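/- Let $Q$ be a smooth $n$-dimensional manifold with a Riemannian metric $\langle\!\langle\cdot,\cdot\rangle\!\rangle$ (the kinetic energy) and a smooth function $U:Q\to\mathbb R$ (the potential energy), let $D\subset TQ$ be a smooth vector subbundle of rank $r$, $2\le r<n$, and let $G$ be a Lie group acting smoothly, freely and properly on $Q$ such that the metric, $U$ and $D$ are $G$-invariant and $T_qQ=D_q\oplus(\mathfrak g\cdot q)$ for all $q\in Q$, where $\mathfrak g\cdot q$ is the tangent space of the orbit through $q$ (a nonholonomic $G$-Chaplygin system with $r$ degrees of freedom). Let $\pi:Q\to S=Q/G$ be the quotient manifold (of dimension $r$), $\mathcal P:TQ\to D$ the orthogonal projector, and $\mathrm{hor}_q:T_{\pi(q)}S\to D_q$ the inverse of $T_q\pi|_{D_q}$. The gyroscopic tensor $\mathcal T$ is the skew-symmetric $(1,2)$ tensor field on $S$ given for vector fields $Y,Z$ on $S$ by $$\mathcal T(Y,Z)(s)=(T_q\pi)\big(\mathcal P[\mathrm{hor}\,Y,\mathrm{hor}\,Z](q)\big)-[Y,Z](s),\qquad \pi(q)=s .$$ Let $\tau_S:T^*S\to S$ be the projection, $\lambda_S$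 the Liouville $1$-form, $\lambda_S(\alpha)(W)=\alpha(T_\alpha\tau_S W)$, $\Omega_{can}=-d\lambda_S$, $\nu=\Omega_{can}^{\,r}$, and $$\Omega_{nh}=\Omega_{can}+\Omega_{\mathcal T},\qquad \Omega_{\mathcal T}(\alpha)(V,W)=\alpha\big(\mathcal T(T_\alpha\tau_S V,T_\alpha\tau_S W)\big).$$ The nonholonomic dynamics is the vector field $X_{nh}[f]=\{f,h_c\}_{D^*}$ on $D^*$, where $\{f,g\}_{D^*}=\{f\circ i_D^*,g\circ i_D^*\}_{T^*Q}\circ\mathcal P^*$ with the canonical Poisson bracket of $T^*Q$, $i_D^*:T^*Q\to D^*$ the restriction of covectors and $\mathcal P^*:D^*\to T^*Q$ the dual of $\mathcal P$, and $h_c=h\circ\mathcal P^*$ with $h(\beta)=\frac12\|\beta\|^2+U(q)$ for $\beta\in T_q^*Q$. It is $G$-equivariant and descends to the reduced vector field $\overline X_{nh}$ on $D^*/G\cong T^*S$, where the class of $\beta\in D_q^*$ corresponds to $u\mapsto\beta(\mathrm{hor}_q u)$ in $T^*_{\pi(q)}S$. The reduced dynamics is said to preserve a volume form $\mu$ on $T^*S$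 if $\mathcal L_{\overline X_{nh}}\mu=0$. For $\phi\in C^\infty(S)$ the system is called $\phi$-simple if $\mathcal T(Y,Z)=Z[\phi]\,Y-Y[\phi]\,Z$ for all smooth vector fields $Y,Z$ on $S$. Then, for every $\phi\in C^\infty(S)$: (i) the system is $\phi$-simple if and only if $\Omega_{nh}$ is conformally symplectic with conformal factor $\exp(\phi\circ\tau_S)$, i.e. $d\big(\exp(\phi\circ\tau_S)\,\Omega_{nh}\big)=0$; (ii) if the system is $\phi$-simple, then the reduced dynamics preserves the basic measure $\exp\big((r-1)\,\phi\circ\tau_S\big)\,\nu$; (iii) if $r=2$ and the reduced dynamics preserves the basic measure $\exp(\phi\circ\tau_S)\,\nu$, then the system is $\phi$-simple. -/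

import Mathlib

open Bundle
open scoped Manifold ContDiff Topology

noncomputable section

namespace Chaplygin

/-! ### Differential forms on manifolds -/

section Forms

variable {E : Type*} [NormedAddCommGroup E] [NormedSpace ℝ E]
  {H : Type*} [TopologicalSpace H] (I : ModelWithCorners ℝ E H)
  (M : Type*) [TopologicalSpace M] [ChartedSpace H M]

/-- Differential forms of degree `k` on `M` (no regularity built in). -/
abbrev DForm (k : ℕ) : Type _ := ∀ x : M, TangentSpace I x [⋀^Fin k]→L[ℝ] ℝ

variable {I M}

/-- The expression of the form `η` in the chart at `x₀`: its pullback under the inverse chart. -/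
def DForm.inChart {k : ℕ} (η : DForm I M k) (x₀ : M) (y : E) : E [⋀^Fin k]→L[ℝ] ℝ :=
  (η ((extChartAt I x₀).symm y)).compContinuousLinearMap
    (mfderivWithin 𝓘(ℝ, E) I (extChartAt I x₀).symm (Set.range I) y)

/-- The exterior derivative of a form, computed at `x₀` in the chart at `x₀`. -/
def DForm.extDer {k : ℕ} (η : DForm I M k) : DForm I M (k + 1) := fun x₀ =>
  (extDerivWithin (η.inChart x₀) (Set.range I) (extChartAt I x₀ x₀)).compContinuousLinearMap
    (mfderiv I 𝓘(ℝ, E) (extChartAt I x₀) x₀)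

/-- The interior product `i_X η = η(X, ·, …, ·)`. -/
def DForm.interior {k : ℕ} (η : DForm I M (k + 1)) (X : ∀ x : M, TangentSpace I x) :
    DForm I M k := fun x =>
  ContinuousAlternatingMap.curryLeft (E := E) (η x) (X x)

/-- The Lie derivative of a form, `L_X η = d (i_X η) + i_X (d η)`. -/
def DForm.lieDer (X : ∀ x : M, TangentSpace I x) : {k : ℕ} → DForm I M k → DForm I M k
  | 0, η => η.extDer.interior X
  | _ + 1, η => fun x => (η.interior X).extDer x + η.extDer.interior X x

/-- A form is closed if its exterior derivative vanishes. -/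
def DForm.IsClosed {k : ℕ} (η : DForm I M k) : Prop := ∀ x, η.extDer x = 0

/-- The vector `X` at `x` with `Ω(X, ·) = dF`; it exists and is unique when `Ω` is
nondegenerate at `x`. -/
def hamVec (Ω : DForm I M 2) (F : M → ℝ) (x : M) : TangentSpace I x :=
  Classical.epsilon fun X => ∀ V : TangentSpace I x, Ω x ![X, V] = mfderiv I 𝓘(ℝ, ℝ) F x V

/-- The bracket `{F, K} = dF(X_K)` attached to a nondegenerate 2-form `Ω`, where
`Ω(X_K, ·) = dK`. -/
def bracket (Ω : DForm I M 2) (F K : M → ℝ) (x : M) : ℝ :=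
  mfderiv I 𝓘(ℝ, ℝ) F x (hamVec Ω K x)

end Forms

section WedgePow

variable {V : Type*} [AddCommGroup V] [Module ℝ V] [TopologicalSpace V]

/-- The multilinear map `v ↦ ∏ᵢ Ω(v_{2i}, v_{2i+1})`. -/
def pairProduct (Ω : V [⋀^Fin 2]→L[ℝ] ℝ) (r : ℕ) :
    ContinuousMultilinearMap ℝ (fun _ : Fin (r * 2) => V) ℝ where
  toFun v := ∏ i : Fin r, Ω fun j => v (finProdFinEquiv (i, j))
  map_update_add' := by
    intro _ v a x y
    obtain ⟨⟨i₀, j₀⟩, rfl⟩ := finProdFinEquiv.surjective a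
    have h₀ : ∀ z, (fun j => Function.update v (finProdFinEquiv (i₀, j₀)) z
        (finProdFinEquiv (i₀, j))) = Function.update (fun j => v (finProdFinEquiv (i₀, j))) j₀ z := by
      intro z
      ext j
      simp [Function.update_apply]
    have h₁ : ∀ z, ∀ i ∈ Finset.univ.erase i₀, (Ω fun j =>
        Function.update v (finProdFinEquiv (i₀, j₀)) z (finProdFinEquiv (i, j))) =
          Ω fun j => v (finProdFinEquiv (i, j)) := by
      intro z i hi
      congr 1
      ext j
      have : i ≠ i₀ := Finset.ne_of_mem_erase hi
      simp [this]
    simp only [← Finset.mul_prod_erase Finset.univ _ (Finset.mem_univ i₀)]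
    rw [Finset.prod_congr rfl (h₁ _), Finset.prod_congr rfl (h₁ x), Finset.prod_congr rfl (h₁ y),
      h₀, h₀, h₀, Ω.map_update_add, add_mul]
  map_update_smul' := by
    intro _ v a c x
    obtain ⟨⟨i₀, j₀⟩, rfl⟩ := finProdFinEquiv.surjective a
    have h₀ : ∀ z, (fun j => Function.update v (finProdFinEquiv (i₀, j₀)) z
        (finProdFinEquiv (i₀, j))) = Function.update (fun j => v (finProdFinEquiv (i₀, j))) j₀ z := by
      intro z
      ext j
      simp [Function.update_apply]
    have h₁ : ∀ z, ∀ i ∈ Finset.univ.erase i₀, (Ω fun j =>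
        Function.update v (finProdFinEquiv (i₀, j₀)) z (finProdFinEquiv (i, j))) =
          Ω fun j => v (finProdFinEquiv (i, j)) := by
      intro z i hi
      congr 1
      ext j
      have : i ≠ i₀ := Finset.ne_of_mem_erase hi
      simp [this]
    simp only [← Finset.mul_prod_erase Finset.univ _ (Finset.mem_univ i₀)]
    rw [Finset.prod_congr rfl (h₁ _), Finset.prod_congr rfl (h₁ x),
      h₀, h₀, Ω.map_update_smul, smul_mul_assoc]
  cont := by
    refine continuous_finsetProd _ fun i _ => Ω.cont.comp ?_
    fun_prop

/-- The `r`-th exterior power `Ω ∧ ⋯ ∧ Ω` of a 2-form on a vector space,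
`(1 / 2 ^ r) ∑_σ sign(σ) ∏ᵢ Ω(v_{σ(2i)}, v_{σ(2i+1)})`. -/
def wedgePow (Ω : V [⋀^Fin 2]→L[ℝ] ℝ) (r : ℕ) : V [⋀^Fin (r * 2)]→L[ℝ] ℝ :=
  ((2 : ℝ) ^ r)⁻¹ • ContinuousMultilinearMap.alternatization (pairProduct Ω r)

end WedgePow

/-! ### Cotangent bundles -/

/-- The model space `ℝⁿ`. -/
abbrev Eu (n : ℕ) : Type := EuclideanSpace ℝ (Fin n)

section Cotangent

variable (n : ℕ) (M : Type*) [TopologicalSpace M] [ChartedSpace (Eu n) M]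

/-- The tangent space `T_x M` of an `n`-dimensional manifold. -/
abbrev Tan {M : Type*} [TopologicalSpace M] [ChartedSpace (Eu n) M] (x : M) : Type :=
  TangentSpace 𝓘(ℝ, Eu n) x

/-- Vector fields on an `n`-dimensional manifold (no regularity built in). -/
abbrev VField : Type _ := ∀ x : M, Tan n x

/-- A tangent vector at `x` as an element of the model space, that is, in the coordinates of the
preferred chart at `x`. -/
def Tan.coord {n : ℕ} {M : Type*} [TopologicalSpace M] [ChartedSpace (Eu n) M] {x : M}
    (v : Tan n x) : Eu n := v

theorem Tan.coord_add {n : ℕ} {M : Type*} [TopologicalSpace M] [ChartedSpace (Eu n) M] {x : M}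
    (v w : Tan n x) (i : Fin n) : (v + w).coord i = v.coord i + w.coord i := rfl

theorem Tan.coord_smul {n : ℕ} {M : Type*} [TopologicalSpace M] [ChartedSpace (Eu n) M] {x : M}
    (c : ℝ) (v : Tan n x) (i : Fin n) : (c • v).coord i = c * v.coord i := rfl

instance {x : M} : FiniteDimensional ℝ (Tan n x) :=
  inferInstanceAs (FiniteDimensional ℝ (Eu n))

instance {x : M} : T2Space (Tan n x) := inferInstanceAs (T2Space (Eu n))

variable [IsManifold 𝓘(ℝ, Eu n) ∞ M]

/-- The cotangent bundle `T*M`, a manifold through Mathlib's bundle of continuous linear maps. -/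
abbrev Cot : Type _ := TotalSpace (Eu n →L[ℝ] ℝ) (fun x : M => Tan n x →L[ℝ] ℝ)

/-- The model with corners of `T*M`. -/
abbrev cotModel : ModelWithCorners ℝ (Eu n × (Eu n →L[ℝ] ℝ)) (ModelProd (Eu n) (Eu n →L[ℝ] ℝ)) :=
  𝓘(ℝ, Eu n).prod 𝓘(ℝ, Eu n →L[ℝ] ℝ)

variable {n M}

/-- A vector field is smooth if it is a smooth section of the tangent bundle. -/
def VField.Smooth (Y : VField n M) : Prop :=
  ContMDiff 𝓘(ℝ, Eu n) 𝓘(ℝ, Eu n).tangent ∞ fun x => (⟨x, Y x⟩ : TangentBundle 𝓘(ℝ, Eu n) M)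

/-- The derivative `Y[φ]` of a function along a vector field. -/
def VField.deriv (Y : VField n M) (φ : M → ℝ) (x : M) : ℝ :=
  mfderiv 𝓘(ℝ, Eu n) 𝓘(ℝ, ℝ) φ x (Y x)

/-- The tangent map `T_α τ` of the projection `τ : T*M → M`. -/
def tauDeriv (α : Cot n M) : TangentSpace (cotModel n) α →L[ℝ] Tan n α.proj :=
  mfderiv (cotModel n) 𝓘(ℝ, Eu n) (fun β : Cot n M => β.proj) α

variable (n M)

/-- The Liouville 1-form `λ(α)(U) = α(Tτ U)` on `T*M`. -/
def liouville : DForm (cotModel n) (Cot n M) 1 := fun α =>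
  ContinuousAlternatingMap.ofSubsingleton ℝ (TangentSpace (cotModel n) α) ℝ (0 : Fin 1)
    (α.2 ∘L tauDeriv α)

/-- The canonical symplectic form `Ω_can = -dλ` on `T*M`. -/
def canForm : DForm (cotModel n) (Cot n M) 2 := fun α => -(liouville n M).extDer α

/-- The Liouville volume form `ν = Ω_can ∧ ⋯ ∧ Ω_can` (`n` factors) on `T*M`. -/
def liouvilleVol : DForm (cotModel n) (Cot n M) (n * 2) := fun α => wedgePow (canForm n M α) n

end Cotangent

/-! ### Chaplygin systems -/

/-- A nonholonomic `G`-Chaplygin system with `r` degrees of freedom on the `n`-dimensional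
configuration manifold `Q`, with shape space `S = Q/G` of dimension `r`. The smooth proper action
of the Lie group `G` on `Q` is given by instances. That `S` is the quotient manifold `Q/G` is
expressed by the surjective submersion `prj = π : Q → S` whose fibres are the `G`-orbits. -/
structure System (n r k : ℕ) (Q S G : Type*)
    [TopologicalSpace Q] [ChartedSpace (Eu n) Q] [IsManifold 𝓘(ℝ, Eu n) ∞ Q]
    [TopologicalSpace S] [ChartedSpace (Eu r) S] [IsManifold 𝓘(ℝ, Eu r) ∞ S]
    [TopologicalSpace G] [ChartedSpace (Eu k) G] [Group G] [LieGroup 𝓘(ℝ, Eu k) ∞ G]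
    [MulAction G Q] [ContMDiffSMul 𝓘(ℝ, Eu k) 𝓘(ℝ, Eu n) ∞ G Q] [ProperSMul G Q] where
  two_le : 2 ≤ r
  lt_dim : r < n
  /-- the kinetic energy metric -/
  metric : ContMDiffRiemannianMetric 𝓘(ℝ, Eu n) ∞ (Eu n) (fun q : Q => Tan n q)
  /-- the potential energy -/
  U : Q → ℝ
  smooth_U : ContMDiff 𝓘(ℝ, Eu n) 𝓘(ℝ, ℝ) ∞ U
  /-- the constraint distribution, a smooth subbundle of `TQ` of rank `r` -/
  D : ∀ q : Q, Submodule ℝ (Tan n q)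
  smooth_D : ∀ q₀ : Q, ∃ (W : Set Q) (X : Fin r → VField n Q), IsOpen W ∧ q₀ ∈ W ∧
    (∀ i, ContMDiffOn 𝓘(ℝ, Eu n) 𝓘(ℝ, Eu n).tangent ∞
      (fun q => (⟨q, X i q⟩ : TangentBundle 𝓘(ℝ, Eu n) Q)) W) ∧
    ∀ q ∈ W, LinearIndependent ℝ (fun i => X i q) ∧
      Submodule.span ℝ (Set.range fun i => X i q) = D q
  free : ∀ (g : G) (q : Q), g • q = q → g = 1
  metric_inv : ∀ (g : G) (q : Q) (v w : Tan n q),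
    metric.inner (g • q) (mfderiv 𝓘(ℝ, Eu n) 𝓘(ℝ, Eu n) (fun p : Q => g • p) q v)
      (mfderiv 𝓘(ℝ, Eu n) 𝓘(ℝ, Eu n) (fun p : Q => g • p) q w) = metric.inner q v w
  U_inv : ∀ (g : G) (q : Q), U (g • q) = U q
  D_inv : ∀ (g : G) (q : Q),
    (D q).map (mfderiv 𝓘(ℝ, Eu n) 𝓘(ℝ, Eu n) (fun p : Q => g • p) q).toLinearMap = D (g • q)
  /-- `T_q Q = D_q ⊕ 𝔤·q`, where `𝔤·q` is the tangent space of the orbit at `q` -/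
  splitting : ∀ q : Q, IsCompl (D q)
    (mfderiv 𝓘(ℝ, Eu k) 𝓘(ℝ, Eu n) (fun g : G => g • q) 1).range
  /-- the principal bundle projection `π : Q → S = Q/G` -/
  prj : Q → S
  smooth_prj : ContMDiff 𝓘(ℝ, Eu n) 𝓘(ℝ, Eu r) ∞ prj
  surjective_prj : Function.Surjective prj
  submersion_prj : ∀ q, Function.Surjective (mfderiv 𝓘(ℝ, Eu n) 𝓘(ℝ, Eu r) prj q)
  fibre_prj : ∀ q q' : Q, prj q = prj q' ↔ ∃ g : G, g • q = q'

namespace System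

variable {n r k : ℕ} {Q S G : Type*}
  [TopologicalSpace Q] [ChartedSpace (Eu n) Q] [IsManifold 𝓘(ℝ, Eu n) ∞ Q]
  [TopologicalSpace S] [ChartedSpace (Eu r) S] [IsManifold 𝓘(ℝ, Eu r) ∞ S]
  [TopologicalSpace G] [ChartedSpace (Eu k) G] [Group G] [LieGroup 𝓘(ℝ, Eu k) ∞ G]
  [MulAction G Q] [ContMDiffSMul 𝓘(ℝ, Eu k) 𝓘(ℝ, Eu n) ∞ G Q] [ProperSMul G Q]
  (C : System n r k Q S G)

/-- The tangent map `T_q π : T_q Q → T_{π(q)} S`. -/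
def dprj (q : Q) : Tan n q →L[ℝ] Tan r (C.prj q) := mfderiv 𝓘(ℝ, Eu n) 𝓘(ℝ, Eu r) C.prj q

/-- The kinetic energy metric at `q` as a bilinear form. -/
def form (q : Q) : LinearMap.BilinForm ℝ (Tan n q) :=
  LinearMap.mk₂ ℝ (fun v w => C.metric.inner q v w) (by simp) (by simp) (by simp) (by simp)

theorem form_apply (q : Q) (v w : Tan n q) : C.form q v w = C.metric.inner q v w := rfl

theorem form_isRefl (q : Q) : (C.form q).IsRefl := fun v w h => by
  rw [form_apply, C.metric.symm]
  exact h

theorem eq_zero_of_form_self (q : Q) {v : Tan n q} (h : C.form q v v = 0) : v = 0 := by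
  by_contra hv
  exact (C.metric.pos q v hv).ne' h

theorem form_nondegenerate (q : Q) : (C.form q).Nondegenerate := by
  refine ⟨fun v h => C.eq_zero_of_form_self q (h v), fun v h => C.eq_zero_of_form_self q (h v)⟩

theorem isCompl_orthogonal (q : Q) : IsCompl (C.D q) ((C.form q).orthogonal (C.D q)) := by
  rw [LinearMap.BilinForm.isCompl_orthogonal_iff_disjoint (C.form_isRefl q),
    Submodule.disjoint_def]
  intro v hv hv'
  exact C.eq_zero_of_form_self q (hv' v hv)

/-- The orthogonal projector `𝒫_q : T_q Q → D_q` (with values in `T_q Q`) of the decomposition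
`T_q Q = D_q ⊕ D_q^⊥`. -/
def proj (q : Q) : Tan n q →L[ℝ] Tan n q :=
  LinearMap.toContinuousLinearMap
    ((C.D q).projection ((C.form q).orthogonal (C.D q)) (C.isCompl_orthogonal q))

theorem finrank_D (q : Q) : Module.finrank ℝ (C.D q) = r := by
  obtain ⟨W, X, -, hq, -, h⟩ := C.smooth_D q
  obtain ⟨hli, hsp⟩ := h q hq
  rw [← hsp, finrank_span_eq_card hli, Fintype.card_fin]

theorem dprj_orbit (q : Q) (ξ : Tan k (1 : G)) :
    C.dprj q (mfderiv 𝓘(ℝ, Eu k) 𝓘(ℝ, Eu n) (fun g : G => g • q) 1 ξ) = 0 := by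
  have hs : MDifferentiableAt 𝓘(ℝ, Eu k) 𝓘(ℝ, Eu n) (fun g : G => g • q) 1 := by
    have h : ContMDiff 𝓘(ℝ, Eu k) 𝓘(ℝ, Eu n) ∞ (fun g : G => g • q) :=
      (contMDiff_smul (I := 𝓘(ℝ, Eu k)) (I' := 𝓘(ℝ, Eu n)) (G := G) (M := Q)).comp
        (contMDiff_id.prodMk contMDiff_const)
    exact h.mdifferentiable (by simp) 1
  have hp : MDifferentiableAt 𝓘(ℝ, Eu n) 𝓘(ℝ, Eu r) C.prj ((1 : G) • q) :=
    C.smooth_prj.mdifferentiable (by simp) _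
  have hc := mfderiv_comp (1 : G) hp hs
  have hconst : C.prj ∘ (fun g : G => g • q) = fun _ => C.prj q := by
    funext g
    exact ((C.fibre_prj q (g • q)).2 ⟨g, rfl⟩).symm
  rw [hconst, mfderiv_const] at hc
  have key : ∀ q' : Q, q' = q → ∀ v : Eu n,
      (mfderiv 𝓘(ℝ, Eu n) 𝓘(ℝ, Eu r) C.prj q' v : Eu r) =
        mfderiv 𝓘(ℝ, Eu n) 𝓘(ℝ, Eu r) C.prj q v := by
    rintro q' rfl v
    rfl
  have h1 := DFunLike.congr_fun hc ξ
  exact (key _ (one_smul G q) _).symm.trans h1.symm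

/-- `T_q π` restricts to an isomorphism `D_q → T_{π(q)} S`. -/
theorem bijective_dprj (q : Q) :
    Function.Bijective ((C.dprj q).toLinearMap ∘ₗ (C.D q).subtype) := by
  have hsurj : Function.Surjective ((C.dprj q).toLinearMap ∘ₗ (C.D q).subtype) := by
    intro u
    obtain ⟨v, hv⟩ := C.submersion_prj q u
    obtain ⟨d, hd, w, ⟨ξ, hξ⟩, rfl⟩ :=
      Submodule.mem_sup.1 ((C.splitting q).sup_eq_top ▸ Submodule.mem_top : v ∈ _ ⊔ _)
    refine ⟨⟨d, hd⟩, ?_⟩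
    have hw : C.dprj q w = 0 := by
      rw [← hξ]
      exact C.dprj_orbit q ξ
    have h2 : C.dprj q (d + w) = u := hv
    rw [map_add, hw, add_zero] at h2
    exact h2
  have hdim : Module.finrank ℝ (C.D q) = Module.finrank ℝ (Tan r (C.prj q)) := by
    rw [C.finrank_D q]
    exact (finrank_euclideanSpace_fin (𝕜 := ℝ) (n := r)).symm
  exact ⟨(LinearMap.injective_iff_surjective_of_finrank_eq_finrank hdim).2 hsurj, hsurj⟩

/-- The horizontal lift `hor_q : T_{π(q)} S → D_q ⊆ T_q Q`, inverse to `T_q π` on `D_q`. -/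
def hor (q : Q) : Tan r (C.prj q) →L[ℝ] Tan n q :=
  LinearMap.toContinuousLinearMap
    ((C.D q).subtype ∘ₗ (LinearEquiv.ofBijective _ (C.bijective_dprj q)).symm.toLinearMap)

/-- The horizontal lift of a vector field on `S`. -/
def horField (Y : VField r S) : VField n Q := fun q => C.hor q (Y (C.prj q))

/-- A point of `Q` over `s`. -/
def pt (s : S) : Q := Function.surjInv C.surjective_prj s

/-- `(T_q π)(𝒫[hor Y, hor Z](q)) - [Y, Z](π(q))`. -/
def gyroOver (Y Z : VField r S) (q : Q) : Tan r (C.prj q) :=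
  C.dprj q (C.proj q (VectorField.mlieBracket 𝓘(ℝ, Eu n) (C.horField Y) (C.horField Z) q)) -
    VectorField.mlieBracket 𝓘(ℝ, Eu r) Y Z (C.prj q)

/-- The gyroscopic tensor `𝒯(Y, Z)(s)` of two vector fields, computed at a point `q` over `s`
(for vector fields that are smooth near `s` the choice of `q` does not matter). As `π(q) = s`,
the tangent spaces at `π(q)` and at `s` are the same. -/
def gyro (Y Z : VField r S) : VField r S := fun s => Tan.coord (C.gyroOver Y Z (C.pt s))

theorem gyro_swap (Y Z : VField r S) (s : S) : C.gyro Y Z s = -C.gyro Z Y s := by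
  have h : C.gyroOver Y Z (C.pt s) = -C.gyroOver Z Y (C.pt s) := by
    unfold gyroOver
    rw [VectorField.mlieBracket_swap_apply (V := C.horField Y),
      VectorField.mlieBracket_swap_apply (V := Y)]
    simp only [map_neg]
    abel
  exact h

/-- The coordinate vector field `∂/∂sⁱ` of the chart at `s₀`. -/
def coordField (s₀ : S) (i : Fin r) : VField r S :=
  FiberBundle.extend (Eu r) (x := s₀)
    (show Tan r s₀ from (EuclideanSpace.single i (1 : ℝ) : Eu r))

/-- The gyroscopic tensor on tangent vectors at `s`: the value `∑ᵢⱼ uⁱ vʲ 𝒯(∂ᵢ, ∂ⱼ)(s)` that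
bilinearity over `C^∞(S)` assigns to `u, v ∈ T_s S`, in the coordinates of the chart at `s`. -/
def gyroAt (s : S) : Tan r s [⋀^Fin 2]→L[ℝ] Tan r s where
  toFun v := ∑ i : Fin r, ∑ j : Fin r,
    (Tan.coord (v 0) i * Tan.coord (v 1) j) • C.gyro (coordField s i) (coordField s j) s
  map_update_add' := by
    intro _ v a x y
    fin_cases a <;> simp [Tan.coord_add, add_mul, mul_add, add_smul, Finset.sum_add_distrib]
  map_update_smul' := by
    intro _ v a c x
    fin_cases a <;>
      simp [Tan.coord_smul, mul_smul, Finset.smul_sum, smul_comm _ c]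
  map_eq_zero_of_eq' := by
    intro v a b hab hne
    have h01 : v 0 = v 1 := by
      fin_cases a <;> fin_cases b <;> simp_all
    have hanti : ∀ i j, C.gyro (coordField s i) (coordField s j) s =
        -C.gyro (coordField s j) (coordField s i) s := fun i j => C.gyro_swap _ _ s
    have h2 : ∀ x : Tan r s, x = -x → x = 0 := fun x hx => by
      have h3 : (2 : ℝ) • x = 0 := by
        rw [two_smul]
        nth_rewrite 2 [hx]
        exact add_neg_cancel x
      simpa using h3
    refine h2 _ ?_
    rw [h01]
    conv_lhs => rw [Finset.sum_comm]
    rw [← Finset.sum_neg_distrib]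
    refine Finset.sum_congr rfl fun i _ => ?_
    rw [← Finset.sum_neg_distrib]
    refine Finset.sum_congr rfl fun j _ => ?_
    rw [hanti j i, smul_neg, mul_comm]
  cont := by
    have h : ∀ i : Fin r, Continuous fun v : Tan r s => Tan.coord v i := fun i =>
      (EuclideanSpace.proj (𝕜 := ℝ) i : Eu r →L[ℝ] ℝ).continuous
    refine continuous_finsetSum _ fun i _ => continuous_finsetSum _ fun j _ => ?_
    exact (((h i).comp (continuous_apply 0)).mul ((h j).comp (continuous_apply 1))).smul
      continuous_const

/-- The gyroscopic 2-form `Ω_𝒯(α)(U, V) = α(𝒯(Tτ U, Tτ V))` on `T*S`. -/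
def gyroForm : DForm (cotModel r) (Cot r S) 2 := fun α =>
  ((α.2 : Tan r α.proj →L[ℝ] ℝ).compContinuousAlternatingMap
    (C.gyroAt α.proj)).compContinuousLinearMap (tauDeriv α)

/-- The almost symplectic form `Ω_nh = Ω_can + Ω_𝒯` on `T*S`. -/
def nhForm : DForm (cotModel r) (Cot r S) 2 := fun α => canForm r S α + C.gyroForm α

/-- The system is `φ`-simple: `𝒯(Y, Z) = Z[φ] Y - Y[φ] Z` for all smooth vector fields. -/
def IsSimple (φ : S → ℝ) : Prop :=
  ∀ Y Z : VField r S, Y.Smooth → Z.Smooth → ∀ s,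
    C.gyro Y Z s = Z.deriv φ s • Y s - Y.deriv φ s • Z s

/-! ### The reduced dynamics -/

/-- The metric dual `β^♯ ∈ T_q Q` of a covector `β`: `⟪β^♯, v⟫ = β(v)`. -/
def sharp (q : Q) (β : Tan n q →L[ℝ] ℝ) : Tan n q :=
  ((C.form q).toDual (C.form_nondegenerate q)).symm β.toLinearMap

/-- The Hamiltonian `h(β) = ‖β‖² / 2 + U(q)` on `T*Q`, where `‖β‖² = β(β^♯)`. -/
def ham (β : Cot n Q) : ℝ := 1 / 2 * β.2 (C.sharp β.proj β.2) + C.U β.proj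

/-- The function `h_c ∘ i_D^*` on `T*Q`, where `i_D^* : T*Q → D*` is the restriction of covectors
to `D` and `h_c = h ∘ 𝒫^*` is the constrained Hamiltonian on `D*`: it maps `β` to `h(β ∘ 𝒫)`. -/
def constrainedHam (β : Cot n Q) : ℝ := C.ham ⟨β.proj, β.2 ∘L C.proj β.proj⟩

/-- The composition `T*Q → D* → D*/G ≅ T*S` of the restriction to `D` and the orbit projection:
it maps `β ∈ T_q^*Q` to the covector `u ↦ β(hor_q u)` at `π(q)`. -/
def red (β : Cot n Q) : Cot r S := ⟨C.prj β.proj, β.2 ∘L C.hor β.proj⟩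

/-- For `α ∈ T*_{π(q)} S`, the element `𝒫^*(b)` of `T*_q Q`, where `b = (α ∘ T_q π)|_{D_q}` is the
element of `D*_q` that represents `α` under `D*/G ≅ T*S`. -/
def lift (q : Q) (α : Tan r (C.prj q) →L[ℝ] ℝ) : Cot n Q := ⟨q, (α ∘L C.dprj q) ∘L C.proj q⟩

/-- `X` is the reduced nonholonomic vector field on `T*S ≅ D*/G`: as a derivation it is
`X[f] = {f, H}`, where the reduced bracket is induced by the nonholonomic bracket
`{a, b}_{D*} = {a ∘ i_D^*, b ∘ i_D^*}_{T*Q} ∘ 𝒫^*` on `D*`. -/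
def IsReducedDynamics (X : ∀ α : Cot r S, TangentSpace (cotModel r) α) : Prop :=
  ∀ (q : Q) (α : Tan r (C.prj q) →L[ℝ] ℝ) (f : Cot r S → ℝ),
    ContMDiffAt (cotModel r) 𝓘(ℝ, ℝ) ∞ f ⟨C.prj q, α⟩ →
      mfderiv (cotModel r) 𝓘(ℝ, ℝ) f ⟨C.prj q, α⟩ (X ⟨C.prj q, α⟩) =
        bracket (canForm n Q) (f ∘ C.red) C.constrainedHam (C.lift q α)

/-- The reduced nonholonomic vector field on `T*S`. -/
def reducedField : ∀ α : Cot r S, TangentSpace (cotModel r) α :=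
  Classical.epsilon C.IsReducedDynamics

/-- The reduced equations of motion preserve the basic measure `exp(σ ∘ τ) ν` on `T*S`. -/
def PreservesBasicMeasure (σ : S → ℝ) : Prop :=
  ∀ α : Cot r S, DForm.lieDer C.reducedField
    (fun β : Cot r S => Real.exp (σ β.proj) • liouvilleVol r S β) α = 0

end System

end Chaplygin

end

noncomputable section

namespace Chaplygin

/-! ### Differential forms in charts -/

section FormsInCharts

variable {E : Type*} [NormedAddCommGroup E] [NormedSpace ℝ E]
  {H : Type*} [TopologicalSpace H] {I : ModelWithCorners ℝ E H}
  {M : Type*} [TopologicalSpace M] [ChartedSpace H M]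

/-! Everything is local, so the proof works in a chart of `S` at `s`, with coordinates `z = (x, p)`
on `T*S`. There the canonical form is the constant form `dx ∧ dp` (`inChart_canForm`), the
gyroscopic tensor is a smooth family `B x` of skew bilinear maps, and the reduced Hamiltonian is `½
p(K x p) + V x` with `K x` symmetric and invertible (`exists_isCoordinateModel`). Thus `Ω_nh = dx ∧
dp + p(B x (·, ·))`, and being `φ`-simple means `B x u v = dφ(v) u - dφ(u) v` at every point
(`isSimple_iff`, `simple_chart_iff`).

For (i): if `B` has this shape, then `exp(φ) Ω_nh = -d(exp(φ) p dx)`, which is closed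
(`extDeriv_conformal_eq_zero`). Conversely, evaluating `d(exp(φ) Ω_nh)` on two vectors `(u, 0)`,
`(v, 0)` and a fibre vector `(0, b)` gives `exp(φ)` times `b(B(u, v)) - dφ(v) b(u) + dφ(u) b(v)`, so
closedness returns the shape of `B` (`eq_of_extDeriv_conformal_eq_zero`).

For (ii) and (iii) the dynamics is needed. It is defined through the canonical bracket of `T*Q`;
pushing the canonical Hamiltonian vector forward to `T*S` shows that the reduced field `X` satisfies
`Ω_nh(X, ·) = dH` (`form_eq_of_reduction`, `nhForm_reducedField`). The gyroscopic term arises from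
differentiating the horizontal lift in the reduction map. In coordinates this reads `x' = K p`,
`p'(v) = p(B(K p, v)) - ∂H/∂x(v)`. The Lie derivative of `exp(σ) ν` is the divergence of `exp(σ) X`
times the constant volume form (`DForm.lieDer_top`). The mixed second derivatives of `H` cancel, and
the contraction of the symmetric `K` with the skew `B` vanishes, leaving `exp(σ)` times `dσ(K p) +
tr B(K p, ·)` (`trace_fderiv_reduced`).

For a `φ`-simple system `tr B(w, ·) = -(r - 1) dφ(w)` (`sum_simple`), so `σ = (r - 1) φ` is
preserved. If `r = 2` and `exp(φ) ν` is preserved, then, since `ν` does not vanish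
(`wedgePow_modelCan_ne_zero`) and `K p` takes every value `w`, the trace of `B(w, ·)` is `-dφ(w)`
for all `w`. On a plane a skew bilinear map is determined by this trace (`eq_of_trace_eq`), which
gives simplicity. -/

theorem DForm.compContinuousLinearMap_congr {k : ℕ} (η : DForm I M k) {p p' : M} (h : p = p')
    (A A' : E →L[ℝ] E) (hA : A = A') :
    (show E [⋀^Fin k]→L[ℝ] ℝ from η p).compContinuousLinearMap A =
      (show E [⋀^Fin k]→L[ℝ] ℝ from η p').compContinuousLinearMap A' := by
  subst h hA
  rfl

variable [I.Boundaryless]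

theorem DForm.inChart_eq {k : ℕ} (η : DForm I M k) (x₀ : M) (y : E) :
    η.inChart x₀ y = (η ((extChartAt I x₀).symm y)).compContinuousLinearMap
      (mfderiv 𝓘(ℝ, E) I (extChartAt I x₀).symm y) := by
  simp only [DForm.inChart, I.range_eq_univ, mfderivWithin_univ]
  rfl

theorem eventually_mem_chart_change {x x₀ : M} {y : E} (hy : y ∈ (extChartAt I x₀).target)
    (hx : (extChartAt I x₀).symm y ∈ (extChartAt I x).source) :
    ∀ᶠ z in 𝓝 y, z ∈ (extChartAt I x₀).target ∧
      (extChartAt I x₀).symm z ∈ (extChartAt I x).source := by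
  refine ((isOpen_extChartAt_target x₀).mem_nhds hy |> Filter.Eventually.and) ?_
  exact (continuousAt_extChartAt_symm'' hy).eventually
    ((isOpen_extChartAt_source x).mem_nhds hx)

variable [IsManifold I ∞ M]

theorem mdifferentiableAt_extChartAt_symm {x₀ : M} {y : E} (hy : y ∈ (extChartAt I x₀).target) :
    MDifferentiableAt 𝓘(ℝ, E) I (extChartAt I x₀).symm y := by
  have : IsManifold I 1 M := .of_le (n := ∞) (by simp)
  have := mdifferentiableWithinAt_extChartAt_symm hy
  rwa [I.range_eq_univ, mdifferentiableWithinAt_univ] at this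

theorem contDiffAt_chart_change {x x₀ : M} {y : E} (hy : y ∈ (extChartAt I x₀).target)
    (hx : (extChartAt I x₀).symm y ∈ (extChartAt I x).source) :
    ContDiffAt ℝ ∞ (extChartAt I x ∘ (extChartAt I x₀).symm) y := by
  have h := contDiffWithinAt_ext_coord_change (I := I) (n := ∞) x x₀ (y := y)
    (by simp only [PartialEquiv.trans_source, PartialEquiv.symm_source]; exact ⟨hy, hx⟩)
  rwa [I.range_eq_univ, contDiffWithinAt_univ] at h

theorem fderiv_chart_change {x x₀ : M} {y : E} (hy : y ∈ (extChartAt I x₀).target)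
    (hx : (extChartAt I x₀).symm y ∈ (extChartAt I x).source) :
    fderiv ℝ (extChartAt I x ∘ (extChartAt I x₀).symm) y =
      (mfderiv I 𝓘(ℝ, E) (extChartAt I x) ((extChartAt I x₀).symm y)).comp
        (mfderiv 𝓘(ℝ, E) I (extChartAt I x₀).symm y) := by
  have : IsManifold I 1 M := .of_le (n := ∞) (by simp)
  rw [← mfderiv_eq_fderiv]
  exact mfderiv_comp y (mdifferentiableAt_extChartAt (by rwa [← extChartAt_source I]))
    (mdifferentiableAt_extChartAt_symm hy)

/-- The expressions of a form in two charts are related by the pullback under the change of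
charts. -/
theorem DForm.inChart_chart_change {k : ℕ} (η : DForm I M k) {x x₀ : M} {y : E}
    (hy : y ∈ (extChartAt I x₀).target)
    (hx : (extChartAt I x₀).symm y ∈ (extChartAt I x).source) :
    η.inChart x₀ y =
      (η.inChart x ((extChartAt I x ∘ (extChartAt I x₀).symm) y)).compContinuousLinearMap
      (fderiv ℝ (extChartAt I x ∘ (extChartAt I x₀).symm) y) := by
  have : IsManifold I 1 M := .of_le (n := ∞) (by simp)
  set f := extChartAt I x ∘ (extChartAt I x₀).symm with hf
  have hfy : f y ∈ (extChartAt I x).target := (extChartAt I x).map_source hx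
  have hpt : (extChartAt I x₀).symm y = (extChartAt I x).symm (f y) :=
    ((extChartAt I x).left_inv hx).symm
  have hder : (mfderiv 𝓘(ℝ, E) I (extChartAt I x₀).symm y : E →L[ℝ] E) =
      (mfderiv 𝓘(ℝ, E) I (extChartAt I x).symm (f y) : E →L[ℝ] E).comp (fderiv ℝ f y) := by
    have h1 : (extChartAt I x₀).symm =ᶠ[𝓝 y] (extChartAt I x).symm ∘ f := by
      filter_upwards [eventually_mem_chart_change hy hx] with z hz
      exact ((extChartAt I x).left_inv hz.2).symm
    rw [h1.mfderiv_eq]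
    have h2 := mfderiv_comp y (mdifferentiableAt_extChartAt_symm hfy)
      ((contDiffAt_chart_change hy hx).differentiableAt (by simp)).mdifferentiableAt
    rw [h2]
    erw [mfderiv_eq_fderiv]
    rfl
  rw [DForm.inChart_eq, DForm.inChart_eq]
  exact DForm.compContinuousLinearMap_congr η hpt _ _ hder

theorem DForm.differentiableAt_inChart_chart_change {k : ℕ} (η : DForm I M k) {x x₀ : M} {y : E}
    (hy : y ∈ (extChartAt I x₀).target)
    (hx : (extChartAt I x₀).symm y ∈ (extChartAt I x).source)
    (hη : DifferentiableAt ℝ (η.inChart x) ((extChartAt I x ∘ (extChartAt I x₀).symm) y)) :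
    DifferentiableAt ℝ (η.inChart x₀) y := by
  have hev : η.inChart x₀ =ᶠ[𝓝 y] fun z =>
      (η.inChart x ((extChartAt I x ∘ (extChartAt I x₀).symm) z)).compContinuousLinearMap
        (fderiv ℝ (extChartAt I x ∘ (extChartAt I x₀).symm) z) := by
    filter_upwards [eventually_mem_chart_change hy hx] with z hz
    exact η.inChart_chart_change hz.1 hz.2
  refine DifferentiableAt.congr_of_eventuallyEq ?_ hev
  have hc := contDiffAt_chart_change hy hx
  have hd : DifferentiableAt ℝ (fderiv ℝ (extChartAt I x ∘ (extChartAt I x₀).symm)) y :=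
    (hc.fderiv_right (m := 1) (by norm_cast)).differentiableAt (by simp)
  exact
    (hη.comp y (hc.differentiableAt (by simp))).continuousAlternatingMapCompContinuousLinearMap hd

/-- The chart at `x` has the identity as its derivative at `x`, because `TangentSpace I x` is the
model space read in that very chart. Hence no pullback remains. -/
theorem DForm.extDer_eq {k : ℕ} (η : DForm I M k) (x : M) :
    η.extDer x = extDeriv (η.inChart x) (extChartAt I x x) := by
  have : IsManifold I 1 M := .of_le (n := ∞) (by simp)
  unfold DForm.extDer
  rw [mfderiv_extChartAt_self, I.range_eq_univ, extDerivWithin_univ]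
  rfl

/-- The exterior derivative of a form may be computed in any chart. -/
theorem DForm.inChart_extDer {k : ℕ} (η : DForm I M k) {x₀ : M} {y : E}
    (hy : y ∈ (extChartAt I x₀).target) (hη : DifferentiableAt ℝ (η.inChart x₀) y) :
    η.extDer.inChart x₀ y = extDeriv (η.inChart x₀) y := by
  have : IsManifold I 1 M := .of_le (n := ∞) (by simp)
  set x := (extChartAt I x₀).symm y with hxdef
  have hx : (extChartAt I x₀).symm y ∈ (extChartAt I x).source := mem_extChartAt_source x
  have hx₀ : x ∈ (extChartAt I x₀).source := (extChartAt I x₀).map_target hy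
  set f := extChartAt I x ∘ (extChartAt I x₀).symm with hf
  -- `η.extDer` at `x` is computed in the chart at `x`, a different chart for each point. The two
  -- expressions are compared through the change of charts, and `extDeriv` commutes with that
  -- pullback.
  have hev : η.inChart x₀ =ᶠ[𝓝 y] fun z =>
      (η.inChart x (f z)).compContinuousLinearMap (fderiv ℝ f z) := by
    filter_upwards [eventually_mem_chart_change hy hx] with z hz
    exact η.inChart_chart_change hz.1 hz.2
  have hfy : f y ∈ (extChartAt I x).target := (extChartAt I x).map_source hx
  have hfy' : (extChartAt I x).symm (f y) = x := (extChartAt I x).left_inv hx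
  have hηx : DifferentiableAt ℝ (η.inChart x) (f y) := by
    refine η.differentiableAt_inChart_chart_change (x := x₀) hfy (by rwa [hfy']) ?_
    simp only [Function.comp_apply, hfy']
    rwa [hxdef, (extChartAt I x₀).right_inv hy]
  rw [hev.extDeriv_eq, extDeriv_pullback hηx (contDiffAt_chart_change hy hx) (by simp; norm_cast),
    fderiv_chart_change hy hx, DForm.inChart_eq]
  rw [← hxdef, mfderiv_extChartAt_self, DForm.extDer_eq]
  rfl

theorem DForm.isClosed_iff {k : ℕ} (η : DForm I M k) :
    η.IsClosed ↔ ∀ x, extDeriv (η.inChart x) (extChartAt I x x) = 0 := by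
  simp only [DForm.IsClosed, DForm.extDer_eq]
  rfl

end FormsInCharts

/-! ### Tangent vectors and covectors in charts -/

section TangentCoordinates

variable {m : ℕ} {M : Type*} [TopologicalSpace M] [ChartedSpace (Eu m) M]
  [IsManifold 𝓘(ℝ, Eu m) ∞ M]

/-- The coordinates, in the chart at `x₀`, of a tangent vector at `x`. -/
def toChart (x₀ x : M) : Tan m x →L[ℝ] Eu m :=
  (trivializationAt (Eu m) (TangentSpace 𝓘(ℝ, Eu m) : M → Type _) x₀).continuousLinearMapAt ℝ x

/-- The tangent vector at `x` with given coordinates in the chart at `x₀`. -/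
def ofChart (x₀ x : M) : Eu m →L[ℝ] Tan m x :=
  (trivializationAt (Eu m) (TangentSpace 𝓘(ℝ, Eu m) : M → Type _) x₀).symmL ℝ x

theorem toChart_ofChart {x₀ x : M} (hx : x ∈ (chartAt (Eu m) x₀).source) (v : Eu m) :
    toChart x₀ x (ofChart x₀ x v) = v :=
  Trivialization.continuousLinearMapAt_symmL _ (by simpa using hx) v

theorem ofChart_toChart {x₀ x : M} (hx : x ∈ (chartAt (Eu m) x₀).source) (v : Tan m x) :
    ofChart x₀ x (toChart x₀ x v) = v :=
  Trivialization.symmL_continuousLinearMapAt _ (by simpa using hx) v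

theorem toChart_eq_mfderiv {x₀ x : M} (hx : x ∈ (chartAt (Eu m) x₀).source) :
    toChart x₀ x = mfderiv 𝓘(ℝ, Eu m) 𝓘(ℝ, Eu m) (extChartAt 𝓘(ℝ, Eu m) x₀) x := by
  have : IsManifold 𝓘(ℝ, Eu m) 1 M := .of_le (n := ∞) (by simp)
  exact TangentBundle.continuousLinearMapAt_trivializationAt hx

theorem toChart_self (x : M) (v : Tan m x) : toChart x x v = v := by
  have : IsManifold 𝓘(ℝ, Eu m) 1 M := .of_le (n := ∞) (by simp)
  rw [toChart_eq_mfderiv (mem_chart_source _ x), mfderiv_extChartAt_self]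
  rfl

theorem ofChart_self (x : M) (v : Eu m) : ofChart x x v = v := by
  have h := toChart_self x (ofChart x x v)
  rw [toChart_ofChart (mem_chart_source _ x)] at h
  exact h.symm

theorem toChart_mfderiv_extChartAt_symm {x₀ : M} {y : Eu m}
    (hy : y ∈ (extChartAt 𝓘(ℝ, Eu m) x₀).target) (v : Eu m) :
    toChart x₀ ((extChartAt 𝓘(ℝ, Eu m) x₀).symm y)
      (mfderiv 𝓘(ℝ, Eu m) 𝓘(ℝ, Eu m) (extChartAt 𝓘(ℝ, Eu m) x₀).symm y v) = v := by
  have : IsManifold 𝓘(ℝ, Eu m) 1 M := .of_le (n := ∞) (by simp)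
  have hx : (extChartAt 𝓘(ℝ, Eu m) x₀).symm y ∈ (chartAt (Eu m) x₀).source := by
    rw [← extChartAt_source 𝓘(ℝ, Eu m)]
    exact (extChartAt 𝓘(ℝ, Eu m) x₀).map_target hy
  have h := mfderiv_extChartAt_comp_mfderivWithin_extChartAt_symm hy
  rw [ModelWithCorners.range_eq_univ, mfderivWithin_univ] at h
  rw [toChart_eq_mfderiv hx]
  exact DFunLike.congr_fun h v

theorem mfderiv_extChartAt_symm_apply {x₀ : M} {y : Eu m}
    (hy : y ∈ (extChartAt 𝓘(ℝ, Eu m) x₀).target) (v : Eu m) :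
    mfderiv 𝓘(ℝ, Eu m) 𝓘(ℝ, Eu m) (extChartAt 𝓘(ℝ, Eu m) x₀).symm y v =
      ofChart x₀ ((extChartAt 𝓘(ℝ, Eu m) x₀).symm y) v := by
  have hx : (extChartAt 𝓘(ℝ, Eu m) x₀).symm y ∈ (chartAt (Eu m) x₀).source := by
    rw [← extChartAt_source 𝓘(ℝ, Eu m)]
    exact (extChartAt 𝓘(ℝ, Eu m) x₀).map_target hy
  rw [← ofChart_toChart hx (mfderiv _ _ _ _ v), toChart_mfderiv_extChartAt_symm hy]

end TangentCoordinates

theorem contDiff_ofSubsingleton {E F : Type*} [NormedAddCommGroup E] [NormedSpace ℝ E]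
    [NormedAddCommGroup F] [NormedSpace ℝ F] {f : F → E →L[ℝ] ℝ} (hf : ContDiff ℝ ∞ f) :
    ContDiff ℝ ∞ fun z => ContinuousAlternatingMap.ofSubsingleton ℝ E ℝ (0 : Fin 1) (f z) :=
  (ContinuousAlternatingMap.ofSubsingletonLIE (𝕜 := ℝ) (E := E) (F := ℝ)
    (0 : Fin 1)).contDiff.comp hf

section CotangentCharts

variable {m : ℕ} {M : Type*} [TopologicalSpace M] [ChartedSpace (Eu m) M]
  [IsManifold 𝓘(ℝ, Eu m) ∞ M]

theorem extChartAt_cot_apply (α₀ α : Cot m M) :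
    extChartAt (cotModel m) α₀ α =
      (extChartAt 𝓘(ℝ, Eu m) α₀.proj α.proj, α.2 ∘L ofChart α₀.proj α.proj) := by
  rw [FiberBundle.extChartAt]
  refine Prod.ext rfl ?_
  ext v
  exact DFunLike.congr_fun (Bundle.Trivial.continuousLinearMapAt_trivialization ℝ M ℝ α.proj)
    (α.2 (ofChart α₀.proj α.proj v))

theorem extChartAt_cot_source (α₀ : Cot m M) :
    (extChartAt (cotModel m) α₀).source = {α | α.proj ∈ (chartAt (Eu m) α₀.proj).source} := by
  ext α
  rw [extChartAt_source, FiberBundle.chartedSpace_chartAt]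
  simp only [OpenPartialHomeomorph.trans_toPartialEquiv, PartialEquiv.trans_source]
  simp
  exact fun h => h

theorem extChartAt_cot_target (α₀ : Cot m M) :
    (extChartAt (cotModel m) α₀).target =
      (extChartAt 𝓘(ℝ, Eu m) α₀.proj).target ×ˢ Set.univ := by
  rw [FiberBundle.extChartAt_target]
  congr 1
  refine Set.inter_eq_left.2 fun y hy => ?_
  have h := (extChartAt 𝓘(ℝ, Eu m) α₀.proj).map_target hy
  rw [extChartAt_source] at h
  simpa using h

theorem extChartAt_cot_symm_apply (α₀ : Cot m M) {z : Eu m × (Eu m →L[ℝ] ℝ)}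
    (hz : z.1 ∈ (extChartAt 𝓘(ℝ, Eu m) α₀.proj).target) :
    (extChartAt (cotModel m) α₀).symm z =
      ⟨(extChartAt 𝓘(ℝ, Eu m) α₀.proj).symm z.1,
        z.2 ∘L toChart α₀.proj ((extChartAt 𝓘(ℝ, Eu m) α₀.proj).symm z.1)⟩ := by
  have hs : (extChartAt 𝓘(ℝ, Eu m) α₀.proj).symm z.1 ∈ (chartAt (Eu m) α₀.proj).source := by
    rw [← extChartAt_source 𝓘(ℝ, Eu m)]
    exact (extChartAt 𝓘(ℝ, Eu m) α₀.proj).map_target hz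
  have hmem : (⟨(extChartAt 𝓘(ℝ, Eu m) α₀.proj).symm z.1,
        z.2 ∘L toChart α₀.proj ((extChartAt 𝓘(ℝ, Eu m) α₀.proj).symm z.1)⟩ : Cot m M) ∈
      (extChartAt (cotModel m) α₀).source := by
    rw [extChartAt_cot_source]
    exact hs
  rw [← (extChartAt (cotModel m) α₀).left_inv hmem, extChartAt_cot_apply]
  congr 1
  refine Prod.ext ((extChartAt 𝓘(ℝ, Eu m) α₀.proj).right_inv hz).symm ?_
  ext v
  exact congrArg z.2 (toChart_ofChart hs v).symm

theorem extChartAt_cot_symm_proj (α₀ : Cot m M) {z : Eu m × (Eu m →L[ℝ] ℝ)}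
    (hz : z.1 ∈ (extChartAt 𝓘(ℝ, Eu m) α₀.proj).target) :
    ((extChartAt (cotModel m) α₀).symm z).proj =
      (extChartAt 𝓘(ℝ, Eu m) α₀.proj).symm z.1 := by
  rw [extChartAt_cot_symm_apply α₀ hz]

theorem extChartAt_cot_symm_snd_apply (α₀ : Cot m M) {z : Eu m × (Eu m →L[ℝ] ℝ)}
    (hz : z.1 ∈ (extChartAt 𝓘(ℝ, Eu m) α₀.proj).target)
    (v : Tan m ((extChartAt (cotModel m) α₀).symm z).proj) :
    ((extChartAt (cotModel m) α₀).symm z).2 v =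
      z.2 (toChart α₀.proj ((extChartAt (cotModel m) α₀).symm z).proj v) := by
  have h := extChartAt_cot_symm_apply α₀ hz
  revert v
  rw [h]
  intro v
  rfl

theorem mdifferentiableAt_cot_proj (α : Cot m M) :
    MDifferentiableAt (cotModel m) 𝓘(ℝ, Eu m) (fun β : Cot m M => β.proj) α :=
  (contMDiff_proj (n := ∞) (IB := 𝓘(ℝ, Eu m)) (F := Eu m →L[ℝ] ℝ)
    (fun x : M => Tan m x →L[ℝ] ℝ)).mdifferentiable (by simp) α

/-- In the chart at `α₀`, the tangent map of `τ` is the first projection. -/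
theorem toChart_tauDeriv (α₀ : Cot m M) {z : Eu m × (Eu m →L[ℝ] ℝ)}
    (hz : z.1 ∈ (extChartAt 𝓘(ℝ, Eu m) α₀.proj).target) (w : Eu m × (Eu m →L[ℝ] ℝ)) :
    toChart α₀.proj ((extChartAt (cotModel m) α₀).symm z).proj
      (tauDeriv ((extChartAt (cotModel m) α₀).symm z)
        (mfderiv 𝓘(ℝ, Eu m × (Eu m →L[ℝ] ℝ)) (cotModel m)
          (extChartAt (cotModel m) α₀).symm z w)) = w.1 := by
  have : IsManifold 𝓘(ℝ, Eu m) 1 M := .of_le (n := ∞) (by simp)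
  have hzt : z ∈ (extChartAt (cotModel m) α₀).target := by
    rw [extChartAt_cot_target]
    exact ⟨hz, trivial⟩
  have hs : ((extChartAt (cotModel m) α₀).symm z).proj ∈ (chartAt (Eu m) α₀.proj).source := by
    have := (extChartAt (cotModel m) α₀).map_target hzt
    rwa [extChartAt_cot_source] at this
  rw [toChart_eq_mfderiv hs]
  have h1 := mfderiv_comp z (mdifferentiableAt_cot_proj ((extChartAt (cotModel m) α₀).symm z))
    (mdifferentiableAt_extChartAt_symm hzt)
  have h2 := mfderiv_comp z (g := extChartAt 𝓘(ℝ, Eu m) α₀.proj)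
    (mdifferentiableAt_extChartAt hs)
    ((mdifferentiableAt_cot_proj ((extChartAt (cotModel m) α₀).symm z)).comp z
      (mdifferentiableAt_extChartAt_symm hzt))
  -- Read in the bundle chart and the base chart, the bundle projection is `Prod.fst`; the chain
  -- rule then gives its tangent map.
  have h3 : extChartAt 𝓘(ℝ, Eu m) α₀.proj ∘ (fun β : Cot m M => β.proj) ∘
      (extChartAt (cotModel m) α₀).symm =ᶠ[𝓝 z] Prod.fst := by
    have hopen : (extChartAt (cotModel m) α₀).target ∈ 𝓝 z :=
      (isOpen_extChartAt_target α₀).mem_nhds hzt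
    filter_upwards [hopen] with z' hz'
    rw [extChartAt_cot_target] at hz'
    simp only [Function.comp_apply]
    rw [extChartAt_cot_symm_proj α₀ hz'.1, (extChartAt 𝓘(ℝ, Eu m) α₀.proj).right_inv hz'.1]
  rw [h3.mfderiv_eq, h1, mfderiv_eq_fderiv, fderiv_fst] at h2
  exact (DFunLike.congr_fun h2 w).symm

/-! ### The canonical forms in charts -/

/-- The Liouville form `p dx` on the model space. -/
def modelLiouville (m : ℕ) (z : Eu m × (Eu m →L[ℝ] ℝ)) :
    (Eu m × (Eu m →L[ℝ] ℝ)) [⋀^Fin 1]→L[ℝ] ℝ :=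
  ContinuousAlternatingMap.ofSubsingleton ℝ (Eu m × (Eu m →L[ℝ] ℝ)) ℝ (0 : Fin 1)
    (z.2 ∘L ContinuousLinearMap.fst ℝ (Eu m) (Eu m →L[ℝ] ℝ))

theorem contDiff_modelLiouville : ContDiff ℝ ∞ (modelLiouville m) :=
  contDiff_ofSubsingleton (contDiff_snd.clm_comp contDiff_const)

theorem inChart_liouville (α₀ : Cot m M) {z : Eu m × (Eu m →L[ℝ] ℝ)}
    (hz : z.1 ∈ (extChartAt 𝓘(ℝ, Eu m) α₀.proj).target) :
    (liouville m M).inChart α₀ z = modelLiouville m z := by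
  rw [DForm.inChart_eq]
  ext v
  change ((extChartAt (cotModel m) α₀).symm z).2 (tauDeriv ((extChartAt (cotModel m) α₀).symm z)
        (mfderiv 𝓘(ℝ, Eu m × (Eu m →L[ℝ] ℝ)) (cotModel m)
          (extChartAt (cotModel m) α₀).symm z (v 0))) = _
  rw [extChartAt_cot_symm_snd_apply α₀ hz]
  exact congrArg z.2 (toChart_tauDeriv α₀ hz (v 0))

/-- The canonical symplectic form `dx ∧ dp` on the model space. -/
def modelCan (m : ℕ) : (Eu m × (Eu m →L[ℝ] ℝ)) [⋀^Fin 2]→L[ℝ] ℝ :=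
  -extDeriv (modelLiouville m) 0

theorem extDeriv_modelLiouville_apply (z : Eu m × (Eu m →L[ℝ] ℝ))
    (v : Fin 2 → Eu m × (Eu m →L[ℝ] ℝ)) :
    extDeriv (modelLiouville m) z v = (v 0).2 (v 1).1 - (v 1).2 (v 0).1 := by
  rw [extDeriv_apply (contDiff_modelLiouville.differentiable (by simp) z)]
  have h : ∀ (i : Fin 2) (w : Eu m × (Eu m →L[ℝ] ℝ)),
      fderiv ℝ (fun z => modelLiouville m z (i.removeNth v)) z w =
        w.2 (i.removeNth v 0).1 := by
    intro i w
    have : (fun z => modelLiouville m z (i.removeNth v)) = fun z =>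
      (ContinuousLinearMap.apply ℝ ℝ (i.removeNth v 0).1 ∘L
        ContinuousLinearMap.snd ℝ (Eu m) (Eu m →L[ℝ] ℝ)) z := rfl
    rw [this, ContinuousLinearMap.fderiv]
    rfl
  simp only [h]
  simp [Fin.removeNth, sub_eq_add_neg]

theorem modelCan_apply (v : Fin 2 → Eu m × (Eu m →L[ℝ] ℝ)) :
    modelCan m v = (v 1).2 (v 0).1 - (v 0).2 (v 1).1 := by
  change -extDeriv (modelLiouville m) 0 v = _
  rw [extDeriv_modelLiouville_apply, neg_sub]

theorem neg_extDeriv_modelLiouville (z : Eu m × (Eu m →L[ℝ] ℝ)) :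
    -extDeriv (modelLiouville m) z = modelCan m := by
  ext v
  rw [modelCan_apply]
  change -extDeriv (modelLiouville m) z v = _
  rw [extDeriv_modelLiouville_apply, neg_sub]

theorem inChart_liouville_eventuallyEq (α₀ : Cot m M) {z : Eu m × (Eu m →L[ℝ] ℝ)}
    (hz : z.1 ∈ (extChartAt 𝓘(ℝ, Eu m) α₀.proj).target) :
    (liouville m M).inChart α₀ =ᶠ[𝓝 z] modelLiouville m := by
  have h : (extChartAt (cotModel m) α₀).target ∈ 𝓝 z :=
    (isOpen_extChartAt_target α₀).mem_nhds (by rw [extChartAt_cot_target]; exact ⟨hz, trivial⟩)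
  filter_upwards [h] with z' hz'
  rw [extChartAt_cot_target] at hz'
  exact inChart_liouville α₀ hz'.1

theorem inChart_canForm (α₀ : Cot m M) {z : Eu m × (Eu m →L[ℝ] ℝ)}
    (hz : z.1 ∈ (extChartAt 𝓘(ℝ, Eu m) α₀.proj).target) :
    (canForm m M).inChart α₀ z = modelCan m := by
  have hzt : z ∈ (extChartAt (cotModel m) α₀).target := by
    rw [extChartAt_cot_target]
    exact ⟨hz, trivial⟩
  have hev := inChart_liouville_eventuallyEq α₀ hz
  have h1 := (liouville m M).inChart_extDer hzt
    ((contDiff_modelLiouville.differentiable (by simp) z).congr_of_eventuallyEq hev)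
  rw [hev.extDeriv_eq] at h1
  rw [← neg_extDeriv_modelLiouville z, ← h1]
  rfl

/-- The tangent space at `α` is the model space in the preferred chart at `α`, so the form at `α` is
literally the constant model form. Pointwise linear algebra can then be done without charts. -/
theorem canForm_eq (α : Cot m M) : canForm m M α = modelCan m := by
  have h := DForm.extDer_eq (liouville m M) α
  have hz : (extChartAt (cotModel m) α α).1 ∈ (extChartAt 𝓘(ℝ, Eu m) α.proj).target := by
    rw [extChartAt_cot_apply]
    exact mem_extChartAt_target _
  rw [(inChart_liouville_eventuallyEq α hz).extDeriv_eq] at h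
  rw [← neg_extDeriv_modelLiouville (extChartAt (cotModel m) α α), ← h]
  rfl

end CotangentCharts

theorem wedgePow_compContinuousLinearMap {V W : Type*} [AddCommGroup V] [Module ℝ V]
    [TopologicalSpace V] [AddCommGroup W] [Module ℝ W] [TopologicalSpace W]
    (Ω : V [⋀^Fin 2]→L[ℝ] ℝ) (A : W →L[ℝ] V) (r : ℕ) :
    (wedgePow Ω r).compContinuousLinearMap A = wedgePow (Ω.compContinuousLinearMap A) r := by
  ext v
  simp only [wedgePow, ContinuousAlternatingMap.compContinuousLinearMap_apply,
    ContinuousAlternatingMap.smul_apply, ContinuousMultilinearMap.alternatization_apply_apply]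
  rfl

theorem inChart_liouvilleVol {m : ℕ} {M : Type*} [TopologicalSpace M] [ChartedSpace (Eu m) M]
    [IsManifold 𝓘(ℝ, Eu m) ∞ M] (α₀ : Cot m M) {z : Eu m × (Eu m →L[ℝ] ℝ)}
    (hz : z.1 ∈ (extChartAt 𝓘(ℝ, Eu m) α₀.proj).target) :
    (liouvilleVol m M).inChart α₀ z = wedgePow (modelCan m) m := by
  rw [← inChart_canForm α₀ hz, DForm.inChart_eq, DForm.inChart_eq]
  exact wedgePow_compContinuousLinearMap _ _ _

/-! ### Calculus of forms on a model vector space. -/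

section ModelForms

variable {E : Type*} [NormedAddCommGroup E] [NormedSpace ℝ E]

/-- A family of alternating forms on a finite-dimensional space is differentiable if its values
are. -/
theorem differentiableAt_form_of_apply [FiniteDimensional ℝ E] {F : Type*} [NormedAddCommGroup F]
    [NormedSpace ℝ F] {k : ℕ} {η : F → E [⋀^Fin k]→L[ℝ] ℝ} {x : F}
    (h : ∀ v : Fin k → E, DifferentiableAt ℝ (fun y => η y v) x) : DifferentiableAt ℝ η x := by
  let b := Module.finBasis ℝ E
  let ev : (E [⋀^Fin k]→L[ℝ] ℝ) →ₗ[ℝ] (Fin k → Fin (Module.finrank ℝ E)) → ℝ :=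
    { toFun := fun θ a => θ fun i => b (a i)
      map_add' := fun _ _ => rfl
      map_smul' := fun _ _ => rfl }
  have hev : LinearMap.ker ev = ⊥ := by
    rw [LinearMap.ker_eq_bot]
    intro θ θ' hθ
    have : θ.toAlternatingMap = θ'.toAlternatingMap :=
      Module.Basis.ext_alternating b fun a _ => congrFun hθ a
    ext v
    exact DFunLike.congr_fun this v
  obtain ⟨g, hg⟩ := ev.exists_leftInverse_of_injective hev
  have hgη : η = fun y => LinearMap.toContinuousLinearMap g (ev (η y)) :=
    funext fun y => (DFunLike.congr_fun hg (η y)).symm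
  rw [hgη]
  exact (LinearMap.toContinuousLinearMap g).differentiableAt.comp x
    (differentiableAt_pi.2 fun a => h fun i => b (a i))

theorem differentiableAt_smul_form {F : Type*} [NormedAddCommGroup F] [NormedSpace ℝ F] {k : ℕ}
    {f : F → ℝ} {η : F → E [⋀^Fin k]→L[ℝ] ℝ} {x : F} (hf : DifferentiableAt ℝ f x)
    (hη : DifferentiableAt ℝ η x) : DifferentiableAt ℝ (fun x => f x • η x) x :=
  hf.fun_smul hη

theorem contDiffAt_smul_form {F : Type*} [NormedAddCommGroup F] [NormedSpace ℝ F] {k : ℕ}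
    {f : F → ℝ} {η : F → E [⋀^Fin k]→L[ℝ] ℝ} {x : F} (hf : ContDiffAt ℝ ∞ f x)
    (hη : ContDiffAt ℝ ∞ η x) : ContDiffAt ℝ ∞ (fun x => f x • η x) x :=
  hf.fun_smul hη

theorem differentiableAt_comp_fst {F G : Type*} [NormedAddCommGroup F] [NormedSpace ℝ F]
    [NormedAddCommGroup G] [NormedSpace ℝ G] {f : E → G} {z : E × F}
    (hf : DifferentiableAt ℝ f z.1) : DifferentiableAt ℝ (fun z : E × F => f z.1) z :=
  hf.comp z differentiableAt_fst

theorem differentiableAt_bilin_apply {B : E → E →L[ℝ] E →L[ℝ] E} {x : E}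
    (hB : DifferentiableAt ℝ B x) (u v : E) : DifferentiableAt ℝ (fun y => B y u v) x :=
  (hB.clm_apply (differentiableAt_const u)).clm_apply (differentiableAt_const v)

/-- The derivative of `c(x) p(w(x))` along a covector. -/
theorem fderiv_mul_covector_apply {c : E → ℝ} {w : E → E} {z : E × (E →L[ℝ] ℝ)}
    (hc : DifferentiableAt ℝ c z.1) (hw : DifferentiableAt ℝ w z.1) (b : E →L[ℝ] ℝ) :
    fderiv ℝ (fun z : E × (E →L[ℝ] ℝ) => c z.1 * z.2 (w z.1)) z (0, b) = c z.1 * b (w z.1) := by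
  have h1 : HasFDerivAt (fun z : E × (E →L[ℝ] ℝ) => c z.1) _ z :=
    hc.hasFDerivAt.comp z hasFDerivAt_fst
  have h2 : HasFDerivAt (fun z : E × (E →L[ℝ] ℝ) => w z.1) _ z :=
    hw.hasFDerivAt.comp z hasFDerivAt_fst
  have h3 : HasFDerivAt (fun z : E × (E →L[ℝ] ℝ) => z.2)
      (ContinuousLinearMap.snd ℝ E (E →L[ℝ] ℝ)) z := hasFDerivAt_snd
  rw [(h1.fun_mul (h3.clm_apply h2)).fderiv]
  simp

theorem extDeriv_neg_extDeriv {k : ℕ} {η : E → E [⋀^Fin k]→L[ℝ] ℝ} {x : E}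
    (hη : ContDiffAt ℝ ∞ η x) : extDeriv (fun y => (-1 : ℝ) • extDeriv η y) x = 0 := by
  have h : extDeriv (fun y => (-1 : ℝ) • extDeriv η y) x = (-1 : ℝ) • extDeriv (extDeriv η) x :=
    extDeriv_fun_smul (x := x) (-1 : ℝ) (extDeriv η)
  rw [h, extDeriv_extDeriv_apply hη (by simp; norm_cast), smul_zero]

end ModelForms

/-! ### Conformal closedness of `dx ∧ dp + p B` in coordinates. -/

section ModelConformal

variable {m : ℕ}

/-- The differential of `exp(φ) p dx`. -/
theorem extDeriv_exp_smul_modelLiouville {φ : Eu m → ℝ} {z : Eu m × (Eu m →L[ℝ] ℝ)}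
    (hφ : DifferentiableAt ℝ φ z.1) (v : Fin 2 → Eu m × (Eu m →L[ℝ] ℝ)) :
    extDeriv (fun z : Eu m × (Eu m →L[ℝ] ℝ) => Real.exp (φ z.1) • modelLiouville m z) z v =
      Real.exp (φ z.1) * ((fderiv ℝ φ z.1 (v 0).1 * z.2 (v 1).1 + (v 0).2 (v 1).1) -
        (fderiv ℝ φ z.1 (v 1).1 * z.2 (v 0).1 + (v 1).2 (v 0).1)) := by
  have hexp : HasFDerivAt (fun z : Eu m × (Eu m →L[ℝ] ℝ) => Real.exp (φ z.1))
      (Real.exp (φ z.1) • (fderiv ℝ φ z.1 ∘L ContinuousLinearMap.fst ℝ _ _)) z :=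
    (hφ.hasFDerivAt.comp z hasFDerivAt_fst).exp
  have hd : DifferentiableAt ℝ
      (fun z : Eu m × (Eu m →L[ℝ] ℝ) => Real.exp (φ z.1) • modelLiouville m z) z :=
    differentiableAt_smul_form hexp.differentiableAt
      (contDiff_modelLiouville.differentiable (by simp) z)
  have h : ∀ u : Eu m, ∀ w : Eu m × (Eu m →L[ℝ] ℝ),
      fderiv ℝ (fun z : Eu m × (Eu m →L[ℝ] ℝ) => Real.exp (φ z.1) * z.2 u) z w =
        Real.exp (φ z.1) * (fderiv ℝ φ z.1 w.1 * z.2 u + w.2 u) := by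
    intro u w
    have h2 : HasFDerivAt (fun z : Eu m × (Eu m →L[ℝ] ℝ) => z.2 u)
        (ContinuousLinearMap.apply ℝ ℝ u ∘L ContinuousLinearMap.snd ℝ (Eu m) (Eu m →L[ℝ] ℝ)) z :=
      ContinuousLinearMap.hasFDerivAt
        (ContinuousLinearMap.apply ℝ ℝ u ∘L ContinuousLinearMap.snd ℝ (Eu m) (Eu m →L[ℝ] ℝ))
    rw [(hexp.fun_mul h2).fderiv]
    simp
    ring
  rw [extDeriv_apply hd, Fin.sum_univ_two]
  have h0 : (fun z : Eu m × (Eu m →L[ℝ] ℝ) =>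
      (Real.exp (φ z.1) • modelLiouville m z) ((0 : Fin 2).removeNth v)) =
        fun z => Real.exp (φ z.1) * z.2 (v 1).1 := rfl
  have h1 : (fun z : Eu m × (Eu m →L[ℝ] ℝ) =>
      (Real.exp (φ z.1) • modelLiouville m z) ((1 : Fin 2).removeNth v)) =
        fun z => Real.exp (φ z.1) * z.2 (v 0).1 := rfl
  rw [h0, h1, h, h]
  simp
  ring

/-- If `B(u, v) = dφ(v) u - dφ(u) v`, then `exp(φ) (dx ∧ dp + p B)` is exact. -/
theorem extDeriv_conformal_eq_zero {φ : Eu m → ℝ} {B : Eu m → Eu m →L[ℝ] Eu m →L[ℝ] Eu m}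
    {z₀ : Eu m × (Eu m →L[ℝ] ℝ)} (hφ : ContDiffAt ℝ ∞ φ z₀.1)
    {η : Eu m × (Eu m →L[ℝ] ℝ) → (Eu m × (Eu m →L[ℝ] ℝ)) [⋀^Fin 2]→L[ℝ] ℝ}
    (hη : ∀ᶠ z in 𝓝 z₀, ∀ v, η z v =
      Real.exp (φ z.1) * (modelCan m v + z.2 (B z.1 (v 0).1 (v 1).1)))
    (hB : ∀ᶠ y in 𝓝 z₀.1, ∀ u v, B y u v = fderiv ℝ φ y v • u - fderiv ℝ φ y u • v) :
    extDeriv η z₀ = 0 := by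
  have hφ' : ∀ᶠ y in 𝓝 z₀.1, ContDiffAt ℝ 1 φ y :=
    (hφ.of_le (m := 1) (by norm_cast)).eventually (by simp)
  -- The primitive is `-exp(φ) p dx`: differentiating `exp(φ)` produces exactly the term `p(dφ(v) u
  -- - dφ(u) v)`. The equality is needed on a neighbourhood because `extDeriv` is applied to both
  -- sides.
  have hev : η =ᶠ[𝓝 z₀]
      fun z => (-1 : ℝ) • extDeriv (fun z : Eu m × (Eu m →L[ℝ] ℝ) =>
        Real.exp (φ z.1) • modelLiouville m z) z := by
    filter_upwards [hη, continuousAt_fst.eventually hB, continuousAt_fst.eventually hφ']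
      with z hz₀ hz hz'
    ext v
    change η z v = -1 * extDeriv _ z v
    rw [hz₀, extDeriv_exp_smul_modelLiouville (hz'.differentiableAt (by simp)), modelCan_apply,
      hz, map_sub, map_smul, map_smul, smul_eq_mul, smul_eq_mul]
    ring
  rw [hev.extDeriv_eq]
  exact extDeriv_neg_extDeriv (contDiffAt_smul_form (hφ.comp z₀ contDiffAt_fst).exp
    contDiff_modelLiouville.contDiffAt)

theorem differentiableAt_conformal {φ : Eu m → ℝ}
    {B : Eu m → Eu m →L[ℝ] Eu m →L[ℝ] Eu m} {z₀ : Eu m × (Eu m →L[ℝ] ℝ)}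
    (hφ : DifferentiableAt ℝ φ z₀.1) (hBd : DifferentiableAt ℝ B z₀.1)
    {η : Eu m × (Eu m →L[ℝ] ℝ) → (Eu m × (Eu m →L[ℝ] ℝ)) [⋀^Fin 2]→L[ℝ] ℝ}
    (hη : ∀ᶠ z in 𝓝 z₀, ∀ v, η z v =
      Real.exp (φ z.1) * (modelCan m v + z.2 (B z.1 (v 0).1 (v 1).1))) :
    DifferentiableAt ℝ η z₀ := by
  refine differentiableAt_form_of_apply fun v => ?_
  refine DifferentiableAt.congr_of_eventuallyEq (f := fun z : Eu m × (Eu m →L[ℝ] ℝ) =>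
    Real.exp (φ z.1) * (modelCan m v + z.2 (B z.1 (v 0).1 (v 1).1))) ?_ ?_
  · refine (differentiableAt_comp_fst hφ).exp.fun_mul ((differentiableAt_const _).fun_add ?_)
    exact differentiableAt_snd.clm_apply
      (differentiableAt_comp_fst (differentiableAt_bilin_apply hBd (v 0).1 (v 1).1))
  · filter_upwards [hη] with z hz using hz v

/-- If `exp(φ) (dx ∧ dp + p B)` is closed, then `B(u, v) = dφ(v) u - dφ(u) v`. -/
theorem eq_of_extDeriv_conformal_eq_zero {φ : Eu m → ℝ}
    {B : Eu m → Eu m →L[ℝ] Eu m →L[ℝ] Eu m} {z₀ : Eu m × (Eu m →L[ℝ] ℝ)}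
    (hφ : DifferentiableAt ℝ φ z₀.1) (hBd : DifferentiableAt ℝ B z₀.1)
    {η : Eu m × (Eu m →L[ℝ] ℝ) → (Eu m × (Eu m →L[ℝ] ℝ)) [⋀^Fin 2]→L[ℝ] ℝ}
    (hη : ∀ᶠ z in 𝓝 z₀, ∀ v, η z v =
      Real.exp (φ z.1) * (modelCan m v + z.2 (B z.1 (v 0).1 (v 1).1)))
    (h0 : extDeriv η z₀ = 0)
    (u v : Eu m) : B z₀.1 u v = fderiv ℝ φ z₀.1 v • u - fderiv ℝ φ z₀.1 u • v := by
  have hexp : HasFDerivAt (fun z : Eu m × (Eu m →L[ℝ] ℝ) => Real.exp (φ z.1))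
      (Real.exp (φ z₀.1) • (fderiv ℝ φ z₀.1 ∘L ContinuousLinearMap.fst ℝ _ _)) z₀ :=
    (hφ.hasFDerivAt.comp z₀ hasFDerivAt_fst).exp
  have hd : DifferentiableAt ℝ η z₀ := differentiableAt_conformal hφ hBd hη
  have hb : ∀ b : Eu m →L[ℝ] ℝ,
      b (B z₀.1 u v) = b (fderiv ℝ φ z₀.1 v • u - fderiv ℝ φ z₀.1 u • v) := by
    intro b
    -- With two base vectors and one fibre vector, derivatives of `B` do not appear: `p B` vanishes
    -- on pairs containing `(0, b)`, and along `(0, b)` it is differentiated only in `p`.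
    have h : extDeriv η z₀ ![(u, 0), (v, 0), (0, b)] = 0 := by rw [h0]; rfl
    have e : ∀ w : Fin 2 → Eu m × (Eu m →L[ℝ] ℝ), fderiv ℝ (fun z => η z w) z₀ =
        fderiv ℝ (fun z => Real.exp (φ z.1) * ((w 1).2 (w 0).1 - (w 0).2 (w 1).1 +
            z.2 (B z.1 (w 0).1 (w 1).1))) z₀ := by
      intro w
      refine Filter.EventuallyEq.fderiv_eq ?_
      filter_upwards [hη] with z hz
      rw [hz, modelCan_apply]
    have r0 : (0 : Fin 3).removeNth ![((u, 0) : Eu m × (Eu m →L[ℝ] ℝ)), (v, 0), (0, b)] =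
        ![(v, 0), (0, b)] := by
      ext i <;> fin_cases i <;> rfl
    have r1 : (1 : Fin 3).removeNth ![((u, 0) : Eu m × (Eu m →L[ℝ] ℝ)), (v, 0), (0, b)] =
        ![(u, 0), (0, b)] := by
      ext i <;> fin_cases i <;> rfl
    have r2 : (2 : Fin 3).removeNth ![((u, 0) : Eu m × (Eu m →L[ℝ] ℝ)), (v, 0), (0, b)] =
        ![(u, 0), (v, 0)] := by
      ext i <;> fin_cases i <;> rfl
    have h3 := fderiv_mul_covector_apply (z := z₀) hφ.exp (differentiableAt_bilin_apply hBd u v) b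
    rw [extDeriv_apply hd, Fin.sum_univ_three] at h
    simp only [r0, r1, r2, e] at h
    simp only [Matrix.cons_val_zero, Matrix.cons_val_one, Matrix.cons_val,
      zero_apply, map_zero, sub_zero, add_zero, zero_add,
      (hexp.mul_const (b v)).fderiv, (hexp.mul_const (b u)).fderiv] at h
    rw [h3] at h
    simp at h
    have he := (Real.exp_pos (φ z₀.1)).ne'
    rw [map_sub, map_smul, map_smul, smul_eq_mul, smul_eq_mul]
    refine mul_left_cancel₀ he ?_
    linarith
  ext i
  exact hb (EuclideanSpace.proj i)

end ModelConformal

/-! ### Volume forms and divergence -/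

section TopForms

variable {E : Type*} [NormedAddCommGroup E] [NormedSpace ℝ E]

/-- In the expansion of `x` in the basis, every term except the `i`-th repeats a basis vector and is
killed by the alternating form. -/
theorem map_update_basis {k : ℕ} (ν : E [⋀^Fin k]→L[ℝ] ℝ) (b : Module.Basis (Fin k) ℝ E)
    (i : Fin k) (x : E) : ν (Function.update b i x) = b.repr x i * ν b := by
  conv_lhs => rw [← b.sum_repr x]
  have h := ν.toAlternatingMap.map_update_sum Finset.univ i (fun j => b.repr x j • b j) b
  refine h.trans ?_
  simp only [ContinuousAlternatingMap.coe_toAlternatingMap]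
  rw [Finset.sum_eq_single i]
  · rw [ν.map_update_smul, Function.update_eq_self, smul_eq_mul]
  · intro j _ hj
    rw [ν.map_update_smul, ν.map_eq_zero_of_eq (i := i) (j := j) _ (by simp [hj]) hj.symm,
      smul_zero]
  · simp

/-- The trace of an endomorphism as a derivation of volume forms. -/
theorem alternatizeUncurryFin_curryLeft_comp [FiniteDimensional ℝ E] {k : ℕ}
    (hE : Module.finrank ℝ E = k + 1) (ν : E [⋀^Fin (k + 1)]→L[ℝ] ℝ) (A : E →L[ℝ] E) :
    ContinuousAlternatingMap.alternatizeUncurryFin (ν.curryLeft ∘L A) =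
      LinearMap.trace ℝ E A.toLinearMap • ν := by
  -- On a basis the alternated sum replaces one `b i` at a time by `A (b i)`, which contributes the
  -- `i`-th diagonal entry of `A`.
  have key : ∀ b : Module.Basis (Fin (k + 1)) ℝ E,
      ContinuousAlternatingMap.alternatizeUncurryFin (ν.curryLeft ∘L A) b =
        (LinearMap.trace ℝ E A.toLinearMap • ν) b := by
    intro b
    rw [ContinuousAlternatingMap.alternatizeUncurryFin_apply]
    have h : ∀ i : Fin (k + 1), ((-1) ^ i.val • (ν.curryLeft ∘L A) (b i) (i.removeNth b)) =
        b.repr (A (b i)) i * ν b := by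
      intro i
      rw [← map_update_basis, ← Fin.insertNth_removeNth]
      have h := ContinuousAlternatingMap.map_insertNth ν i (A (b i)) (i.removeNth b)
      exact h.symm
    rw [Finset.sum_congr rfl fun i _ => h i, ← Finset.sum_mul]
    rw [LinearMap.trace_eq_matrix_trace ℝ b]
    simp [Matrix.trace, LinearMap.toMatrix_apply]
  let b : Module.Basis (Fin (k + 1)) ℝ E := Module.finBasisOfFinrankEq ℝ E hE
  have h : (ContinuousAlternatingMap.alternatizeUncurryFin (ν.curryLeft ∘L A)).toAlternatingMap =
      (LinearMap.trace ℝ E A.toLinearMap • ν).toAlternatingMap := by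
    -- An alternating map is determined by its values on injective families of basis vectors. Such a
    -- family has full length, so it is a reindexed basis, to which `key` applies.
    refine Module.Basis.ext_alternating b fun a ha => ?_
    have := key (b.reindex (Equiv.ofBijective a (Finite.injective_iff_bijective.1 ha)).symm)
    simpa [Function.comp_def] using! this
  ext v
  exact DFunLike.congr_fun h v

theorem extDeriv_curryLeft [FiniteDimensional ℝ E] {k : ℕ} (hE : Module.finrank ℝ E = k + 1)
    (ν : E [⋀^Fin (k + 1)]→L[ℝ] ℝ) {V : E → E} {x : E} (hV : DifferentiableAt ℝ V x) :
    extDeriv (fun y => ν.curryLeft (V y)) x =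
      LinearMap.trace ℝ E (fderiv ℝ V x).toLinearMap • ν := by
  have h : HasFDerivAt (fun y => ν.curryLeft (V y)) (ν.curryLeft ∘L fderiv ℝ V x) x :=
    ν.curryLeft.hasFDerivAt.comp x hV.hasFDerivAt
  rw [extDeriv, h.fderiv, alternatizeUncurryFin_curryLeft_comp hE]

theorem form_eq_zero_of_finrank_lt [FiniteDimensional ℝ E] {k : ℕ}
    (hE : Module.finrank ℝ E < k) (ν : E [⋀^Fin k]→L[ℝ] ℝ) : ν = 0 := by
  ext v
  refine ν.toAlternatingMap.map_linearDependent v fun h => ?_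
  have := h.fintype_card_le_finrank
  simp at this
  omega

variable {H : Type*} [TopologicalSpace H] {I : ModelWithCorners ℝ E H} [I.Boundaryless]
  {M : Type*} [TopologicalSpace M] [ChartedSpace H M] [IsManifold I ∞ M]

/-- The Lie derivative of a volume form that is a multiple of a constant one in a chart. -/
theorem DForm.lieDer_top [FiniteDimensional ℝ E] {k : ℕ} (hk : k ≠ 0)
    (hE : Module.finrank ℝ E = k) (X : ∀ x : M, TangentSpace I x) (μ : DForm I M k) (x₀ : M)
    (c : E → ℝ) (ν : E [⋀^Fin k]→L[ℝ] ℝ) (Y : E → E)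
    (hμ : ∀ᶠ z in 𝓝 (extChartAt I x₀ x₀), μ.inChart x₀ z = c z • ν)
    (hX : ∀ᶠ z in 𝓝 (extChartAt I x₀ x₀), X ((extChartAt I x₀).symm z) =
      mfderiv 𝓘(ℝ, E) I (extChartAt I x₀).symm z (Y z))
    (hd : DifferentiableAt ℝ (fun z => c z • Y z) (extChartAt I x₀ x₀)) :
    DForm.lieDer X μ x₀ =
      LinearMap.trace ℝ E (fderiv ℝ (fun z => c z • Y z) (extChartAt I x₀ x₀)).toLinearMap • ν := by
  obtain _ | k := k
  · exact absurd rfl hk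
  have h1 : DForm.lieDer X μ x₀ = (μ.interior X).extDer x₀ + μ.extDer.interior X x₀ := rfl
  -- A form of degree above the dimension is zero. Of Cartan's formula only `d (i_X μ)` survives,
  -- and this is a divergence.
  have h2 : μ.extDer x₀ = 0 :=
    form_eq_zero_of_finrank_lt (E := E) (by rw [hE]; exact Nat.lt_succ_self _) _
  have h3 : μ.extDer.interior X x₀ = 0 := by
    unfold DForm.interior
    rw [h2]
    rfl
  have h4 : (μ.interior X).inChart x₀ =ᶠ[𝓝 (extChartAt I x₀ x₀)]
      fun z => ν.curryLeft (c z • Y z) := by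
    filter_upwards [hμ, hX] with z hz hz'
    ext v
    rw [map_smul]
    change _ = c z * ν (Matrix.vecCons (Y z) v)
    have h5 : c z * ν (Matrix.vecCons (Y z) v) = μ.inChart x₀ z (Matrix.vecCons (Y z) v) := by
      rw [hz]
      rfl
    rw [h5, DForm.inChart_eq, DForm.inChart_eq]
    change μ _ (Matrix.vecCons (X _) _) = μ _ _
    rw [hz']
    congr 1
    ext i
    refine Fin.cases ?_ (fun i => ?_) i <;> rfl
  rw [h1, h3, add_zero, DForm.extDer_eq, h4.extDeriv_eq, extDeriv_curryLeft hE ν hd]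

end TopForms

/-! ### The divergence of the reduced vector field in a chart -/

section PartialDerivatives

variable {E F G : Type*} [NormedAddCommGroup E] [NormedSpace ℝ E] [NormedAddCommGroup F]
  [NormedSpace ℝ F] [NormedAddCommGroup G] [NormedSpace ℝ G]

theorem fderiv_apply_left {f : E × F → G} {z : E × F} (hf : DifferentiableAt ℝ f z) (u : E) :
    fderiv ℝ f z (u, 0) = fderiv ℝ (fun y => f (y, z.2)) z.1 u := by
  have h : HasFDerivAt (fun y => f (y, z.2)) (fderiv ℝ f z ∘L ContinuousLinearMap.inl ℝ E F) z.1 :=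
    HasFDerivAt.comp (g := f) z.1 hf.hasFDerivAt (hasFDerivAt_prodMk_left z.1 z.2)
  rw [h.fderiv]
  rfl

theorem fderiv_apply_right {f : E × F → G} {z : E × F} (hf : DifferentiableAt ℝ f z) (u : F) :
    fderiv ℝ f z (0, u) = fderiv ℝ (fun y => f (z.1, y)) z.2 u := by
  have h : HasFDerivAt (fun y => f (z.1, y)) (fderiv ℝ f z ∘L ContinuousLinearMap.inr ℝ E F) z.2 :=
    HasFDerivAt.comp (g := f) z.2 hf.hasFDerivAt (hasFDerivAt_prodMk_right z.1 z.2)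
  rw [h.fderiv]
  rfl

/-- A family of linear maps on a finite-dimensional space is differentiable if its values are. -/
theorem differentiableAt_clm_of_apply [FiniteDimensional ℝ E] {f : F → E →L[ℝ] G} {x : F}
    (h : ∀ v, DifferentiableAt ℝ (fun y => f y v) x) : DifferentiableAt ℝ f x := by
  let b := Module.finBasis ℝ E
  have hf : f = fun y => ∑ i, (ContinuousLinearMap.smulRightL ℝ E G
      (LinearMap.toContinuousLinearMap (b.coord i))) (f y (b i)) := by
    funext y
    ext v
    have h1 : f y v = ∑ i, b.repr v i • f y (b i) := by
      conv_lhs => rw [← b.sum_repr v]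
      rw [map_sum]
      exact Finset.sum_congr rfl fun i _ => map_smul _ _ _
    rw [h1]
    simp
  rw [hf]
  refine DifferentiableAt.fun_sum fun i _ => ?_
  exact (ContinuousLinearMap.differentiableAt _).comp x (h (b i))

end PartialDerivatives

section Divergence

variable {V : Type*} [NormedAddCommGroup V] [NormedSpace ℝ V]

/-- The force component `p B(x)(K p, v) - ∂H(x, p)/∂x (v)` of the reduced equations of motion, for
`H(x, p) = p (K(x) p) / 2 + U(x)`. -/
def forceComponent (K : V → (V →L[ℝ] ℝ) →L[ℝ] V) (B : V → V →L[ℝ] V →L[ℝ] V) (U : V → ℝ)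
    (v : V) (z : V × (V →L[ℝ] ℝ)) : ℝ :=
  z.2 (B z.1 (K z.1 z.2) v) - (2⁻¹ * z.2 (fderiv ℝ K z.1 v z.2) + fderiv ℝ U z.1 v)

variable {K : V → (V →L[ℝ] ℝ) →L[ℝ] V} {B : V → V →L[ℝ] V →L[ℝ] V} {U : V → ℝ}
  {z : V × (V →L[ℝ] ℝ)}

theorem differentiableAt_velocity (hK : DifferentiableAt ℝ K z.1) :
    DifferentiableAt ℝ (fun z : V × (V →L[ℝ] ℝ) => K z.1 z.2) z := by
  have h := differentiableAt_comp_fst (F := V →L[ℝ] ℝ) (G := (V →L[ℝ] ℝ) →L[ℝ] V)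
    (f := K) (z := z) hK
  exact h.clm_apply differentiableAt_snd

theorem differentiableAt_fderiv_apply {W : Type*} [NormedAddCommGroup W] [NormedSpace ℝ W]
    {f : V → W} {x : V} (hf : ContDiffAt ℝ ∞ f x) (v : V) :
    DifferentiableAt ℝ (fun y => fderiv ℝ f y v) x :=
  ((hf.fderiv_right (m := 1) (by norm_cast)).differentiableAt (by simp)).clm_apply
    (differentiableAt_const v)

theorem differentiableAt_forceComponent (hK : ContDiffAt ℝ ∞ K z.1)
    (hB : DifferentiableAt ℝ B z.1) (hU : ContDiffAt ℝ ∞ U z.1) (v : V) :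
    DifferentiableAt ℝ (forceComponent K B U v) z := by
  have h1 := differentiableAt_velocity (hK.differentiableAt (by simp))
  have h2 := differentiableAt_comp_fst (F := V →L[ℝ] ℝ) (G := V →L[ℝ] V →L[ℝ] V)
    (f := B) (z := z) hB
  have h3 := differentiableAt_comp_fst (F := V →L[ℝ] ℝ) (G := (V →L[ℝ] ℝ) →L[ℝ] V)
    (f := fun y => fderiv ℝ K y v) (z := z) (differentiableAt_fderiv_apply hK v)
  have h4 := differentiableAt_comp_fst (F := V →L[ℝ] ℝ) (z := z)
    (differentiableAt_fderiv_apply hU v)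
  have h5 : DifferentiableAt ℝ (fun z : V × (V →L[ℝ] ℝ) => z.2) z := differentiableAt_snd
  refine (h5.clm_apply ((h2.clm_apply h1).clm_apply (differentiableAt_const v))).fun_sub ?_
  exact ((h5.clm_apply (h3.clm_apply h5)).const_mul _).fun_add h4

theorem fderiv_forceComponent_covector (hK : ContDiffAt ℝ ∞ K z.1)
    (hB : DifferentiableAt ℝ B z.1) (hU : ContDiffAt ℝ ∞ U z.1) (v : V) (b : V →L[ℝ] ℝ) :
    fderiv ℝ (forceComponent K B U v) z (0, b) =
      b (B z.1 (K z.1 z.2) v) + z.2 (B z.1 (K z.1 b) v) -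
        2⁻¹ * (b (fderiv ℝ K z.1 v z.2) + z.2 (fderiv ℝ K z.1 v b)) := by
  rw [fderiv_apply_right (differentiableAt_forceComponent hK hB hU v)]
  have hid : HasFDerivAt (fun p : V →L[ℝ] ℝ => p) (ContinuousLinearMap.id ℝ (V →L[ℝ] ℝ)) z.2 :=
    hasFDerivAt_id _
  have h1 : HasFDerivAt (fun p : V →L[ℝ] ℝ => B z.1 (K z.1 p) v)
      ((B z.1).flip v ∘L K z.1) z.2 :=
    ContinuousLinearMap.hasFDerivAt ((B z.1).flip v ∘L K z.1)
  have h2 : HasFDerivAt (fun p : V →L[ℝ] ℝ => fderiv ℝ K z.1 v p) (fderiv ℝ K z.1 v) z.2 :=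
    ContinuousLinearMap.hasFDerivAt (fderiv ℝ K z.1 v)
  have h3 := (hid.clm_apply h1).fun_sub
    (((hid.clm_apply h2).const_mul (2⁻¹ : ℝ)).add_const (fderiv ℝ U z.1 v))
  have h4 : (fun p => forceComponent K B U v (z.1, p)) = fun p : V →L[ℝ] ℝ =>
    p (B z.1 (K z.1 p) v) - (2⁻¹ * p (fderiv ℝ K z.1 v p) + fderiv ℝ U z.1 v) := rfl
  rw [h4, h3.fderiv]
  simp
  ring

/-- Symmetry holds near `x`, so the two scalar functions `y ↦ p (K y q)` and `y ↦ q (K y p)` have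
the same derivative. -/
theorem fderiv_symmetric {x : V} (hK : DifferentiableAt ℝ K x)
    (hs : ∀ᶠ y in 𝓝 x, ∀ p q : V →L[ℝ] ℝ, p (K y q) = q (K y p)) (u : V) (p q : V →L[ℝ] ℝ) :
    p (fderiv ℝ K x u q) = q (fderiv ℝ K x u p) := by
  have h : ∀ p q : V →L[ℝ] ℝ,
      fderiv ℝ (fun y => p (K y q)) x u = p (fderiv ℝ K x u q) := by
    intro p q
    have h1 : HasFDerivAt (fun y => K y q) ((fderiv ℝ K x).flip q) x := by
      simpa using hK.hasFDerivAt.clm_apply (hasFDerivAt_const q x)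
    have h2 : HasFDerivAt (fun y => p (K y q)) (p ∘L (fderiv ℝ K x).flip q) x :=
      p.hasFDerivAt.comp x h1
    rw [h2.fderiv]
    rfl
  rw [← h, ← h, Filter.EventuallyEq.fderiv_eq (hs.mono fun y hy => hy p q)]

end Divergence

section Trace

variable {r : ℕ}

/-- The basis of the dual of `ℝʳ` given by the coordinate functions. -/
def coordBasis (r : ℕ) : Module.Basis (Fin r) ℝ (Eu r →L[ℝ] ℝ) :=
  (EuclideanSpace.basisFun (Fin r) ℝ).toBasis.dualBasis.map LinearMap.toContinuousLinearMap

theorem coordBasis_apply (i : Fin r) : coordBasis r i = EuclideanSpace.proj i := by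
  ext v
  change (EuclideanSpace.basisFun (Fin r) ℝ).toBasis.dualBasis i v = v i
  simp

theorem coordBasis_repr (p : Eu r →L[ℝ] ℝ) (i : Fin r) :
    (coordBasis r).repr p i = p (EuclideanSpace.single i 1) := by
  change (EuclideanSpace.basisFun (Fin r) ℝ).toBasis.dualBasis.repr p.toLinearMap i = _
  simp

theorem covector_eq_sum (p : Eu r →L[ℝ] ℝ) (v : Eu r) :
    p v = ∑ i, v i * p (EuclideanSpace.single i 1) := by
  conv_lhs => rw [← (EuclideanSpace.basisFun (Fin r) ℝ).toBasis.sum_repr v]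
  simp

/-- The trace is taken in the basis `(eᵢ, 0)`, `(0, eⁱ)`, where the coordinates of a covector are
its values on the `eᵢ`. -/
theorem trace_prod_dual (A : (Eu r × (Eu r →L[ℝ] ℝ)) →L[ℝ] Eu r × (Eu r →L[ℝ] ℝ)) :
    LinearMap.trace ℝ (Eu r × (Eu r →L[ℝ] ℝ)) A.toLinearMap =
      ∑ i, (A (EuclideanSpace.single i 1, 0)).1 i +
        ∑ i, (A (0, EuclideanSpace.proj i)).2 (EuclideanSpace.single i 1) := by
  rw [LinearMap.trace_eq_matrix_trace ℝ
    ((EuclideanSpace.basisFun (Fin r) ℝ).toBasis.prod (coordBasis r)), Matrix.trace,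
    Fintype.sum_sum_type]
  congr 1
  · refine Finset.sum_congr rfl fun i _ => ?_
    simp [LinearMap.toMatrix_apply, Matrix.diag]
  · refine Finset.sum_congr rfl fun i _ => ?_
    simp [LinearMap.toMatrix_apply, Matrix.diag, coordBasis_apply, coordBasis_repr]

/-- The contraction of a symmetric tensor with a skew-symmetric one vanishes. -/
theorem sum_symm_skew_eq_zero (K : (Eu r →L[ℝ] ℝ) →L[ℝ] Eu r) (B : Eu r →L[ℝ] Eu r →L[ℝ] Eu r)
    (hK : ∀ p q : Eu r →L[ℝ] ℝ, p (K q) = q (K p)) (hB : ∀ u v, B u v = -B v u)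
    (p : Eu r →L[ℝ] ℝ) :
    ∑ i, p (B (K (EuclideanSpace.proj i)) (EuclideanSpace.single i 1)) = 0 := by
  have h1 : ∀ i, p (B (K (EuclideanSpace.proj i)) (EuclideanSpace.single i 1)) =
      ∑ j, K (EuclideanSpace.proj i) j *
        p (B (EuclideanSpace.single j 1) (EuclideanSpace.single i 1)) := fun i =>
    covector_eq_sum (p ∘L B.flip (EuclideanSpace.single i 1)) (K (EuclideanSpace.proj i))
  have h2 : ∀ i j, K (EuclideanSpace.proj i) j = K (EuclideanSpace.proj j) i := fun i j =>
    hK (EuclideanSpace.proj j) (EuclideanSpace.proj i)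
  -- Exchanging the two summation indices preserves the `K` factor and changes the sign of the `B`
  -- factor, so the sum equals its own negative.
  have h3 : ∑ i, p (B (K (EuclideanSpace.proj i)) (EuclideanSpace.single i 1)) =
      -∑ i, p (B (K (EuclideanSpace.proj i)) (EuclideanSpace.single i 1)) := by
    simp only [h1]
    conv_lhs => rw [Finset.sum_comm]
    rw [← Finset.sum_neg_distrib]
    refine Finset.sum_congr rfl fun i _ => ?_
    rw [← Finset.sum_neg_distrib]
    refine Finset.sum_congr rfl fun j _ => ?_
    rw [hB, map_neg, h2]
    ring
  linarith

/-- The trace of the derivative of `exp(σ) X`, where `X` is the vector field with components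
`K p` and `p B(K p, ·) - ∂H/∂x`. -/
theorem trace_fderiv_reduced {K : Eu r → (Eu r →L[ℝ] ℝ) →L[ℝ] Eu r}
    {B : Eu r → Eu r →L[ℝ] Eu r →L[ℝ] Eu r} {U σ : Eu r → ℝ} {z : Eu r × (Eu r →L[ℝ] ℝ)}
    (hK : ContDiffAt ℝ ∞ K z.1)
    (hKs : ∀ᶠ y in 𝓝 z.1, ∀ p q : Eu r →L[ℝ] ℝ, p (K y q) = q (K y p))
    (hB : DifferentiableAt ℝ B z.1) (hBs : ∀ u v, B z.1 u v = -B z.1 v u)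
    (hU : ContDiffAt ℝ ∞ U z.1) (hσ : DifferentiableAt ℝ σ z.1)
    {Y : Eu r × (Eu r →L[ℝ] ℝ) → Eu r × (Eu r →L[ℝ] ℝ)}
    (hY₁ : ∀ᶠ z in 𝓝 z, (Y z).1 = K z.1 z.2)
    (hY₂ : ∀ᶠ z in 𝓝 z, ∀ v, (Y z).2 v = forceComponent K B U v z) :
    DifferentiableAt ℝ (fun z => Real.exp (σ z.1) • Y z) z ∧
      LinearMap.trace ℝ _ (fderiv ℝ (fun z => Real.exp (σ z.1) • Y z) z).toLinearMap =
        Real.exp (σ z.1) * (fderiv ℝ σ z.1 (K z.1 z.2) +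
          ∑ i, B z.1 (K z.1 z.2) (EuclideanSpace.single i 1) i) := by
  have d₁ : DifferentiableAt ℝ (fun z => (Y z).1) z :=
    (differentiableAt_velocity (hK.differentiableAt (by simp))).congr_of_eventuallyEq hY₁
  have d₂ : DifferentiableAt ℝ (fun z => (Y z).2) z := differentiableAt_clm_of_apply fun v =>
    (differentiableAt_forceComponent hK hB hU v).congr_of_eventuallyEq (hY₂.mono fun z hz => hz v)
  have dY : HasFDerivAt Y
      ((fderiv ℝ (fun z => (Y z).1) z).prod (fderiv ℝ (fun z => (Y z).2) z)) z :=
    d₁.hasFDerivAt.prodMk d₂.hasFDerivAt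
  have hexp : HasFDerivAt (fun z : Eu r × (Eu r →L[ℝ] ℝ) => Real.exp (σ z.1))
      (Real.exp (σ z.1) • (fderiv ℝ σ z.1 ∘L ContinuousLinearMap.fst ℝ _ _)) z :=
    (hσ.hasFDerivAt.comp z hasFDerivAt_fst).exp
  have hsm := hexp.fun_smul dY
  refine ⟨hsm.differentiableAt, ?_⟩
  rw [trace_prod_dual]
  have e₁ : ∀ u, fderiv ℝ (fun z => (Y z).1) z (u, 0) = fderiv ℝ K z.1 u z.2 := by
    intro u
    have h1 : HasFDerivAt (fun y => K y z.2) ((fderiv ℝ K z.1).flip z.2) z.1 := by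
      simpa using (hK.differentiableAt (by simp)).hasFDerivAt.clm_apply (hasFDerivAt_const z.2 z.1)
    rw [Filter.EventuallyEq.fderiv_eq hY₁,
      fderiv_apply_left (differentiableAt_velocity (hK.differentiableAt (by simp))), h1.fderiv]
    rfl
  have e₂ : ∀ b v, fderiv ℝ (fun z => (Y z).2) z (0, b) v =
      b (B z.1 (K z.1 z.2) v) + z.2 (B z.1 (K z.1 b) v) -
        2⁻¹ * (b (fderiv ℝ K z.1 v z.2) + z.2 (fderiv ℝ K z.1 v b)) := by
    intro b v
    have h1 : HasFDerivAt (fun z => (Y z).2 v)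
        ((fderiv ℝ (fun z => (Y z).2) z).flip v) z := by
      simpa using d₂.hasFDerivAt.clm_apply (hasFDerivAt_const v z)
    have h2 : fderiv ℝ (fun z => (Y z).2 v) z = fderiv ℝ (forceComponent K B U v) z :=
      Filter.EventuallyEq.fderiv_eq (hY₂.mono fun z hz => hz v)
    rw [← fderiv_forceComponent_covector hK hB hU v b, ← h2, h1.fderiv]
    rfl
  -- Symmetry of `∂K` merges the two halves of the momentum derivative of `½ p (∂ᵢK p)` into `(∂ᵢK
  -- p)ᵢ`, which cancels the position derivative of `(K p)ᵢ`.
  have hsymm : ∀ (v : Eu r) (i : Fin r), z.2 (fderiv ℝ K z.1 v (EuclideanSpace.proj i)) =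
      fderiv ℝ K z.1 v z.2 i := fun v i =>
    fderiv_symmetric (hK.differentiableAt (by simp)) hKs v z.2 (EuclideanSpace.proj i)
  have hskew := sum_symm_skew_eq_zero (K z.1) (B z.1) hKs.self_of_nhds hBs z.2
  have hY₀ : (Y z).1 = K z.1 z.2 := hY₁.self_of_nhds
  have hsum := covector_eq_sum (fderiv ℝ σ z.1) (K z.1 z.2)
  have hA₁ : ∀ w i, (fderiv ℝ (fun z => Real.exp (σ z.1) • Y z) z w).1 i =
      Real.exp (σ z.1) * fderiv ℝ (fun z => (Y z).1) z w i +
        (Real.exp (σ z.1) * fderiv ℝ σ z.1 w.1) * (Y z).1 i := by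
    intro w i
    rw [hsm.fderiv]
    rfl
  have hA₂ : ∀ w v, (fderiv ℝ (fun z => Real.exp (σ z.1) • Y z) z w).2 v =
      Real.exp (σ z.1) * fderiv ℝ (fun z => (Y z).2) z w v +
        (Real.exp (σ z.1) * fderiv ℝ σ z.1 w.1) * (Y z).2 v := by
    intro w v
    rw [hsm.fderiv]
    rfl
  have t₁ : ∀ i : Fin r, (fderiv ℝ (fun z => Real.exp (σ z.1) • Y z) z
      (EuclideanSpace.single i 1, 0)).1 i = Real.exp (σ z.1) *
          (fderiv ℝ K z.1 (EuclideanSpace.single i 1) z.2 i +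
            K z.1 z.2 i * fderiv ℝ σ z.1 (EuclideanSpace.single i 1)) := by
    intro i
    rw [hA₁, e₁, hY₀]
    ring
  have t₂ : ∀ i : Fin r, (fderiv ℝ (fun z => Real.exp (σ z.1) • Y z) z
      (0, EuclideanSpace.proj i)).2 (EuclideanSpace.single i 1) = Real.exp (σ z.1) *
          (B z.1 (K z.1 z.2) (EuclideanSpace.single i 1) i +
            z.2 (B z.1 (K z.1 (EuclideanSpace.proj i)) (EuclideanSpace.single i 1)) -
              fderiv ℝ K z.1 (EuclideanSpace.single i 1) z.2 i) := by
    intro i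
    rw [hA₂, e₂, hsymm, map_zero]
    have hp : ∀ v : Eu r, (EuclideanSpace.proj i : Eu r →L[ℝ] ℝ) v = v i := fun _ => rfl
    rw [hp, hp]
    ring
  rw [Finset.sum_congr rfl fun i _ => t₁ i, Finset.sum_congr rfl fun i _ => t₂ i,
    ← Finset.mul_sum, ← Finset.mul_sum, Finset.sum_add_distrib, Finset.sum_sub_distrib,
    Finset.sum_add_distrib, hskew, ← hsum]
  ring

/-- Hamilton's equations for `H(x, p) = p (K(x) p) / 2 + U(x)` and the 2-form `dx ∧ dp + p B`. -/
theorem eq_of_form_eq_fderiv {K : Eu r → (Eu r →L[ℝ] ℝ) →L[ℝ] Eu r}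
    {B : Eu r → Eu r →L[ℝ] Eu r →L[ℝ] Eu r} {U : Eu r → ℝ} {z X : Eu r × (Eu r →L[ℝ] ℝ)}
    (hK : DifferentiableAt ℝ K z.1) (hU : DifferentiableAt ℝ U z.1)
    (hKs : ∀ p q : Eu r →L[ℝ] ℝ, p (K z.1 q) = q (K z.1 p))
    (hX : ∀ W : Eu r × (Eu r →L[ℝ] ℝ), W.2 X.1 - X.2 W.1 + z.2 (B z.1 X.1 W.1) =
      fderiv ℝ (fun z : Eu r × (Eu r →L[ℝ] ℝ) => 2⁻¹ * z.2 (K z.1 z.2) + U z.1) z W) :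
    X.1 = K z.1 z.2 ∧ ∀ v, X.2 v = forceComponent K B U v z := by
  have hd : DifferentiableAt ℝ
      (fun z : Eu r × (Eu r →L[ℝ] ℝ) => 2⁻¹ * z.2 (K z.1 z.2) + U z.1) z :=
    ((differentiableAt_snd.clm_apply (differentiableAt_velocity hK)).const_mul _).fun_add
      (differentiableAt_comp_fst hU)
  -- Testing on the fibre vectors `(0, b)` gives the velocity; the gyroscopic term does not see
  -- them. The base vectors `(v, 0)` then give the force.
  have h1 : ∀ b : Eu r →L[ℝ] ℝ, b X.1 = b (K z.1 z.2) := by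
    intro b
    have hid : HasFDerivAt (fun p : Eu r →L[ℝ] ℝ => p)
      (ContinuousLinearMap.id ℝ (Eu r →L[ℝ] ℝ)) z.2 := hasFDerivAt_id _
    have hq := (((hid.clm_apply (K z.1).hasFDerivAt).const_mul (2⁻¹ : ℝ)).add_const (U z.1)).fderiv
    have h := hX (0, b)
    rw [fderiv_apply_right hd] at h
    rw [hq] at h
    simp [hKs z.2 b] at h
    linarith
  have h2 : X.1 = K z.1 z.2 := by
    ext i
    exact h1 (EuclideanSpace.proj i)
  refine ⟨h2, fun v => ?_⟩
  have hk : HasFDerivAt (fun y => K y z.2) ((fderiv ℝ K z.1).flip z.2) z.1 := by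
    simpa using hK.hasFDerivAt.clm_apply (hasFDerivAt_const z.2 z.1)
  have hq := (((z.2.hasFDerivAt.comp z.1 hk).const_mul (2⁻¹ : ℝ)).fun_add hU.hasFDerivAt).fderiv
  have h := hX (v, 0)
  rw [fderiv_apply_left hd] at h
  have hq' := (DFunLike.congr_fun hq v)
  have h3 := h.trans hq'
  rw [h2] at h3
  simp at h3
  rw [forceComponent]
  linarith

end Trace

/-! ### Nonvanishing of the Liouville volume when `r = 2`. -/

section Nonvanishing

/-- The matrix of `dx ∧ dp` in the basis `∂x⁰, ∂p₀, ∂x¹, ∂p₁`. -/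
def symplecticEntry (a b : Fin (2 * 2)) : ℤ :=
  if a.val + 1 = b.val ∧ a.val % 2 = 0 then 1
  else if b.val + 1 = a.val ∧ b.val % 2 = 0 then -1 else 0

-- The value is `2² · 2!`. Only permutations preserving the partition into two conjugate pairs
-- contribute. Swapping a pair changes both the sign and the entry, and exchanging the pairs is
-- even, so each of the eight contributes `1`.
set_option maxRecDepth 20000 in
theorem sum_symplecticEntry :
    ∑ σ : Equiv.Perm (Fin (2 * 2)), (Equiv.Perm.sign σ : ℤ) * ∏ i : Fin 2,
      symplecticEntry (σ (finProdFinEquiv (i, 0))) (σ (finProdFinEquiv (i, 1))) = 8 := by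
  decide

theorem wedgePow_modelCan_ne_zero : wedgePow (modelCan 2) 2 ≠ 0 := by
  intro h
  let v : Fin (2 * 2) → Eu 2 × (Eu 2 →L[ℝ] ℝ) :=
    ![(EuclideanSpace.single 0 1, 0), (0, EuclideanSpace.proj 0),
      (EuclideanSpace.single 1 1, 0), (0, EuclideanSpace.proj 1)]
  have hv : ∀ a b, modelCan 2 ![v a, v b] = (symplecticEntry a b : ℝ) := by
    intro a b
    rw [modelCan_apply]
    fin_cases a <;> fin_cases b <;> simp [v, symplecticEntry]
  have h1 : wedgePow (modelCan 2) 2 v = ((2 : ℝ) ^ 2)⁻¹ *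
      ∑ σ : Equiv.Perm (Fin (2 * 2)), Equiv.Perm.sign σ • ∏ i : Fin 2,
        modelCan 2 (fun j => v (σ (finProdFinEquiv (i, j)))) := by
    simp only [wedgePow, ContinuousAlternatingMap.smul_apply,
      ContinuousMultilinearMap.alternatization_apply_apply]
    rfl
  have h2 : ∀ (σ : Equiv.Perm (Fin (2 * 2))) (i : Fin 2),
      modelCan 2 (fun j => v (σ (finProdFinEquiv (i, j)))) =
        (symplecticEntry (σ (finProdFinEquiv (i, 0))) (σ (finProdFinEquiv (i, 1))) : ℝ) := by
    intro σ i
    rw [← hv]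
    congr 1
    ext j <;> fin_cases j <;> rfl
  have h3 : ∑ σ : Equiv.Perm (Fin (2 * 2)), Equiv.Perm.sign σ • ∏ i : Fin 2,
        modelCan 2 (fun j => v (σ (finProdFinEquiv (i, j)))) = 8 := by
    have h4 := congrArg (Int.cast : ℤ → ℝ) sum_symplecticEntry
    push_cast at h4
    rw [← h4]
    refine Finset.sum_congr rfl fun σ _ => ?_
    rw [Finset.prod_congr rfl fun i _ => h2 σ i, Units.smul_def, zsmul_eq_mul]
  have h0 : wedgePow (modelCan 2) 2 v = 0 := by
    rw [h]
    rfl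
  rw [h1, h3] at h0
  norm_num at h0

end Nonvanishing

/-! ### Smooth sections and Lie brackets in charts -/

theorem contDiffAt_clm_of_apply {D E F : Type*} [NormedAddCommGroup D] [NormedSpace ℝ D]
    [NormedAddCommGroup E] [NormedSpace ℝ E] [NormedAddCommGroup F] [NormedSpace ℝ F]
    [FiniteDimensional ℝ E] {k : WithTop ℕ∞} {f : D → E →L[ℝ] F} {x : D}
    (h : ∀ v, ContDiffAt ℝ k (fun y => f y v) x) : ContDiffAt ℝ k f x := by
  let d := Module.finrank ℝ E
  have hd : d = Module.finrank ℝ (Fin d → ℝ) := (Module.finrank_fin_fun ℝ).symm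
  let e₁ := ContinuousLinearEquiv.ofFinrankEq hd
  let e₂ := (e₁.arrowCongr (1 : F ≃L[ℝ] F)).trans (ContinuousLinearEquiv.piRing (Fin d))
  rw [← Function.id_comp f, ← e₂.symm_comp_self]
  exact e₂.symm.contDiff.contDiffAt.comp x (contDiffAt_pi.2 fun i => h _)

theorem mlieBracket_modelSpace {E : Type*} [NormedAddCommGroup E] [NormedSpace ℝ E]
    (V W : ∀ x : E, TangentSpace 𝓘(ℝ, E) x) (x : E) :
    VectorField.mlieBracket 𝓘(ℝ, E) V W x =
      fderiv ℝ (F := E) W x (V x) - fderiv ℝ (F := E) V x (W x) := by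
  rw [← VectorField.mlieBracketWithin_univ, VectorField.mlieBracketWithin_eq_lieBracketWithin]
  exact congrFun (VectorField.lieBracketWithin_univ (𝕜 := ℝ) (E := E) (V := V) (W := W)) x

section SectionsInCharts

variable {m : ℕ} {M : Type*} [TopologicalSpace M] [ChartedSpace (Eu m) M]
  [IsManifold 𝓘(ℝ, Eu m) ∞ M]

/-- The vector field `V` in the chart at `x₀`. -/
def VField.inChart (V : VField m M) (x₀ : M) (y : Eu m) : Eu m :=
  toChart x₀ ((extChartAt 𝓘(ℝ, Eu m) x₀).symm y) (V ((extChartAt 𝓘(ℝ, Eu m) x₀).symm y))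

omit [IsManifold 𝓘(ℝ, Eu m) ∞ M] in
theorem extChartAt_symm_mem {x₀ : M} {y : Eu m} (hy : y ∈ (extChartAt 𝓘(ℝ, Eu m) x₀).target) :
    (extChartAt 𝓘(ℝ, Eu m) x₀).symm y ∈ (chartAt (Eu m) x₀).source := by
  rw [← extChartAt_source 𝓘(ℝ, Eu m)]
  exact (extChartAt 𝓘(ℝ, Eu m) x₀).map_target hy

theorem contMDiffAt_extChartAt_symm {x₀ : M} {y : Eu m}
    (hy : y ∈ (extChartAt 𝓘(ℝ, Eu m) x₀).target) :
    ContMDiffAt 𝓘(ℝ, Eu m) 𝓘(ℝ, Eu m) ∞ (extChartAt 𝓘(ℝ, Eu m) x₀).symm y :=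
  (contMDiffOn_extChartAt_symm x₀).contMDiffAt ((isOpen_extChartAt_target x₀).mem_nhds hy)

theorem contDiffAt_comp_extChartAt_symm {F : Type*} [NormedAddCommGroup F] [NormedSpace ℝ F]
    {f : M → F} {x₀ : M} {y : Eu m}
    (hy : y ∈ (extChartAt 𝓘(ℝ, Eu m) x₀).target)
    (hf : ContMDiffAt 𝓘(ℝ, Eu m) 𝓘(ℝ, F) ∞ f ((extChartAt 𝓘(ℝ, Eu m) x₀).symm y)) :
    ContDiffAt ℝ ∞ (fun y => f ((extChartAt 𝓘(ℝ, Eu m) x₀).symm y)) y :=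
  (hf.comp y (contMDiffAt_extChartAt_symm hy)).contDiffAt

theorem toChart_eq_trivialization {x₀ x : M} (hx : x ∈ (chartAt (Eu m) x₀).source) (v : Tan m x) :
    toChart x₀ x v =
      (trivializationAt (Eu m) (TangentSpace 𝓘(ℝ, Eu m) : M → Type _) x₀ ⟨x, v⟩).2 := by
  rw [toChart, Trivialization.continuousLinearMapAt_apply,
    Trivialization.coe_linearMapAt_of_mem _ (by simpa using hx)]

theorem contDiffAt_inChart_of_contMDiffAt {V : VField m M} {x₀ : M} {y : Eu m}
    (hy : y ∈ (extChartAt 𝓘(ℝ, Eu m) x₀).target)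
    (hV : ContMDiffAt 𝓘(ℝ, Eu m) 𝓘(ℝ, Eu m).tangent ∞
      (fun x => (⟨x, V x⟩ : TangentBundle 𝓘(ℝ, Eu m) M)) ((extChartAt 𝓘(ℝ, Eu m) x₀).symm y)) :
    ContDiffAt ℝ ∞ (V.inChart x₀) y := by
  have h := (Trivialization.contMDiffAt_section_iff (IB := 𝓘(ℝ, Eu m)) (n := ∞)
    (trivializationAt (Eu m) (TangentSpace 𝓘(ℝ, Eu m) : M → Type _) x₀)
    (by simpa using extChartAt_symm_mem hy)).1 hV
  refine (contDiffAt_comp_extChartAt_symm hy h).congr_of_eventuallyEq ?_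
  filter_upwards [(isOpen_extChartAt_target x₀).mem_nhds hy] with z hz
  exact toChart_eq_trivialization (extChartAt_symm_mem hz) _

theorem differentiableAt_inChart_iff {V : VField m M} {x₀ : M} {y : Eu m}
    (hy : y ∈ (extChartAt 𝓘(ℝ, Eu m) x₀).target) :
    DifferentiableAt ℝ (V.inChart x₀) y ↔
    MDifferentiableAt 𝓘(ℝ, Eu m) 𝓘(ℝ, Eu m).tangent
      (fun x => (⟨x, V x⟩ : TangentBundle 𝓘(ℝ, Eu m) M))
        ((extChartAt 𝓘(ℝ, Eu m) x₀).symm y) := by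
  have : IsManifold 𝓘(ℝ, Eu m) 1 M := .of_le (n := ∞) (by simp)
  rw [Trivialization.mdifferentiableAt_section_iff (𝓘(ℝ, Eu m))
    (trivializationAt (Eu m) (TangentSpace 𝓘(ℝ, Eu m) : M → Type _) x₀) V
    (by simpa using extChartAt_symm_mem hy)]
  have hs := extChartAt_symm_mem hy
  constructor
  · intro h
    have h1 : MDifferentiableAt 𝓘(ℝ, Eu m) 𝓘(ℝ, Eu m) (V.inChart x₀)
        (extChartAt 𝓘(ℝ, Eu m) x₀ ((extChartAt 𝓘(ℝ, Eu m) x₀).symm y)) := by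
      rw [(extChartAt 𝓘(ℝ, Eu m) x₀).right_inv hy]
      exact h.mdifferentiableAt
    refine (h1.comp _ (mdifferentiableAt_extChartAt hs)).congr_of_eventuallyEq ?_
    filter_upwards [(chartAt (Eu m) x₀).open_source.mem_nhds hs] with x hx
    have hx' : x ∈ (extChartAt 𝓘(ℝ, Eu m) x₀).source := by rwa [extChartAt_source]
    simp only [Function.comp_apply, VField.inChart]
    rw [(extChartAt 𝓘(ℝ, Eu m) x₀).left_inv hx', toChart_eq_trivialization hx]
  · intro h
    have h1 := (h.comp y (mdifferentiableAt_extChartAt_symm hy)).differentiableAt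
    refine h1.congr_of_eventuallyEq ?_
    filter_upwards [(isOpen_extChartAt_target x₀).mem_nhds hy] with z hz
    exact toChart_eq_trivialization (extChartAt_symm_mem hz) _

theorem contMDiffAt_ofChart {x₀ x : M} (hx : x ∈ (chartAt (Eu m) x₀).source) (v : Eu m) :
    ContMDiffAt 𝓘(ℝ, Eu m) 𝓘(ℝ, Eu m).tangent ∞
      (fun x => (⟨x, ofChart x₀ x v⟩ : TangentBundle 𝓘(ℝ, Eu m) M)) x := by
  refine (Trivialization.contMDiffAt_section_iff (IB := 𝓘(ℝ, Eu m)) (n := ∞)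
    (trivializationAt (Eu m) (TangentSpace 𝓘(ℝ, Eu m) : M → Type _) x₀)
    (by simpa using hx)).2 ?_
  refine (contMDiffAt_const (c := v)).congr_of_eventuallyEq ?_
  filter_upwards [(chartAt (Eu m) x₀).open_source.mem_nhds hx] with x' hx'
  rw [← toChart_eq_trivialization hx', toChart_ofChart hx']

theorem inverse_mfderiv_extChartAt_symm {x₀ : M} {y : Eu m}
    (hy : y ∈ (extChartAt 𝓘(ℝ, Eu m) x₀).target) :
    (mfderiv 𝓘(ℝ, Eu m) 𝓘(ℝ, Eu m) (extChartAt 𝓘(ℝ, Eu m) x₀).symm y).inverse =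
      toChart x₀ ((extChartAt 𝓘(ℝ, Eu m) x₀).symm y) := by
  refine ContinuousLinearMap.inverse_eq ?_ ?_
  · ext v
    have h := mfderiv_extChartAt_symm_apply hy (toChart x₀ ((extChartAt 𝓘(ℝ, Eu m) x₀).symm y) v)
    rw [ofChart_toChart (extChartAt_symm_mem hy)] at h
    exact h
  · ext v
    exact toChart_mfderiv_extChartAt_symm hy v

/-- Pullback along the inverse chart carries vector fields to their coordinate expressions and
commutes with brackets, so the bracket becomes the one of the model space. -/
theorem toChart_mlieBracket {V W : VField m M} {x₀ : M} {y : Eu m}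
    (hy : y ∈ (extChartAt 𝓘(ℝ, Eu m) x₀).target)
    (hV : DifferentiableAt ℝ (V.inChart x₀) y) (hW : DifferentiableAt ℝ (W.inChart x₀) y) :
    toChart x₀ ((extChartAt 𝓘(ℝ, Eu m) x₀).symm y)
      (VectorField.mlieBracket 𝓘(ℝ, Eu m) V W ((extChartAt 𝓘(ℝ, Eu m) x₀).symm y)) =
    fderiv ℝ (W.inChart x₀) y (V.inChart x₀ y) - fderiv ℝ (V.inChart x₀) y (W.inChart x₀ y) := by
  have : IsManifold 𝓘(ℝ, Eu m) (minSmoothness ℝ 3) M := .of_le (n := ∞) (by simp; norm_cast)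
  have : IsManifold 𝓘(ℝ, Eu m) (minSmoothness ℝ 2) M := .of_le (n := ∞) (by simp; norm_cast)
  have hpull : ∀ V : VField m M, VectorField.mpullback 𝓘(ℝ, Eu m) 𝓘(ℝ, Eu m)
      (extChartAt 𝓘(ℝ, Eu m) x₀).symm V =ᶠ[𝓝 y] V.inChart x₀ := by
    intro V
    filter_upwards [(isOpen_extChartAt_target x₀).mem_nhds hy] with z hz
    rw [VectorField.mpullback_apply, inverse_mfderiv_extChartAt_symm hz]
    rfl
  have h := VectorField.mpullback_mlieBracket (n := ∞) ((differentiableAt_inChart_iff hy).1 hV)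
    ((differentiableAt_inChart_iff hy).1 hW) (contMDiffAt_extChartAt_symm hy) (by simp; norm_cast)
  rw [VectorField.mpullback_apply, inverse_mfderiv_extChartAt_symm hy] at h
  refine h.trans ?_
  rw [(hpull V).mlieBracket_vectorField_eq (hpull W)]
  exact mlieBracket_modelSpace _ _ y

end SectionsInCharts

namespace System

variable {n r k : ℕ} {Q S G : Type*}
  [TopologicalSpace Q] [ChartedSpace (Eu n) Q] [IsManifold 𝓘(ℝ, Eu n) ∞ Q]
  [TopologicalSpace S] [ChartedSpace (Eu r) S] [IsManifold 𝓘(ℝ, Eu r) ∞ S]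
  [TopologicalSpace G] [ChartedSpace (Eu k) G] [Group G] [LieGroup 𝓘(ℝ, Eu k) ∞ G]
  [MulAction G Q] [ContMDiffSMul 𝓘(ℝ, Eu k) 𝓘(ℝ, Eu n) ∞ G Q] [ProperSMul G Q]
  (C : System n r k Q S G)

/-! ### Horizontal lifts and the orthogonal projector -/

theorem hor_mem (q : Q) (u : Tan r (C.prj q)) : C.hor q u ∈ C.D q :=
  ((LinearEquiv.ofBijective _ (C.bijective_dprj q)).symm u).2

theorem dprj_hor (q : Q) (u : Tan r (C.prj q)) : C.dprj q (C.hor q u) = u :=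
  (LinearEquiv.ofBijective _ (C.bijective_dprj q)).apply_symm_apply u

theorem eq_of_dprj_eq {q : Q} {v w : Tan n q} (hv : v ∈ C.D q) (hw : w ∈ C.D q)
    (h : C.dprj q v = C.dprj q w) : v = w :=
  congrArg Subtype.val ((C.bijective_dprj q).1 (a₁ := ⟨v, hv⟩) (a₂ := ⟨w, hw⟩) h)

theorem hor_dprj {q : Q} {v : Tan n q} (hv : v ∈ C.D q) : C.hor q (C.dprj q v) = v :=
  C.eq_of_dprj_eq (C.hor_mem q _) hv (C.dprj_hor q _)

theorem proj_mem (q : Q) (v : Tan n q) : C.proj q v ∈ C.D q :=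
  Submodule.projection_apply_mem _ v

theorem proj_of_mem {q : Q} {v : Tan n q} (hv : v ∈ C.D q) : C.proj q v = v :=
  (Submodule.projection_eq_self_iff _ v).2 hv

/-- The difference `w - C.proj q w` lies in the orthogonal complement of `C.D q`. -/
theorem inner_proj {q : Q} {v : Tan n q} (hv : v ∈ C.D q) (w : Tan n q) :
    C.metric.inner q v (C.proj q w) = C.metric.inner q v w := by
  have h : w - C.proj q w ∈ (C.form q).orthogonal (C.D q) := by
    refine (Submodule.projection_apply_eq_zero_iff (C.isCompl_orthogonal q)).1 ?_
    have h1 : C.proj q (w - C.proj q w) = 0 := by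
      rw [map_sub, C.proj_of_mem (C.proj_mem q w), sub_self]
    exact h1
  have h2 := h v hv
  rw [form_apply, map_sub, sub_eq_zero] at h2
  exact h2.symm

theorem hor_dprj_proj (q : Q) (v : Tan n q) : C.hor q (C.dprj q (C.proj q v)) = C.proj q v :=
  C.hor_dprj (C.proj_mem q v)

/-! ### The projection, the horizontal lift and the metric in charts -/

/-- The coordinates, in the chart at `q₀`, of the points `q` such that `π(q)` is in the chart at
`π(q₀)`. -/
def chartDomain (q₀ : Q) : Set (Eu n) :=
  (extChartAt 𝓘(ℝ, Eu n) q₀).target ∩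
    (fun y => C.prj ((extChartAt 𝓘(ℝ, Eu n) q₀).symm y)) ⁻¹' (chartAt (Eu r) (C.prj q₀)).source

theorem isOpen_chartDomain (q₀ : Q) : IsOpen (C.chartDomain q₀) :=
  (C.smooth_prj.continuous.comp_continuousOn (continuousOn_extChartAt_symm q₀)).isOpen_inter_preimage
    (isOpen_extChartAt_target q₀) (chartAt (Eu r) (C.prj q₀)).open_source

theorem mem_chartDomain (q₀ : Q) : extChartAt 𝓘(ℝ, Eu n) q₀ q₀ ∈ C.chartDomain q₀ := by
  refine ⟨mem_extChartAt_target q₀, ?_⟩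
  simp only [Set.mem_preimage]
  rw [extChartAt_to_inv]
  exact mem_chart_source _ _

/-- The projection `π` in the charts at `q₀` and `π(q₀)`. -/
def prjC (q₀ : Q) (y : Eu n) : Eu r :=
  extChartAt 𝓘(ℝ, Eu r) (C.prj q₀) (C.prj ((extChartAt 𝓘(ℝ, Eu n) q₀).symm y))

/-- The horizontal lift in the charts at `q₀` and `π(q₀)`. -/
def horC (q₀ : Q) (y : Eu n) : Eu r →L[ℝ] Eu n :=
  toChart q₀ ((extChartAt 𝓘(ℝ, Eu n) q₀).symm y) ∘L C.hor ((extChartAt 𝓘(ℝ, Eu n) q₀).symm y) ∘L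
    ofChart (C.prj q₀) (C.prj ((extChartAt 𝓘(ℝ, Eu n) q₀).symm y))

/-- The kinetic energy metric in the chart at `q₀`. -/
def metricC (q₀ : Q) (y : Eu n) : Eu n →L[ℝ] Eu n →L[ℝ] ℝ :=
  (show Eu n →L[ℝ] Eu n →L[ℝ] ℝ from
    C.metric.inner ((extChartAt 𝓘(ℝ, Eu n) q₀).symm y)).bilinearComp
    (show Eu n →L[ℝ] Eu n from ofChart q₀ ((extChartAt 𝓘(ℝ, Eu n) q₀).symm y))
    (show Eu n →L[ℝ] Eu n from ofChart q₀ ((extChartAt 𝓘(ℝ, Eu n) q₀).symm y))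

theorem metricC_apply (q₀ : Q) (y v w : Eu n) : C.metricC q₀ y v w =
    C.metric.inner ((extChartAt 𝓘(ℝ, Eu n) q₀).symm y)
      (ofChart q₀ ((extChartAt 𝓘(ℝ, Eu n) q₀).symm y) v)
      (ofChart q₀ ((extChartAt 𝓘(ℝ, Eu n) q₀).symm y) w) := rfl

variable {C} {q₀ : Q} {y : Eu n}

theorem contDiffAt_prjC (hy : y ∈ C.chartDomain q₀) : ContDiffAt ℝ ∞ (C.prjC q₀) y := by
  have h := (contMDiffAt_extChartAt' (n := ∞) (I := 𝓘(ℝ, Eu r)) hy.2).comp _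
    C.smooth_prj.contMDiffAt
  exact contDiffAt_comp_extChartAt_symm hy.1 h

theorem fderiv_prjC (hy : y ∈ C.chartDomain q₀) (v : Eu n) :
    fderiv ℝ (C.prjC q₀) y v =
      toChart (C.prj q₀) (C.prj ((extChartAt 𝓘(ℝ, Eu n) q₀).symm y))
        (C.dprj ((extChartAt 𝓘(ℝ, Eu n) q₀).symm y)
          (ofChart q₀ ((extChartAt 𝓘(ℝ, Eu n) q₀).symm y) v)) := by
  have : IsManifold 𝓘(ℝ, Eu r) 1 S := .of_le (n := ∞) (by simp)
  have h1 : MDifferentiableAt 𝓘(ℝ, Eu n) 𝓘(ℝ, Eu r) C.prj ((extChartAt 𝓘(ℝ, Eu n) q₀).symm y) :=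
    C.smooth_prj.mdifferentiable (by simp) _
  have h2 := mfderiv_comp y h1 (mdifferentiableAt_extChartAt_symm hy.1)
  have h3 := mfderiv_comp y (g := extChartAt 𝓘(ℝ, Eu r) (C.prj q₀))
    (mdifferentiableAt_extChartAt hy.2) (h1.comp y (mdifferentiableAt_extChartAt_symm hy.1))
  rw [h2, mfderiv_eq_fderiv] at h3
  rw [toChart_eq_mfderiv hy.2, ← mfderiv_extChartAt_symm_apply hy.1]
  exact DFunLike.congr_fun h3 v

theorem ofChart_horC (hy : y ∈ C.chartDomain q₀) (u : Eu r) :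
    ofChart q₀ ((extChartAt 𝓘(ℝ, Eu n) q₀).symm y) (C.horC q₀ y u) =
      C.hor ((extChartAt 𝓘(ℝ, Eu n) q₀).symm y)
        (ofChart (C.prj q₀) (C.prj ((extChartAt 𝓘(ℝ, Eu n) q₀).symm y)) u) :=
  ofChart_toChart (extChartAt_symm_mem hy.1) _

theorem fderiv_prjC_horC (hy : y ∈ C.chartDomain q₀) (u : Eu r) :
    fderiv ℝ (C.prjC q₀) y (C.horC q₀ y u) = u := by
  rw [fderiv_prjC hy, ofChart_horC hy, C.dprj_hor, toChart_ofChart hy.2]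

theorem contDiffAt_metricC (hy : y ∈ (extChartAt 𝓘(ℝ, Eu n) q₀).target) :
    ContDiffAt ℝ ∞ (C.metricC q₀) y := by
  refine contDiffAt_clm_of_apply fun v => contDiffAt_clm_of_apply fun w => ?_
  have hs := extChartAt_symm_mem hy
  have h1 := C.metric.contMDiff.contMDiffAt (x := (extChartAt 𝓘(ℝ, Eu n) q₀).symm y)
  have h2 := ContMDiffAt.clm_bundle_apply₂ (F₁ := Eu n) (F₂ := Eu n) (b := fun q : Q => q)
    (F₃ := ℝ) (E₃ := Bundle.Trivial Q ℝ) h1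
    (contMDiffAt_ofChart hs v) (contMDiffAt_ofChart hs w)
  have h3 := (contMDiffAt_totalSpace.1 h2).2
  exact contDiffAt_comp_extChartAt_symm hy h3

/-- The horizontal lift is defined pointwise as an inverse, which does not show its smoothness. A
smooth local frame of `D` is the source of smoothness in `contDiffAt_horC`. -/
theorem exists_contDiffAt_frame (q₀ : Q) : ∃ X : Eu n → Eu r →L[ℝ] Eu n,
    ContDiffAt ℝ ∞ X (extChartAt 𝓘(ℝ, Eu n) q₀ q₀) ∧
    ∀ᶠ y in 𝓝 (extChartAt 𝓘(ℝ, Eu n) q₀ q₀), ∀ u, ∃ c, X y c = C.horC q₀ y u := by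
  obtain ⟨W, X, hW, hq, hX, hD⟩ := C.smooth_D q₀
  refine ⟨fun y => ∑ i : Fin r, (EuclideanSpace.proj i : Eu r →L[ℝ] ℝ).smulRight
    ((X i).inChart q₀ y), ?_, ?_⟩
  · refine contDiffAt_clm_of_apply fun c => ?_
    simp only [sum_apply, ContinuousLinearMap.smulRight_apply]
    refine ContDiffAt.sum fun i _ => contDiffAt_const.fun_smul ?_
    refine contDiffAt_inChart_of_contMDiffAt (mem_extChartAt_target q₀) ?_
    rw [extChartAt_to_inv]
    exact (hX i).contMDiffAt (hW.mem_nhds hq)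
  · have hW' : ∀ᶠ y in 𝓝 (extChartAt 𝓘(ℝ, Eu n) q₀ q₀),
        (extChartAt 𝓘(ℝ, Eu n) q₀).symm y ∈ W := by
      refine (continuousAt_extChartAt_symm q₀).eventually ?_
      rw [extChartAt_to_inv]
      exact hW.mem_nhds hq
    filter_upwards [hW', (isOpen_extChartAt_target q₀).mem_nhds (mem_extChartAt_target q₀)]
      with y hy hyt u
    have h := C.hor_mem _ (ofChart (C.prj q₀) (C.prj ((extChartAt 𝓘(ℝ, Eu n) q₀).symm y)) u)
    rw [← (hD _ hy).2] at h
    obtain ⟨c, hc⟩ := (Submodule.mem_span_range_iff_exists_fun ℝ).1 h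
    refine ⟨WithLp.toLp 2 c, ?_⟩
    simp only [sum_apply, ContinuousLinearMap.smulRight_apply]
    change _ = toChart q₀ _ (C.hor _ (ofChart _ _ u))
    rw [← hc, map_sum]
    refine Finset.sum_congr rfl fun i _ => ?_
    rw [map_smul]
    rfl

end System

/-! ### Smoothness of the horizontal lift, the reduced metric and the gyroscopic tensor. -/

theorem exists_continuousLinearEquiv_of_surjective {E : Type*} [NormedAddCommGroup E]
    [NormedSpace ℝ E] [FiniteDimensional ℝ E] {A : E →L[ℝ] E} (hA : Function.Surjective A) :
    ∃ e : E ≃L[ℝ] E, (e : E →L[ℝ] E) = A :=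
  ⟨(LinearEquiv.ofBijective A.toLinearMap
    ⟨LinearMap.injective_iff_surjective.2 hA, hA⟩).toContinuousLinearEquiv, by ext; rfl⟩

theorem exists_continuousLinearEquiv_of_pos {E : Type*} [NormedAddCommGroup E]
    [NormedSpace ℝ E] [FiniteDimensional ℝ E] {g : E →L[ℝ] E →L[ℝ] ℝ}
    (hg : ∀ v, v ≠ 0 → 0 < g v v) : ∃ e : E ≃L[ℝ] E →L[ℝ] ℝ, (e : E →L[ℝ] E →L[ℝ] ℝ) = g := by
  have hinj : Function.Injective g.toLinearMap := by
    refine (injective_iff_map_eq_zero _).2 fun v hv => ?_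
    by_contra h
    have h1 := hg v h
    have h2 : g v = 0 := hv
    rw [h2] at h1
    exact lt_irrefl _ h1
  have hdim : Module.finrank ℝ E = Module.finrank ℝ (E →L[ℝ] ℝ) := by
    rw [← (LinearMap.toContinuousLinearMap : (E →ₗ[ℝ] ℝ) ≃ₗ[ℝ] E →L[ℝ] ℝ).finrank_eq]
    exact (Subspace.dual_finrank_eq (K := ℝ) (V := E)).symm
  exact ⟨(LinearEquiv.ofBijective g.toLinearMap
    ⟨hinj, (LinearMap.injective_iff_surjective_of_finrank_eq_finrank hdim).1 hinj⟩
      ).toContinuousLinearEquiv, by ext; rfl⟩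

theorem contDiffAt_bilin_apply {D E F G : Type*} [NormedAddCommGroup D] [NormedSpace ℝ D]
    [NormedAddCommGroup E] [NormedSpace ℝ E] [NormedAddCommGroup F] [NormedSpace ℝ F]
    [NormedAddCommGroup G] [NormedSpace ℝ G] {f : D → E →L[ℝ] F →L[ℝ] G} {u : D → E} {v : D → F}
    {x : D} (hf : ContDiffAt ℝ ∞ f x) (hu : ContDiffAt ℝ ∞ u x) (hv : ContDiffAt ℝ ∞ v x) :
    ContDiffAt ℝ ∞ (fun y => f y (u y) (v y)) x :=
  (hf.clm_apply hu).clm_apply hv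

namespace System

variable {n r k : ℕ} {Q S G : Type*}
  [TopologicalSpace Q] [ChartedSpace (Eu n) Q] [IsManifold 𝓘(ℝ, Eu n) ∞ Q]
  [TopologicalSpace S] [ChartedSpace (Eu r) S] [IsManifold 𝓘(ℝ, Eu r) ∞ S]
  [TopologicalSpace G] [ChartedSpace (Eu k) G] [Group G] [LieGroup 𝓘(ℝ, Eu k) ∞ G]
  [MulAction G Q] [ContMDiffSMul 𝓘(ℝ, Eu k) 𝓘(ℝ, Eu n) ∞ G Q] [ProperSMul G Q]
  {C : System n r k Q S G} {q₀ : Q} {y : Eu n}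

theorem eventually_mem_chartDomain (C : System n r k Q S G) (q₀ : Q) :
    ∀ᶠ y in 𝓝 (extChartAt 𝓘(ℝ, Eu n) q₀ q₀), y ∈ C.chartDomain q₀ :=
  (C.isOpen_chartDomain q₀).mem_nhds (C.mem_chartDomain q₀)

-- With a smooth frame `X` of `D`, the lift is `X ∘ (dπ ∘ X)⁻¹`. Here `dπ ∘ X` is an endomorphism of
-- `ℝʳ`, invertible because it is surjective, and inversion of invertible operators is smooth.
variable (C) in
theorem contDiffAt_horC (q₀ : Q) :
    ContDiffAt ℝ ∞ (C.horC q₀) (extChartAt 𝓘(ℝ, Eu n) q₀ q₀) := by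
  obtain ⟨X, hX, hXh⟩ := C.exists_contDiffAt_frame q₀
  have hA : ContDiffAt ℝ ∞ (fun y => fderiv ℝ (C.prjC q₀) y ∘L X y)
      (extChartAt 𝓘(ℝ, Eu n) q₀ q₀) :=
    ((contDiffAt_prjC (C.mem_chartDomain q₀)).fderiv_right (m := ∞) (by simp)).clm_comp hX
  have hsurj : ∀ y, y ∈ C.chartDomain q₀ → (∀ u, ∃ c, X y c = C.horC q₀ y u) →
      Function.Surjective (fderiv ℝ (C.prjC q₀) y ∘L X y) := by
    intro y hy h u
    obtain ⟨c, hc⟩ := h u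
    refine ⟨c, ?_⟩
    rw [ContinuousLinearMap.comp_apply, hc, fderiv_prjC_horC hy]
  obtain ⟨e, he⟩ := exists_continuousLinearEquiv_of_surjective
    (hsurj _ (C.mem_chartDomain q₀) hXh.self_of_nhds)
  have hinv : ContDiffAt ℝ ∞ (fun y => (fderiv ℝ (C.prjC q₀) y ∘L X y).inverse)
      (extChartAt 𝓘(ℝ, Eu n) q₀ q₀) := by
    refine ContDiffAt.comp (g := ContinuousLinearMap.inverse) _ ?_ hA
    rw [← he]
    exact contDiffAt_map_inverse e
  refine (hX.clm_comp hinv).congr_of_eventuallyEq ?_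
  filter_upwards [hXh, C.eventually_mem_chartDomain q₀] with y hy hyd
  obtain ⟨e, he⟩ := exists_continuousLinearEquiv_of_surjective (hsurj y hyd hy)
  refine ContinuousLinearMap.ext fun u => ?_
  obtain ⟨c, hc⟩ := hy u
  have h1 : e c = u := by
    have : (e : Eu r →L[ℝ] Eu r) c = u := by
      rw [he, ContinuousLinearMap.comp_apply, hc, fderiv_prjC_horC hyd]
    exact this
  rw [ContinuousLinearMap.comp_apply, ← he, ContinuousLinearMap.inverse_equiv, ← hc]
  congr 1
  rw [← h1]
  exact (e.symm_apply_apply c).symm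

variable (C) in
/-- The reduced metric in the charts at `q₀` and `π(q₀)`. -/
def redMetricC (q₀ : Q) (y : Eu n) : Eu r →L[ℝ] Eu r →L[ℝ] ℝ :=
  (C.metricC q₀ y).bilinearComp (C.horC q₀ y) (C.horC q₀ y)

theorem redMetricC_apply (q₀ : Q) (y : Eu n) (u v : Eu r) :
    C.redMetricC q₀ y u v = C.metricC q₀ y (C.horC q₀ y u) (C.horC q₀ y v) := rfl

theorem redMetricC_eq (hy : y ∈ C.chartDomain q₀) (u v : Eu r) :
    C.redMetricC q₀ y u v = C.metric.inner ((extChartAt 𝓘(ℝ, Eu n) q₀).symm y)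
      (C.hor _ (ofChart (C.prj q₀) (C.prj ((extChartAt 𝓘(ℝ, Eu n) q₀).symm y)) u))
      (C.hor _ (ofChart (C.prj q₀) (C.prj ((extChartAt 𝓘(ℝ, Eu n) q₀).symm y)) v)) := by
  rw [redMetricC_apply, metricC_apply, ofChart_horC hy, ofChart_horC hy]

theorem redMetricC_comm (hy : y ∈ C.chartDomain q₀) (u v : Eu r) :
    C.redMetricC q₀ y u v = C.redMetricC q₀ y v u := by
  rw [redMetricC_eq hy, redMetricC_eq hy, C.metric.symm]

theorem redMetricC_pos (hy : y ∈ C.chartDomain q₀) {u : Eu r} (hu : u ≠ 0) :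
    0 < C.redMetricC q₀ y u u := by
  rw [redMetricC_eq hy]
  refine C.metric.pos _ _ fun h => hu ?_
  have h1 := C.dprj_hor _ (ofChart (C.prj q₀) (C.prj ((extChartAt 𝓘(ℝ, Eu n) q₀).symm y)) u)
  rw [h, map_zero] at h1
  rw [← toChart_ofChart hy.2 u, ← h1, map_zero]

variable (C) in
theorem contDiffAt_redMetricC (q₀ : Q) :
    ContDiffAt ℝ ∞ (C.redMetricC q₀) (extChartAt 𝓘(ℝ, Eu n) q₀ q₀) := by
  refine contDiffAt_clm_of_apply fun u => contDiffAt_clm_of_apply fun v => ?_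
  have h : ∀ u : Eu r, ContDiffAt ℝ ∞ (fun y => C.horC q₀ y u) (extChartAt 𝓘(ℝ, Eu n) q₀ q₀) :=
    fun u => (C.contDiffAt_horC q₀).clm_apply contDiffAt_const
  simp only [redMetricC_apply]
  exact contDiffAt_bilin_apply (contDiffAt_metricC (C := C) (mem_extChartAt_target q₀)) (h u) (h v)

variable (C) in
/-- The inverse of the reduced metric in the charts at `q₀` and `π(q₀)`. -/
def redCometricC (q₀ : Q) (y : Eu n) : (Eu r →L[ℝ] ℝ) →L[ℝ] Eu r :=
  (C.redMetricC q₀ y).inverse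

theorem redMetricC_redCometricC (hy : y ∈ C.chartDomain q₀) (p : Eu r →L[ℝ] ℝ) :
    C.redMetricC q₀ y (C.redCometricC q₀ y p) = p := by
  obtain ⟨e, he⟩ := exists_continuousLinearEquiv_of_pos fun v hv => redMetricC_pos hy (u := v) hv
  rw [redCometricC, ← he, ContinuousLinearMap.inverse_equiv]
  exact e.apply_symm_apply p

theorem redCometricC_redMetricC (hy : y ∈ C.chartDomain q₀) (u : Eu r) :
    C.redCometricC q₀ y (C.redMetricC q₀ y u) = u := by
  obtain ⟨e, he⟩ := exists_continuousLinearEquiv_of_pos fun v hv => redMetricC_pos hy (u := v) hv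
  rw [redCometricC, ← he, ContinuousLinearMap.inverse_equiv]
  exact e.symm_apply_apply u

theorem redCometricC_comm (hy : y ∈ C.chartDomain q₀) (p p' : Eu r →L[ℝ] ℝ) :
    p (C.redCometricC q₀ y p') = p' (C.redCometricC q₀ y p) := by
  conv_lhs => rw [← redMetricC_redCometricC hy p]
  rw [redMetricC_comm hy, redMetricC_redCometricC hy]

variable (C) in
theorem contDiffAt_redCometricC (q₀ : Q) :
    ContDiffAt ℝ ∞ (C.redCometricC q₀) (extChartAt 𝓘(ℝ, Eu n) q₀ q₀) := by
  refine ContDiffAt.comp (g := ContinuousLinearMap.inverse) _ ?_ (C.contDiffAt_redMetricC q₀)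
  obtain ⟨e, he⟩ := exists_continuousLinearEquiv_of_pos
    fun v hv => redMetricC_pos (C.mem_chartDomain q₀) (u := v) hv
  rw [← he]
  exact contDiffAt_map_inverse e

variable (C) in
/-- The map `Tπ ∘ 𝒫` in the charts at `q₀` and `π(q₀)`. -/
def dprjProjC (q₀ : Q) (y : Eu n) : Eu n →L[ℝ] Eu r :=
  toChart (C.prj q₀) (C.prj ((extChartAt 𝓘(ℝ, Eu n) q₀).symm y)) ∘L
    C.dprj ((extChartAt 𝓘(ℝ, Eu n) q₀).symm y) ∘L C.proj ((extChartAt 𝓘(ℝ, Eu n) q₀).symm y) ∘L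
      ofChart q₀ ((extChartAt 𝓘(ℝ, Eu n) q₀).symm y)

theorem ofChart_dprjProjC (hy : y ∈ C.chartDomain q₀) (v : Eu n) :
    ofChart (C.prj q₀) (C.prj ((extChartAt 𝓘(ℝ, Eu n) q₀).symm y)) (C.dprjProjC q₀ y v) =
      C.dprj ((extChartAt 𝓘(ℝ, Eu n) q₀).symm y) (C.proj ((extChartAt 𝓘(ℝ, Eu n) q₀).symm y)
        (ofChart q₀ ((extChartAt 𝓘(ℝ, Eu n) q₀).symm y) v)) :=
  ofChart_toChart hy.2 _

theorem dprjProjC_horC (hy : y ∈ C.chartDomain q₀) (u : Eu r) :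
    C.dprjProjC q₀ y (C.horC q₀ y u) = u := by
  change toChart _ _ (C.dprj _ (C.proj _ (ofChart q₀ _ (C.horC q₀ y u)))) = u
  rw [ofChart_horC hy, C.proj_of_mem (C.hor_mem _ _), C.dprj_hor, toChart_ofChart hy.2]

/-- Pairing `Tπ(𝒫 v)` with `u` in the reduced metric gives `⟪𝒫 v, hor u⟫ = ⟪v, hor u⟫`. The
projector is thereby expressed through the metric and the horizontal lift, which are already known
to be smooth. -/
theorem dprjProjC_eq (hy : y ∈ C.chartDomain q₀) (v : Eu n) :
    C.dprjProjC q₀ y v = C.redCometricC q₀ y (C.metricC q₀ y v ∘L C.horC q₀ y) := by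
  rw [← redCometricC_redMetricC hy (C.dprjProjC q₀ y v)]
  congr 1
  refine ContinuousLinearMap.ext fun u => ?_
  rw [redMetricC_eq hy, ofChart_dprjProjC hy, C.hor_dprj_proj, C.metric.symm,
    C.inner_proj (C.hor_mem _ _), C.metric.symm, ContinuousLinearMap.comp_apply, metricC_apply,
    ofChart_horC hy]

variable (C) in
theorem contDiffAt_dprjProjC (q₀ : Q) :
    ContDiffAt ℝ ∞ (C.dprjProjC q₀) (extChartAt 𝓘(ℝ, Eu n) q₀ q₀) := by
  refine contDiffAt_clm_of_apply fun v => ?_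
  refine ((C.contDiffAt_redCometricC q₀).clm_apply
    (((contDiffAt_metricC (C := C) (mem_extChartAt_target q₀)).clm_apply
      (contDiffAt_const (c := v))).clm_comp (C.contDiffAt_horC q₀))).congr_of_eventuallyEq ?_
  filter_upwards [C.eventually_mem_chartDomain q₀] with y hy
  exact dprjProjC_eq hy v

variable (C) in
/-- The gyroscopic tensor in the charts at `q₀` and `π(q₀)`. -/
def gyroC (q₀ : Q) (y : Eu n) : Eu r →L[ℝ] Eu r →L[ℝ] Eu r :=
  ContinuousLinearMap.compL ℝ (Eu r) (Eu n) (Eu r) (C.dprjProjC q₀ y) ∘L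
    (fderiv ℝ (C.horC q₀) y ∘L C.horC q₀ y - (fderiv ℝ (C.horC q₀) y ∘L C.horC q₀ y).flip)

theorem gyroC_apply (q₀ : Q) (y : Eu n) (u v : Eu r) :
    C.gyroC q₀ y u v = C.dprjProjC q₀ y (fderiv ℝ (C.horC q₀) y (C.horC q₀ y u) v -
      fderiv ℝ (C.horC q₀) y (C.horC q₀ y v) u) := rfl

theorem gyroC_swap (q₀ : Q) (y : Eu n) (u v : Eu r) :
    C.gyroC q₀ y u v = -C.gyroC q₀ y v u := by
  rw [gyroC_apply, gyroC_apply, ← map_neg, neg_sub]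

variable (C) in
theorem contDiffAt_gyroC (q₀ : Q) :
    ContDiffAt ℝ ∞ (C.gyroC q₀) (extChartAt 𝓘(ℝ, Eu n) q₀ q₀) := by
  refine contDiffAt_clm_of_apply fun u => contDiffAt_clm_of_apply fun v => ?_
  have h := C.contDiffAt_horC q₀
  have h' := h.fderiv_right (m := ∞) (by simp)
  have hd : ∀ u v : Eu r, ContDiffAt ℝ ∞
      (fun y => fderiv ℝ (C.horC q₀) y (C.horC q₀ y u) v) (extChartAt 𝓘(ℝ, Eu n) q₀ q₀) :=
    fun u v => contDiffAt_bilin_apply h' (h.clm_apply contDiffAt_const) contDiffAt_const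
  exact (C.contDiffAt_dprjProjC q₀).clm_apply (ContDiffAt.sub (hd u v) (hd v u))

end System

namespace System

variable {n r k : ℕ} {Q S G : Type*}
  [TopologicalSpace Q] [ChartedSpace (Eu n) Q] [IsManifold 𝓘(ℝ, Eu n) ∞ Q]
  [TopologicalSpace S] [ChartedSpace (Eu r) S] [IsManifold 𝓘(ℝ, Eu r) ∞ S]
  [TopologicalSpace G] [ChartedSpace (Eu k) G] [Group G] [LieGroup 𝓘(ℝ, Eu k) ∞ G]
  [MulAction G Q] [ContMDiffSMul 𝓘(ℝ, Eu k) 𝓘(ℝ, Eu n) ∞ G Q] [ProperSMul G Q]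
  {C : System n r k Q S G} {q₀ : Q} {y : Eu n}

/-! ### The gyroscopic tensor in charts -/

theorem inChart_prjC (hy : y ∈ C.chartDomain q₀) (Y : VField r S) :
    Y.inChart (C.prj q₀) (C.prjC q₀ y) =
      toChart (C.prj q₀) (C.prj ((extChartAt 𝓘(ℝ, Eu n) q₀).symm y))
        (Y (C.prj ((extChartAt 𝓘(ℝ, Eu n) q₀).symm y))) := by
  have h : C.prj ((extChartAt 𝓘(ℝ, Eu n) q₀).symm y) ∈
      (extChartAt 𝓘(ℝ, Eu r) (C.prj q₀)).source := by
    rw [extChartAt_source]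
    exact hy.2
  simp only [VField.inChart, prjC]
  rw [(extChartAt 𝓘(ℝ, Eu r) (C.prj q₀)).left_inv h]
  rfl

theorem inChart_horField (hy : y ∈ C.chartDomain q₀) (Y : VField r S) :
    VField.inChart (C.horField Y) q₀ y =
      C.horC q₀ y (Y.inChart (C.prj q₀) (C.prjC q₀ y)) := by
  rw [inChart_prjC hy]
  change toChart q₀ _ (C.hor _ (Y _)) = toChart q₀ _ (C.hor _ (ofChart _ _ (toChart _ _ (Y _))))
  rw [ofChart_toChart hy.2]

theorem hasFDerivAt_inChart_horField (hy : y ∈ C.chartDomain q₀)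
    (hh : DifferentiableAt ℝ (C.horC q₀) y) {Y : VField r S}
    (hY : DifferentiableAt ℝ (Y.inChart (C.prj q₀)) (C.prjC q₀ y)) :
    HasFDerivAt (VField.inChart (C.horField Y) q₀)
      ((C.horC q₀ y) ∘L (fderiv ℝ (Y.inChart (C.prj q₀)) (C.prjC q₀ y) ∘L
        fderiv ℝ (C.prjC q₀) y) +
        (fderiv ℝ (C.horC q₀) y).flip (Y.inChart (C.prj q₀) (C.prjC q₀ y))) y := by
  have h1 : HasFDerivAt (fun y => Y.inChart (C.prj q₀) (C.prjC q₀ y))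
      (fderiv ℝ (Y.inChart (C.prj q₀)) (C.prjC q₀ y) ∘L fderiv ℝ (C.prjC q₀) y) y :=
    hY.hasFDerivAt.comp y ((contDiffAt_prjC hy).differentiableAt (by simp)).hasFDerivAt
  refine (hh.hasFDerivAt.clm_apply h1).congr_of_eventuallyEq ?_
  filter_upwards [(C.isOpen_chartDomain q₀).mem_nhds hy] with z hz
  exact inChart_horField hz Y

/-- In `[hor Y, hor Z]` the terms that differentiate `Y` and `Z` are lifts, and `Tπ ∘ 𝒫` turns them
into the coordinate expression of `[Y, Z]`, which is subtracted. Only derivatives of the lift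
remain, so the result depends on `Y` and `Z` through their values alone. -/
theorem toChart_gyroOver (hy : y ∈ C.chartDomain q₀)
    (hh : DifferentiableAt ℝ (C.horC q₀) y) {Y Z : VField r S}
    (hY : DifferentiableAt ℝ (Y.inChart (C.prj q₀)) (C.prjC q₀ y))
    (hZ : DifferentiableAt ℝ (Z.inChart (C.prj q₀)) (C.prjC q₀ y)) :
    toChart (C.prj q₀) (C.prj ((extChartAt 𝓘(ℝ, Eu n) q₀).symm y))
      (C.gyroOver Y Z ((extChartAt 𝓘(ℝ, Eu n) q₀).symm y)) =
    C.gyroC q₀ y (Y.inChart (C.prj q₀) (C.prjC q₀ y)) (Z.inChart (C.prj q₀) (C.prjC q₀ y)) := by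
  have hs : C.prj ((extChartAt 𝓘(ℝ, Eu n) q₀).symm y) ∈
      (extChartAt 𝓘(ℝ, Eu r) (C.prj q₀)).source := by
    rw [extChartAt_source]
    exact hy.2
  have hx : C.prjC q₀ y ∈ (extChartAt 𝓘(ℝ, Eu r) (C.prj q₀)).target :=
    (extChartAt 𝓘(ℝ, Eu r) (C.prj q₀)).map_source hs
  have hYd := hasFDerivAt_inChart_horField hy hh hY
  have hZd := hasFDerivAt_inChart_horField hy hh hZ
  have h1 := toChart_mlieBracket hy.1 hYd.differentiableAt hZd.differentiableAt
  have h2 := toChart_mlieBracket hx hY hZ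
  have hpt : (extChartAt 𝓘(ℝ, Eu r) (C.prj q₀)).symm (C.prjC q₀ y) =
      C.prj ((extChartAt 𝓘(ℝ, Eu n) q₀).symm y) := (extChartAt 𝓘(ℝ, Eu r) (C.prj q₀)).left_inv hs
  rw [hpt] at h2
  have h3 : ∀ V : Tan n ((extChartAt 𝓘(ℝ, Eu n) q₀).symm y),
      toChart (C.prj q₀) (C.prj ((extChartAt 𝓘(ℝ, Eu n) q₀).symm y)) (C.dprj _ (C.proj _ V)) =
        C.dprjProjC q₀ y (toChart q₀ _ V) := by
    intro V
    change _ = toChart (C.prj q₀) _ (C.dprj _ (C.proj _ (ofChart q₀ _ (toChart q₀ _ V))))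
    rw [ofChart_toChart (extChartAt_symm_mem hy.1)]
  rw [gyroOver, map_sub, h3]
  refine (congrArg₂ (fun a b => C.dprjProjC q₀ y a - b) h1 h2).trans ?_
  rw [hYd.fderiv, hZd.fderiv, inChart_horField hy, inChart_horField hy, gyroC_apply]
  simp only [add_apply, ContinuousLinearMap.comp_apply,
    ContinuousLinearMap.flip_apply, fderiv_prjC_horC hy, map_sub, map_add, dprjProjC_horC hy]
  abel

/-! ### Independence of the point in the fibre -/

theorem prj_smul (C : System n r k Q S G) (g : G) (q : Q) : C.prj (g • q) = C.prj q :=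
  ((C.fibre_prj q (g • q)).2 ⟨g, rfl⟩).symm

theorem contMDiff_smul_left (_C : System n r k Q S G) (g : G) :
    ContMDiff 𝓘(ℝ, Eu n) 𝓘(ℝ, Eu n) ∞ (fun q : Q => g • q) :=
  (contMDiff_smul (I := 𝓘(ℝ, Eu k)) (I' := 𝓘(ℝ, Eu n)) (G := G) (M := Q)).comp
    (contMDiff_const.prodMk contMDiff_id)

/-- The tangent map at `q` of the action of `g`. -/
def dsmul (g : G) (q : Q) : Tan n q →L[ℝ] Tan n (g • q) :=
  mfderiv 𝓘(ℝ, Eu n) 𝓘(ℝ, Eu n) (fun p : Q => g • p) q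

theorem injective_dsmul (C : System n r k Q S G) (g : G) (q : Q) :
    Function.Injective (dsmul (n := n) g q) := by
  have h := mfderiv_comp q (I := 𝓘(ℝ, Eu n)) (I' := 𝓘(ℝ, Eu n)) (I'' := 𝓘(ℝ, Eu n))
    (g := fun p : Q => g⁻¹ • p) (f := fun p : Q => g • p)
    ((C.contMDiff_smul_left g⁻¹).mdifferentiable (by simp) _)
    ((C.contMDiff_smul_left g).mdifferentiable (by simp) q)
  have hid : ((fun p : Q => g⁻¹ • p) ∘ fun p : Q => g • p) = id := by
    funext p
    simp
  have key : ∀ f : Q → Q, f = id → ∀ v : Eu n,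
      (mfderiv 𝓘(ℝ, Eu n) 𝓘(ℝ, Eu n) f q v : Eu n) = v := by
    rintro _ rfl v
    rw [mfderiv_id]
    rfl
  intro v w hvw
  have h1 : (mfderiv 𝓘(ℝ, Eu n) 𝓘(ℝ, Eu n) ((fun p : Q => g⁻¹ • p) ∘ fun p : Q => g • p) q v : Eu n)
      = mfderiv 𝓘(ℝ, Eu n) 𝓘(ℝ, Eu n) ((fun p : Q => g⁻¹ • p) ∘ fun p : Q => g • p) q w := by
    rw [h]
    exact congrArg (mfderiv 𝓘(ℝ, Eu n) 𝓘(ℝ, Eu n) (fun p : Q => g⁻¹ • p) (g • q)) hvw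
  exact (key _ hid v).symm.trans (h1.trans (key _ hid w))

theorem exists_equiv_eq_dsmul (C : System n r k Q S G) (g : G) (q : Q) :
    ∃ e : Tan n q ≃L[ℝ] Tan n (g • q), (e : Tan n q →L[ℝ] Tan n (g • q)) = dsmul g q := by
  have hdim : Module.finrank ℝ (Tan n q) = Module.finrank ℝ (Tan n (g • q)) := rfl
  exact ⟨(LinearEquiv.ofBijective (dsmul g q).toLinearMap ⟨C.injective_dsmul g q,
    (LinearMap.injective_iff_surjective_of_finrank_eq_finrank hdim).1
      (C.injective_dsmul g q)⟩).toContinuousLinearEquiv, by ext; rfl⟩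

theorem coord_dprj_dsmul (C : System n r k Q S G) (g : G) (q : Q) (v : Tan n q) :
    Tan.coord (C.dprj (g • q) (dsmul g q v)) = Tan.coord (C.dprj q v) := by
  have h := mfderiv_comp q (I := 𝓘(ℝ, Eu n)) (I' := 𝓘(ℝ, Eu n)) (I'' := 𝓘(ℝ, Eu r))
    (g := C.prj) (f := fun p : Q => g • p) (C.smooth_prj.mdifferentiable (by simp) _)
    ((C.contMDiff_smul_left g).mdifferentiable (by simp) q)
  have key : ∀ f : Q → S, f = C.prj →
      (mfderiv 𝓘(ℝ, Eu n) 𝓘(ℝ, Eu r) f q v : Eu r) = C.dprj q v := by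
    rintro _ rfl
    rfl
  have h1 := DFunLike.congr_fun h v
  exact h1.symm.trans (key _ (funext fun p => C.prj_smul g p))

theorem dsmul_mem (C : System n r k Q S G) (g : G) {q : Q} {v : Tan n q} (hv : v ∈ C.D q) :
    dsmul g q v ∈ C.D (g • q) := by
  rw [← C.D_inv g q]
  exact ⟨v, hv, rfl⟩

/-- Both sides lie in `D` at `g • q` and have the same image under `Tπ`, since `π` is invariant
under `g`. -/
theorem hor_smul (C : System n r k Q S G) (g : G) (q : Q) (u : Tan r (C.prj (g • q)))
    (u' : Tan r (C.prj q)) (hu : u.coord = u'.coord) :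
    C.hor (g • q) u = dsmul g q (C.hor q u') := by
  refine C.eq_of_dprj_eq (C.hor_mem _ _) (C.dsmul_mem g (C.hor_mem q u')) ?_
  rw [C.dprj_hor]
  refine Eq.trans ?_ (C.coord_dprj_dsmul g q (C.hor q u')).symm
  rw [C.dprj_hor]
  exact hu

theorem proj_eq_of_mem {q : Q} {v d : Tan n q} (hd : d ∈ C.D q)
    (h : ∀ w ∈ C.D q, C.metric.inner q w d = C.metric.inner q w v) : C.proj q v = d := by
  have hmem : C.proj q v - d ∈ C.D q := Submodule.sub_mem _ (C.proj_mem q v) hd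
  refine sub_eq_zero.1 (C.eq_zero_of_form_self q ?_)
  rw [form_apply, map_sub, C.inner_proj hmem, h _ hmem, sub_self]

/-- The action is isometric and preserves `D`, and the orthogonal projection is characterised by
inner products with `D`. -/
theorem proj_dsmul (C : System n r k Q S G) (g : G) (q : Q) (v : Tan n q) :
    C.proj (g • q) (dsmul g q v) = dsmul g q (C.proj q v) := by
  refine proj_eq_of_mem (C.dsmul_mem g (C.proj_mem q v)) fun w hw => ?_
  rw [← C.D_inv g q] at hw
  obtain ⟨w', hw', rfl⟩ := hw
  exact (C.metric_inv g q w' _).trans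
    ((C.inner_proj hw' v).trans (C.metric_inv g q w' v).symm)

theorem mdifferentiableAt_horField (C : System n r k Q S G) (q : Q) {Y : VField r S}
    (hY : MDifferentiableAt 𝓘(ℝ, Eu r) 𝓘(ℝ, Eu r).tangent
      (fun s => (⟨s, Y s⟩ : TangentBundle 𝓘(ℝ, Eu r) S)) (C.prj q)) :
    MDifferentiableAt 𝓘(ℝ, Eu n) 𝓘(ℝ, Eu n).tangent
      (fun q => (⟨q, C.horField Y q⟩ : TangentBundle 𝓘(ℝ, Eu n) Q)) q := by
  have hx : C.prjC q (extChartAt 𝓘(ℝ, Eu n) q q) = extChartAt 𝓘(ℝ, Eu r) (C.prj q) (C.prj q) := by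
    rw [prjC, extChartAt_to_inv]
  have hY' : DifferentiableAt ℝ (Y.inChart (C.prj q)) (C.prjC q (extChartAt 𝓘(ℝ, Eu n) q q)) := by
    rw [hx, differentiableAt_inChart_iff (mem_extChartAt_target _), extChartAt_to_inv]
    exact hY
  have h := (differentiableAt_inChart_iff (mem_extChartAt_target q)).1
    (hasFDerivAt_inChart_horField (C.mem_chartDomain q)
      ((C.contDiffAt_horC q).differentiableAt (by simp)) hY').differentiableAt
  rwa [extChartAt_to_inv] at h

omit [IsManifold 𝓘(ℝ, Eu r) ∞ S] in
theorem VField_congr (Y : VField r S) {s s' : S} (h : s = s') : (Y s).coord = (Y s').coord := by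
  subst h
  rfl

/-- Horizontal lifts are invariant under pullback by `g`, and pullback by a diffeomorphism preserves
brackets. -/
theorem mlieBracket_horField_smul (C : System n r k Q S G) (g : G) (q : Q) {Y Z : VField r S}
    (hY : MDifferentiableAt 𝓘(ℝ, Eu r) 𝓘(ℝ, Eu r).tangent
      (fun s => (⟨s, Y s⟩ : TangentBundle 𝓘(ℝ, Eu r) S)) (C.prj q))
    (hZ : MDifferentiableAt 𝓘(ℝ, Eu r) 𝓘(ℝ, Eu r).tangent
      (fun s => (⟨s, Z s⟩ : TangentBundle 𝓘(ℝ, Eu r) S)) (C.prj q)) :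
    VectorField.mlieBracket 𝓘(ℝ, Eu n) (C.horField Y) (C.horField Z) (g • q) =
      dsmul g q (VectorField.mlieBracket 𝓘(ℝ, Eu n) (C.horField Y) (C.horField Z) q) := by
  have : IsManifold 𝓘(ℝ, Eu n) (minSmoothness ℝ 3) Q := .of_le (n := ∞) (by simp; norm_cast)
  have : IsManifold 𝓘(ℝ, Eu n) (minSmoothness ℝ 2) Q := .of_le (n := ∞) (by simp; norm_cast)
  have hpull : ∀ Y : VField r S, VectorField.mpullback 𝓘(ℝ, Eu n) 𝓘(ℝ, Eu n)
      (fun p : Q => g • p) (C.horField Y) = C.horField Y := by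
    intro Y
    funext p
    rw [VectorField.mpullback_apply]
    obtain ⟨e, he⟩ := C.exists_equiv_eq_dsmul g p
    change (dsmul g p).inverse (C.hor (g • p) (Y (C.prj (g • p)))) = C.hor p (Y (C.prj p))
    rw [C.hor_smul g p _ (Y (C.prj p)) (VField_congr Y (C.prj_smul g p)), ← he,
      ContinuousLinearMap.inverse_equiv]
    exact e.symm_apply_apply _
  have hY' := C.mdifferentiableAt_horField (g • q) (Y := Y) (by rwa [C.prj_smul])
  have hZ' := C.mdifferentiableAt_horField (g • q) (Y := Z) (by rwa [C.prj_smul])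
  have h := VectorField.mpullback_mlieBracket (n := ∞) (f := fun p : Q => g • p) (x₀ := q)
    (I := 𝓘(ℝ, Eu n)) hY' hZ' (C.contMDiff_smul_left g).contMDiffAt (by simp; norm_cast)
  rw [hpull, hpull, VectorField.mpullback_apply] at h
  obtain ⟨e, he⟩ := C.exists_equiv_eq_dsmul g q
  rw [← h]
  change _ = dsmul g q ((dsmul g q).inverse _)
  rw [← he, ContinuousLinearMap.inverse_equiv]
  exact (e.apply_symm_apply _).symm

theorem coord_gyroOver_smul (C : System n r k Q S G) (g : G) (q : Q) {Y Z : VField r S}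
    (hY : MDifferentiableAt 𝓘(ℝ, Eu r) 𝓘(ℝ, Eu r).tangent
      (fun s => (⟨s, Y s⟩ : TangentBundle 𝓘(ℝ, Eu r) S)) (C.prj q))
    (hZ : MDifferentiableAt 𝓘(ℝ, Eu r) 𝓘(ℝ, Eu r).tangent
      (fun s => (⟨s, Z s⟩ : TangentBundle 𝓘(ℝ, Eu r) S)) (C.prj q)) :
    (C.gyroOver Y Z (g • q)).coord = (C.gyroOver Y Z q).coord := by
  have h1 := C.coord_dprj_dsmul g q
    (C.proj q (VectorField.mlieBracket 𝓘(ℝ, Eu n) (C.horField Y) (C.horField Z) q))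
  rw [← C.proj_dsmul, ← C.mlieBracket_horField_smul g q hY hZ] at h1
  have h2 := VField_congr (VectorField.mlieBracket 𝓘(ℝ, Eu r) Y Z) (C.prj_smul g q)
  exact congrArg₂ (fun a b : Eu r => a - b) h1 h2

/-- The point `C.pt (C.prj q)` used in the definition lies on the orbit of `q`, and `gyroOver` is
constant along orbits. Any point of the fibre may therefore be used. -/
theorem gyro_prj (C : System n r k Q S G) (q : Q) {Y Z : VField r S}
    (hY : MDifferentiableAt 𝓘(ℝ, Eu r) 𝓘(ℝ, Eu r).tangent
      (fun s => (⟨s, Y s⟩ : TangentBundle 𝓘(ℝ, Eu r) S)) (C.prj q))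
    (hZ : MDifferentiableAt 𝓘(ℝ, Eu r) 𝓘(ℝ, Eu r).tangent
      (fun s => (⟨s, Z s⟩ : TangentBundle 𝓘(ℝ, Eu r) S)) (C.prj q)) :
    C.gyro Y Z (C.prj q) = C.gyroOver Y Z q := by
  have h : C.prj q = C.prj (C.pt (C.prj q)) := (Function.surjInv_eq C.surjective_prj _).symm
  obtain ⟨g, hg⟩ := (C.fibre_prj _ _).1 h
  have h1 := C.coord_gyroOver_smul g q hY hZ
  rw [hg] at h1
  exact h1

end System

/-! ### Coordinate expressions on the shape space. -/

namespace System

variable {n r k : ℕ} {Q S G : Type*}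
  [TopologicalSpace Q] [ChartedSpace (Eu n) Q] [IsManifold 𝓘(ℝ, Eu n) ∞ Q]
  [TopologicalSpace S] [ChartedSpace (Eu r) S] [IsManifold 𝓘(ℝ, Eu r) ∞ S]
  [TopologicalSpace G] [ChartedSpace (Eu k) G] [Group G] [LieGroup 𝓘(ℝ, Eu k) ∞ G]
  [MulAction G Q] [ContMDiffSMul 𝓘(ℝ, Eu k) 𝓘(ℝ, Eu n) ∞ G Q] [ProperSMul G Q]
  {C : System n r k Q S G} {q₀ : Q} {y : Eu n}

/-- `gyroAt` uses the coordinate fields of the chart at the moving base point. Their values expand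
any two vectors there, so bilinearity and `toChart_gyroOver` replace this varying frame by one fixed
chart. -/
theorem toChart_gyroAt (hy : y ∈ C.chartDomain q₀) (hh : DifferentiableAt ℝ (C.horC q₀) y)
    (u v : Tan r (C.prj ((extChartAt 𝓘(ℝ, Eu n) q₀).symm y))) :
    toChart (C.prj q₀) (C.prj ((extChartAt 𝓘(ℝ, Eu n) q₀).symm y))
      (C.gyroAt (C.prj ((extChartAt 𝓘(ℝ, Eu n) q₀).symm y)) ![u, v]) =
    C.gyroC q₀ y (toChart (C.prj q₀) _ u) (toChart (C.prj q₀) _ v) := by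
  have : IsManifold 𝓘(ℝ, Eu r) 1 S := .of_le (n := ∞) (by simp)
  revert u v
  set q := (extChartAt 𝓘(ℝ, Eu n) q₀).symm y with hq
  intro u v
  have hs : C.prj q ∈ (extChartAt 𝓘(ℝ, Eu r) (C.prj q₀)).source := by
    rw [extChartAt_source]
    exact hy.2
  have hx : C.prjC q₀ y ∈ (extChartAt 𝓘(ℝ, Eu r) (C.prj q₀)).target :=
    (extChartAt 𝓘(ℝ, Eu r) (C.prj q₀)).map_source hs
  have hpt : (extChartAt 𝓘(ℝ, Eu r) (C.prj q₀)).symm (C.prjC q₀ y) = C.prj q :=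
    (extChartAt 𝓘(ℝ, Eu r) (C.prj q₀)).left_inv hs
  have hd : ∀ i, MDifferentiableAt 𝓘(ℝ, Eu r) 𝓘(ℝ, Eu r).tangent
      (fun s => (⟨s, coordField (C.prj q) i s⟩ : TangentBundle 𝓘(ℝ, Eu r) S)) (C.prj q) :=
    fun i => FiberBundle.mdifferentiableAt_extend _ _ _
  have hd' : ∀ i, DifferentiableAt ℝ ((coordField (C.prj q) i).inChart (C.prj q₀))
      (C.prjC q₀ y) := by
    intro i
    rw [differentiableAt_inChart_iff hx, hpt]
    exact hd i
  obtain ⟨e, he⟩ : ∃ e : Fin r → Tan r (C.prj q),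
      ∀ i, e i = (EuclideanSpace.single i (1 : ℝ) : Eu r) := ⟨_, fun _ => rfl⟩
  have hval : ∀ i, (coordField (C.prj q) i).inChart (C.prj q₀) (C.prjC q₀ y) =
      toChart (C.prj q₀) (C.prj q) (e i) := by
    intro i
    rw [inChart_prjC hy, he]
    congr 1
    exact FiberBundle.extend_apply_self (F := Eu r)
      (E := (TangentSpace 𝓘(ℝ, Eu r) : S → Type _)) (x := C.prj q)
      (show Tan r (C.prj q) from (EuclideanSpace.single i (1 : ℝ) : Eu r))
  have hterm : ∀ i j, toChart (C.prj q₀) (C.prj q)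
      (C.gyro (coordField (C.prj q) i) (coordField (C.prj q) j) (C.prj q)) =
      C.gyroC q₀ y (toChart (C.prj q₀) (C.prj q) (e i)) (toChart (C.prj q₀) (C.prj q) (e j)) := by
    intro i j
    rw [C.gyro_prj q (hd i) (hd j), ← hval i, ← hval j]
    exact toChart_gyroOver hy hh (hd' i) (hd' j)
  have hsum : ∀ w : Tan r (C.prj q), w = ∑ i, w.coord i • e i := by
    intro w
    simp only [he]
    refine (?_ : (w.coord : Eu r) = ∑ i, w.coord i • EuclideanSpace.single i (1 : ℝ))
    ext j
    simp [Pi.single_apply]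
  change toChart (C.prj q₀) (C.prj q) (∑ i : Fin r, ∑ j : Fin r, (u.coord i * v.coord j) •
    C.gyro (coordField (C.prj q) i) (coordField (C.prj q) j) (C.prj q)) = _
  conv_rhs => rw [hsum u, hsum v]
  simp only [map_sum, map_smul, hterm, FunLike.coe_sum, Finset.sum_apply, smul_apply,
    mul_smul, Finset.smul_sum]
  rw [Finset.sum_comm]
  refine Finset.sum_congr rfl fun i _ => Finset.sum_congr rfl fun j _ => ?_
  rw [smul_comm]

/-! ### The reduced Hamiltonian -/

theorem sharp_eq {q : Q} {β : Tan n q →L[ℝ] ℝ} {w : Tan n q}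
    (h : ∀ v, C.metric.inner q w v = β v) : C.sharp q β = w := by
  rw [sharp, LinearEquiv.symm_apply_eq]
  ext v
  exact (h v).symm

/-- The metric dual of `b ∘ 𝒫` is horizontal, because `b ∘ 𝒫` kills the orthogonal complement of
`D`. It is therefore the lift of the `w` that represents `b` on horizontal vectors. -/
theorem constrainedHam_eq (q : Q) (b : Tan n q →L[ℝ] ℝ) (w : Tan r (C.prj q))
    (hw : ∀ u, C.metric.inner q (C.hor q w) (C.hor q u) = b (C.hor q u)) :
    C.constrainedHam ⟨q, b⟩ = 1 / 2 * b (C.hor q w) + C.U q := by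
  have h : C.sharp q (b ∘L C.proj q) = C.hor q w := by
    refine sharp_eq fun v => ?_
    rw [← C.inner_proj (C.hor_mem q w), ← C.hor_dprj_proj, hw, C.hor_dprj_proj]
    rfl
  change 1 / 2 * (b ∘L C.proj q) (C.sharp q (b ∘L C.proj q)) + C.U q = _
  rw [h, ContinuousLinearMap.comp_apply, C.proj_of_mem (C.hor_mem q w)]

theorem inner_hor_redCometricC (hy : y ∈ C.chartDomain q₀)
    (b : Tan n ((extChartAt 𝓘(ℝ, Eu n) q₀).symm y) →L[ℝ] ℝ) (p : Eu r →L[ℝ] ℝ)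
    (hp : ∀ u, b (C.hor _ u) = p (toChart (C.prj q₀) _ u))
    (u : Tan r (C.prj ((extChartAt 𝓘(ℝ, Eu n) q₀).symm y))) :
    C.metric.inner _ (C.hor _ (ofChart (C.prj q₀) _ (C.redCometricC q₀ y p))) (C.hor _ u) =
      b (C.hor _ u) := by
  have h := redMetricC_eq hy (C.redCometricC q₀ y p) (toChart (C.prj q₀) _ u)
  rw [redMetricC_redCometricC hy, ofChart_toChart hy.2] at h
  rw [hp, ← h]

theorem constrainedHam_chart (hy : y ∈ C.chartDomain q₀)
    (b : Tan n ((extChartAt 𝓘(ℝ, Eu n) q₀).symm y) →L[ℝ] ℝ) (p : Eu r →L[ℝ] ℝ)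
    (hp : ∀ u, b (C.hor _ u) = p (toChart (C.prj q₀) _ u)) :
    C.constrainedHam ⟨(extChartAt 𝓘(ℝ, Eu n) q₀).symm y, b⟩ =
      2⁻¹ * p (C.redCometricC q₀ y p) + C.U ((extChartAt 𝓘(ℝ, Eu n) q₀).symm y) := by
  rw [constrainedHam_eq _ b _ (inner_hor_redCometricC hy b p hp), hp, toChart_ofChart hy.2,
    one_div]

theorem exists_inner_hor_eq (C : System n r k Q S G) (q : Q) (b : Tan n q →L[ℝ] ℝ) :
    ∃ w, ∀ u, C.metric.inner q (C.hor q w) (C.hor q u) = b (C.hor q u) := by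
  have h : ∀ b : Tan n ((extChartAt 𝓘(ℝ, Eu n) q).symm (extChartAt 𝓘(ℝ, Eu n) q q)) →L[ℝ] ℝ,
      ∃ w, ∀ u, C.metric.inner _ (C.hor _ w) (C.hor _ u) = b (C.hor _ u) := by
    intro b
    have hy := C.mem_chartDomain q
    refine ⟨_, inner_hor_redCometricC hy b (b ∘L C.hor _ ∘L ofChart (C.prj q) _) fun u => ?_⟩
    simp only [ContinuousLinearMap.comp_apply, ofChart_toChart hy.2]
  rw [extChartAt_to_inv] at h
  exact h b

theorem constrainedHam_smul (C : System n r k Q S G) (g : G) (q : Q) (b : Tan n q →L[ℝ] ℝ)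
    (b' : Tan n (g • q) →L[ℝ] ℝ)
    (h : ∀ (u : Tan r (C.prj q)) (u' : Tan r (C.prj (g • q))), u.coord = u'.coord →
      b (C.hor q u) = b' (C.hor (g • q) u')) :
    C.constrainedHam ⟨g • q, b'⟩ = C.constrainedHam ⟨q, b⟩ := by
  obtain ⟨w, hw⟩ := C.exists_inner_hor_eq q b
  rw [constrainedHam_eq q b w hw, constrainedHam_eq (g • q) b' w.coord ?_, ← h w w.coord rfl,
    C.U_inv]
  intro u'
  rw [C.hor_smul g q w.coord w rfl, C.hor_smul g q u' u'.coord rfl]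
  refine (C.metric_inv g q _ _).trans ?_
  refine (hw _).trans ((h _ u' rfl).trans ?_)
  rw [C.hor_smul g q u' u'.coord rfl]

-- The two covectors live in fibres over points that are only propositionally equal. The arguments
-- are compared through `Tan.coord`, since the tangent spaces share the same model space.
omit [IsManifold 𝓘(ℝ, Eu r) ∞ S] in
theorem covector_congr {α α' : Cot r S} (h : α = α') (u : Tan r α.proj) (u' : Tan r α'.proj)
    (hu : u.coord = u'.coord) : α.2 u = α'.2 u' := by
  subst h
  exact congrArg α.2 hu

/-- Covectors with the same image under `red` lie over one orbit and agree on horizontal vectors,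
which is all that the constrained Hamiltonian sees. This is why it descends to `T*S`. -/
theorem constrainedHam_congr (C : System n r k Q S G) {β β' : Cot n Q} (h : C.red β = C.red β') :
    C.constrainedHam β = C.constrainedHam β' := by
  obtain ⟨q, b⟩ := β
  obtain ⟨q', b'⟩ := β'
  have hp : C.prj q = C.prj q' := congrArg TotalSpace.proj h
  obtain ⟨g, rfl⟩ := (C.fibre_prj q q').1 hp
  exact (C.constrainedHam_smul g q b b' fun u u' hu => covector_congr h u u' hu).symm

theorem red_lift (C : System n r k Q S G) (q : Q) (a : Tan r (C.prj q) →L[ℝ] ℝ) :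
    C.red (C.lift q a) = ⟨C.prj q, a⟩ := by
  change (⟨C.prj q, ((a ∘L C.dprj q) ∘L C.proj q) ∘L C.hor q⟩ : Cot r S) = ⟨C.prj q, a⟩
  congr 1
  ext u
  simp only [ContinuousLinearMap.comp_apply, C.proj_of_mem (C.hor_mem q u), C.dprj_hor]

theorem surjective_red (C : System n r k Q S G) : Function.Surjective C.red := by
  rintro ⟨s, a⟩
  obtain ⟨q, rfl⟩ := C.surjective_prj s
  exact ⟨_, C.red_lift q a⟩

/-- The reduced Hamiltonian on `T*S`. -/
def redHam (C : System n r k Q S G) (α : Cot r S) : ℝ :=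
  C.constrainedHam (Function.surjInv C.surjective_red α)

theorem redHam_red (C : System n r k Q S G) (β : Cot n Q) :
    C.redHam (C.red β) = C.constrainedHam β :=
  C.constrainedHam_congr (Function.surjInv_eq C.surjective_red _)

/-! ### Coordinates on the shape space -/

/-- Coordinate expressions built from `Q` are functions on its chart; composing them with a smooth
local section of `π` makes them functions on the chart of `S`. -/
theorem exists_section (C : System n r k Q S G) (q₀ : Q) : ∃ σ : Eu r → Eu n,
    ContDiffAt ℝ ∞ σ (extChartAt 𝓘(ℝ, Eu r) (C.prj q₀) (C.prj q₀)) ∧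
    σ (extChartAt 𝓘(ℝ, Eu r) (C.prj q₀) (C.prj q₀)) = extChartAt 𝓘(ℝ, Eu n) q₀ q₀ ∧
    ∀ᶠ x in 𝓝 (extChartAt 𝓘(ℝ, Eu r) (C.prj q₀) (C.prj q₀)), C.prjC q₀ (σ x) = x := by
  set y₀ := extChartAt 𝓘(ℝ, Eu n) q₀ q₀ with hy₀
  have hy := C.mem_chartDomain q₀
  have hx : C.prjC q₀ y₀ = extChartAt 𝓘(ℝ, Eu r) (C.prj q₀) (C.prj q₀) := by
    rw [prjC, hy₀, extChartAt_to_inv]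
  rw [← hx]
  -- On the affine slice in the horizontal direction, `π ∘ ℓ` has derivative the identity at `0`.
  -- The inverse function theorem inverts it there, and `ℓ` composed with this inverse is the
  -- section.
  set ℓ : Eu r → Eu n := fun x => y₀ + C.horC q₀ y₀ x with hℓ
  have hℓ0 : ℓ 0 = y₀ := by simp [hℓ]
  have hℓd : HasFDerivAt ℓ (C.horC q₀ y₀) 0 := (C.horC q₀ y₀).hasFDerivAt.const_add y₀
  have hℓc : ContDiff ℝ ∞ ℓ := contDiff_const.add (C.horC q₀ y₀).contDiff
  have hp : ContDiffAt ℝ ∞ (C.prjC q₀) (ℓ 0) := by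
    rw [hℓ0]
    exact contDiffAt_prjC hy
  have hf : ContDiffAt ℝ ∞ (C.prjC q₀ ∘ ℓ) 0 := hp.comp 0 hℓc.contDiffAt
  have hf' : HasFDerivAt (C.prjC q₀ ∘ ℓ)
      ((ContinuousLinearEquiv.refl ℝ (Eu r) : Eu r ≃L[ℝ] Eu r) : Eu r →L[ℝ] Eu r) 0 := by
    have h := (hp.differentiableAt (by simp)).hasFDerivAt.comp 0 hℓd
    refine h.congr_fderiv (ContinuousLinearMap.ext fun u => ?_)
    rw [ContinuousLinearMap.comp_apply, hℓ0, fderiv_prjC_horC hy]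
    rfl
  have hf0 : (C.prjC q₀ ∘ ℓ) 0 = C.prjC q₀ y₀ := by rw [Function.comp_apply, hℓ0]
  refine ⟨fun x => ℓ (hf.localInverse hf' (by simp) x), ?_, ?_, ?_⟩
  · refine hℓc.contDiffAt.comp _ ?_
    rw [← hf0]
    exact hf.to_localInverse hf' (by simp)
  · rw [← hf0]
    exact (congrArg ℓ (hf.localInverse_apply_image hf' (by simp))).trans hℓ0
  · rw [← hf0]
    exact (hf.hasStrictFDerivAt' hf' (by simp)).eventually_right_inverse

/-- The gyroscopic tensor and the reduced Hamiltonian near `s₀` are, in the chart at `s₀`, given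
by the bilinear maps `B x` and by the function `½ p(K x p) + V x`. -/
structure IsCoordinateModel (C : System n r k Q S G) (s₀ : S)
    (B : Eu r → Eu r →L[ℝ] Eu r →L[ℝ] Eu r) (K : Eu r → (Eu r →L[ℝ] ℝ) →L[ℝ] Eu r)
    (V : Eu r → ℝ) : Prop where
  contDiffAt_gyro : ContDiffAt ℝ ∞ B (extChartAt 𝓘(ℝ, Eu r) s₀ s₀)
  contDiffAt_cometric : ContDiffAt ℝ ∞ K (extChartAt 𝓘(ℝ, Eu r) s₀ s₀)
  contDiffAt_potential : ContDiffAt ℝ ∞ V (extChartAt 𝓘(ℝ, Eu r) s₀ s₀)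
  gyro_skew : ∀ᶠ x in 𝓝 (extChartAt 𝓘(ℝ, Eu r) s₀ s₀), ∀ u v, B x u v = -B x v u
  cometric_symm : ∀ᶠ x in 𝓝 (extChartAt 𝓘(ℝ, Eu r) s₀ s₀),
    ∀ p p' : Eu r →L[ℝ] ℝ, p (K x p') = p' (K x p)
  cometric_surjective : ∀ᶠ x in 𝓝 (extChartAt 𝓘(ℝ, Eu r) s₀ s₀), Function.Surjective (K x)
  gyro_eq : ∀ᶠ x in 𝓝 (extChartAt 𝓘(ℝ, Eu r) s₀ s₀),
    ∀ u v, toChart s₀ ((extChartAt 𝓘(ℝ, Eu r) s₀).symm x)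
      (C.gyroAt ((extChartAt 𝓘(ℝ, Eu r) s₀).symm x) ![u, v]) =
        B x (toChart s₀ _ u) (toChart s₀ _ v)
  ham_eq : ∀ᶠ x in 𝓝 (extChartAt 𝓘(ℝ, Eu r) s₀ s₀), ∀ p : Eu r →L[ℝ] ℝ,
    C.redHam ⟨(extChartAt 𝓘(ℝ, Eu r) s₀).symm x,
      p ∘L toChart s₀ ((extChartAt 𝓘(ℝ, Eu r) s₀).symm x)⟩ = 2⁻¹ * p (K x p) + V x

theorem exists_isCoordinateModel (C : System n r k Q S G) (s₀ : S) :
    ∃ B K V, C.IsCoordinateModel s₀ B K V := by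
  obtain ⟨q₀, rfl⟩ := C.surjective_prj s₀
  obtain ⟨σ, hσ, hσ0, hσr⟩ := C.exists_section q₀
  have hB := C.contDiffAt_gyroC q₀
  have hK := C.contDiffAt_redCometricC q₀
  have hV : ContDiffAt ℝ ∞ (fun y => C.U ((extChartAt 𝓘(ℝ, Eu n) q₀).symm y))
      (extChartAt 𝓘(ℝ, Eu n) q₀ q₀) :=
    contDiffAt_comp_extChartAt_symm (mem_extChartAt_target q₀) C.smooth_U.contMDiffAt
  have hdom := C.eventually_mem_chartDomain q₀
  have hdiff : ∀ᶠ y in 𝓝 (extChartAt 𝓘(ℝ, Eu n) q₀ q₀), DifferentiableAt ℝ (C.horC q₀) y := by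
    filter_upwards [((C.contDiffAt_horC q₀).of_le (m := 1) (by simp)).eventually (by simp)] with y hy
    exact hy.differentiableAt (by simp)
  rw [← hσ0] at hB hK hV hdom hdiff
  -- Along the section, `σ x` represents a point of `Q` over the point of `S` with coordinates `x`,
  -- so each fact about `y` becomes a fact about `x`.
  have hev : ∀ᶠ x in 𝓝 (extChartAt 𝓘(ℝ, Eu r) (C.prj q₀) (C.prj q₀)),
      σ x ∈ C.chartDomain q₀ ∧ DifferentiableAt ℝ (C.horC q₀) (σ x) ∧
      (extChartAt 𝓘(ℝ, Eu r) (C.prj q₀)).symm x =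
        C.prj ((extChartAt 𝓘(ℝ, Eu n) q₀).symm (σ x)) := by
    filter_upwards [hσr, hσ.continuousAt.eventually hdom, hσ.continuousAt.eventually hdiff]
      with x hx hy hh
    refine ⟨hy, hh, ?_⟩
    have hs : C.prj ((extChartAt 𝓘(ℝ, Eu n) q₀).symm (σ x)) ∈
        (extChartAt 𝓘(ℝ, Eu r) (C.prj q₀)).source := by
      rw [extChartAt_source]
      exact hy.2
    conv_lhs => rw [← hx]
    exact (extChartAt 𝓘(ℝ, Eu r) (C.prj q₀)).left_inv hs
  refine ⟨fun x => C.gyroC q₀ (σ x), fun x => C.redCometricC q₀ (σ x),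
    fun x => C.U ((extChartAt 𝓘(ℝ, Eu n) q₀).symm (σ x)), hB.comp _ hσ, hK.comp _ hσ,
    hV.comp _ hσ, Filter.Eventually.of_forall fun x => gyroC_swap q₀ _,
    hev.mono fun x hx => redCometricC_comm hx.1,
    hev.mono fun x hx u => ⟨_, redCometricC_redMetricC hx.1 u⟩, hev.mono ?_, hev.mono ?_⟩
  · rintro x ⟨hy, hh, hpt⟩
    rw [hpt]
    exact toChart_gyroAt hy hh
  · rintro x ⟨hy, hh, hpt⟩ p
    rw [hpt]
    set q := (extChartAt 𝓘(ℝ, Eu n) q₀).symm (σ x) with hq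
    have hred : C.red ⟨q, (p ∘L toChart (C.prj q₀) (C.prj q)) ∘L C.dprj q⟩ =
        ⟨C.prj q, p ∘L toChart (C.prj q₀) (C.prj q)⟩ := by
      change (⟨C.prj q, ((p ∘L toChart (C.prj q₀) (C.prj q)) ∘L C.dprj q) ∘L C.hor q⟩ :
        Cot r S) = _
      congr 1
      ext u
      simp only [ContinuousLinearMap.comp_apply, C.dprj_hor]
    rw [← hred, C.redHam_red]
    refine constrainedHam_chart hy _ p fun u => ?_
    exact congrArg (fun w => p (toChart (C.prj q₀) (C.prj q) w)) (C.dprj_hor q u)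

end System

/-! ### Evaluating forms and derivatives at the centre of a chart. -/

section ChartExpressions

variable {E : Type*} [NormedAddCommGroup E] [NormedSpace ℝ E]
  {H : Type*} [TopologicalSpace H] {I : ModelWithCorners ℝ E H}
  {M : Type*} [TopologicalSpace M] [ChartedSpace H M]

theorem DForm.inChart_self [IsManifold I ∞ M] {k : ℕ} (η : DForm I M k) (x : M) :
    η.inChart x (extChartAt I x x) = η x := by
  have : IsManifold I 1 M := .of_le (n := ∞) (by simp)
  have h := η.compContinuousLinearMap_congr (extChartAt_to_inv (I := I) x)
    (mfderivWithin 𝓘(ℝ, E) I (extChartAt I x).symm (Set.range I) (extChartAt I x x))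
    (ContinuousLinearMap.id ℝ E) mfderivWithin_range_extChartAt_symm
  refine h.trans ?_
  ext v
  rfl

/-- A map between manifolds with a differentiable expression in charts is differentiable. -/
theorem hasMFDerivAt_of_chart {E' : Type*} [NormedAddCommGroup E'] [NormedSpace ℝ E']
    {H' : Type*} [TopologicalSpace H'] {I' : ModelWithCorners ℝ E' H'}
    {N : Type*} [TopologicalSpace N] [ChartedSpace H' N]
    {f : M → N} {F : E → E'} {x : M}
    (hs : ∀ᶠ x' in 𝓝 x, f x' ∈ (extChartAt I' (f x)).source)
    (hF : DifferentiableAt ℝ F (extChartAt I x x))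
    (h : ∀ᶠ z in 𝓝 (extChartAt I x x),
      extChartAt I' (f x) (f ((extChartAt I x).symm z)) = F z) :
    HasMFDerivAt I I' f x (fderiv ℝ F (extChartAt I x x)) := by
  refine ⟨?_, ?_⟩
  -- `HasMFDerivAt` includes continuity of `f`. It follows from continuity of `F` because `hs`
  -- allows the target chart to be inverted near `x`.
  · have h0 : F (extChartAt I x x) = extChartAt I' (f x) (f x) := by
      rw [← h.self_of_nhds, extChartAt_to_inv]
    have h1 : ContinuousAt (fun x' => (extChartAt I' (f x)).symm (F (extChartAt I x x'))) x := by
      refine ContinuousAt.comp (g := (extChartAt I' (f x)).symm)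
        (f := fun x' => F (extChartAt I x x')) ?_
        (hF.continuousAt.comp (f := extChartAt I x) (continuousAt_extChartAt x))
      rw [h0]
      exact continuousAt_extChartAt_symm (f x)
    refine h1.congr ?_
    filter_upwards [hs, (continuousAt_extChartAt (I := I) x).eventually h,
      extChartAt_source_mem_nhds (I := I) x] with x' h2 h3 h4
    rw [← h3, (extChartAt I x).left_inv h4, (extChartAt I' (f x)).left_inv h2]
  · exact (hF.hasFDerivAt.congr_of_eventuallyEq h).hasFDerivWithinAt

end ChartExpressions

/-- This is nondegeneracy of `dx ∧ dp`; the witness is Hamilton's vector `(∂L/∂p, -∂L/∂x)`. -/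
theorem exists_modelCan_eq {m : ℕ} (L : (Eu m × (Eu m →L[ℝ] ℝ)) →L[ℝ] ℝ) :
    ∃ X, ∀ V, modelCan m ![X, V] = L V := by
  refine ⟨(WithLp.toLp 2 fun i => L (0, EuclideanSpace.proj i),
    -(L ∘L ContinuousLinearMap.inl ℝ _ _)), fun V => ?_⟩
  have h1 : V = (V.1, 0) + ∑ i, V.2 (EuclideanSpace.single i 1) •
      ((0, EuclideanSpace.proj i) : Eu m × (Eu m →L[ℝ] ℝ)) := by
    refine Prod.ext (by simp [Prod.fst_sum]) (ContinuousLinearMap.ext fun v => ?_)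
    rw [covector_eq_sum V.2 v]
    simp [Prod.snd_sum, mul_comm]
  conv_rhs => rw [h1, map_add, map_sum]
  rw [modelCan_apply]
  simp only [Matrix.cons_val_zero, Matrix.cons_val_one, map_smul]
  rw [covector_eq_sum V.2]
  simp [mul_comm, add_comm]

/-- Pointwise linear algebra of the reduction: `P` is `Tπ`, `h` the horizontal lift, `D` its
derivative, `κ` is `Tπ ∘ 𝒫`, `a ∘ κ` the lifted covector, `ξ` the canonical Hamiltonian vector
upstairs and `W` its image. Differentiating `p ↦ p ∘ hor` along the base produces the `D` terms, and
their antisymmetrisation is the gyroscopic term. -/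
theorem form_eq_of_reduction {n r : ℕ} {P κ : Eu n →L[ℝ] Eu r} {h : Eu r →L[ℝ] Eu n}
    {D : Eu n →L[ℝ] Eu r →L[ℝ] Eu n} {a : Eu r →L[ℝ] ℝ}
    {dH : (Eu r × (Eu r →L[ℝ] ℝ)) →L[ℝ] ℝ} {ξ : Eu n × (Eu n →L[ℝ] ℝ)}
    {W : Eu r × (Eu r →L[ℝ] ℝ)}
    (hP : ∀ u, P (h u) = u)
    (hξ : ∀ v c, c ξ.1 - ξ.2 v = dH (P v, c ∘L h + (a ∘L κ) ∘L D v))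
    (hW : W = (P ξ.1, ξ.2 ∘L h + (a ∘L κ) ∘L D ξ.1)) (V : Eu r × (Eu r →L[ℝ] ℝ)) :
    V.2 W.1 - W.2 V.1 + a (κ (D (h W.1) V.1 - D (h V.1) W.1)) = dH V := by
  have hw : ∀ p : Eu r →L[ℝ] ℝ, dH (0, p) = p W.1 := by
    intro p
    have h1 := hξ 0 (p ∘L P)
    have h2 : (p ∘L P) ∘L h = p := by
      ext1 u
      simp [hP]
    rw [map_zero, map_zero, map_zero, sub_zero, ContinuousLinearMap.comp_zero, add_zero, h2] at h1
    rw [← h1, hW]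
    rfl
  have hsplit : ∀ (u : Eu r) (p : Eu r →L[ℝ] ℝ), dH (u, p) = dH (u, 0) + p W.1 := by
    intro u p
    rw [← hw, ← map_add]
    simp
  -- Varying only the covector `c` shows that the velocity upstairs is horizontal, so it satisfies
  -- the constraint.
  have hξ1 : ξ.1 = h W.1 := by
    refine (SeparatingDual.eq_iff_forall_dual_eq (R := ℝ)).2 fun c => ?_
    have h1 := hξ 0 c
    rw [map_zero, map_zero, map_zero, sub_zero, ContinuousLinearMap.comp_zero, add_zero, hw] at h1
    exact h1
  have h2 := hξ (h V.1) 0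
  rw [hP, hsplit] at h2
  have h3 : W.2 V.1 = ξ.2 (h V.1) + a (κ (D ξ.1 V.1)) := by
    rw [hW]
    rfl
  have h4 : dH V = dH (V.1, 0) + V.2 W.1 := hsplit V.1 V.2
  simp only [ContinuousLinearMap.zero_comp, zero_add, ContinuousLinearMap.comp_apply,
    zero_apply, zero_sub] at h2
  rw [h3, h4, ← hξ1, map_sub, map_sub]
  linarith

namespace System

variable {n r k : ℕ} {Q S G : Type*}
  [TopologicalSpace Q] [ChartedSpace (Eu n) Q] [IsManifold 𝓘(ℝ, Eu n) ∞ Q]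
  [TopologicalSpace S] [ChartedSpace (Eu r) S] [IsManifold 𝓘(ℝ, Eu r) ∞ S]
  [TopologicalSpace G] [ChartedSpace (Eu k) G] [Group G] [LieGroup 𝓘(ℝ, Eu k) ∞ G]
  [MulAction G Q] [ContMDiffSMul 𝓘(ℝ, Eu k) 𝓘(ℝ, Eu n) ∞ G Q] [ProperSMul G Q]
  {C : System n r k Q S G} {q₀ : Q} {y : Eu n}

/-! ### The almost symplectic form and the reduced Hamiltonian in charts -/

theorem inChart_nhForm (C : System n r k Q S G) (α₀ : Cot r S) {z : Eu r × (Eu r →L[ℝ] ℝ)}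
    (hz : z.1 ∈ (extChartAt 𝓘(ℝ, Eu r) α₀.proj).target) {B : Eu r →L[ℝ] Eu r →L[ℝ] Eu r}
    (hB : ∀ u v, toChart α₀.proj ((extChartAt 𝓘(ℝ, Eu r) α₀.proj).symm z.1)
      (C.gyroAt ((extChartAt 𝓘(ℝ, Eu r) α₀.proj).symm z.1) ![u, v]) =
        B (toChart α₀.proj _ u) (toChart α₀.proj _ v))
    (v : Fin 2 → Eu r × (Eu r →L[ℝ] ℝ)) :
    C.nhForm.inChart α₀ z v = modelCan r v + z.2 (B (v 0).1 (v 1).1) := by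
  rw [← extChartAt_cot_symm_proj α₀ hz] at hB
  have h1 : (C.nhForm).inChart α₀ z v =
      (canForm r S).inChart α₀ z v + C.gyroForm.inChart α₀ z v := by
    simp only [DForm.inChart_eq]
    rfl
  rw [h1, inChart_canForm α₀ hz, DForm.inChart_eq]
  congr 1
  set α := (extChartAt (cotModel r) α₀).symm z with hα
  set T : Eu r × (Eu r →L[ℝ] ℝ) → Tan r α.proj := fun w => tauDeriv α
    (mfderiv 𝓘(ℝ, Eu r × (Eu r →L[ℝ] ℝ)) (cotModel r) (extChartAt (cotModel r) α₀).symm z w)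
    with hT
  have h2 : (fun i => T (v i)) = ![T (v 0), T (v 1)] := by
    funext i
    fin_cases i <;> rfl
  change α.2 (C.gyroAt α.proj fun i => T (v i)) = _
  rw [h2]
  refine (extChartAt_cot_symm_snd_apply α₀ hz _).trans ?_
  rw [hB]
  exact congrArg₂ (fun a b => z.2 (B a b)) (toChart_tauDeriv α₀ hz (v 0))
    (toChart_tauDeriv α₀ hz (v 1))

section CoordinateModel

variable {B : Eu r → Eu r →L[ℝ] Eu r →L[ℝ] Eu r} {K : Eu r → (Eu r →L[ℝ] ℝ) →L[ℝ] Eu r}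
  {V : Eu r → ℝ}

omit [IsManifold 𝓘(ℝ, Eu r) ∞ S] in
theorem eventually_mem_target (s₀ : S) : ∀ᶠ x in 𝓝 (extChartAt 𝓘(ℝ, Eu r) s₀ s₀),
    x ∈ (extChartAt 𝓘(ℝ, Eu r) s₀).target :=
  (isOpen_extChartAt_target _).mem_nhds (mem_extChartAt_target _)

theorem eventually_cot (α : Cot r S) {P : Eu r → Prop}
    (h : ∀ᶠ x in 𝓝 (extChartAt 𝓘(ℝ, Eu r) α.proj α.proj), P x) :
    ∀ᶠ z in 𝓝 (extChartAt (cotModel r) α α), P z.1 := by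
  refine continuousAt_fst.eventually ?_
  rw [extChartAt_cot_apply]
  exact h

theorem IsCoordinateModel.inChart_nhForm {α : Cot r S} (h : C.IsCoordinateModel α.proj B K V) :
    ∀ᶠ z in 𝓝 (extChartAt (cotModel r) α α), ∀ v,
      C.nhForm.inChart α z v = modelCan r v + z.2 (B z.1 (v 0).1 (v 1).1) := by
  filter_upwards [eventually_cot α h.gyro_eq, eventually_cot α (eventually_mem_target α.proj)]
    with z hz hzt
  exact C.inChart_nhForm α hzt hz

theorem IsCoordinateModel.redHam_symm {α : Cot r S} (h : C.IsCoordinateModel α.proj B K V) :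
    ∀ᶠ z in 𝓝 (extChartAt (cotModel r) α α),
      C.redHam ((extChartAt (cotModel r) α).symm z) = 2⁻¹ * z.2 (K z.1 z.2) + V z.1 := by
  filter_upwards [eventually_cot α h.ham_eq, eventually_cot α (eventually_mem_target α.proj)]
    with z hz hzt
  rw [extChartAt_cot_symm_apply α hzt]
  exact hz z.2

theorem mdifferentiableAt_redHam (C : System n r k Q S G) (α : Cot r S) :
    MDifferentiableAt (cotModel r) 𝓘(ℝ, ℝ) C.redHam α := by
  obtain ⟨B, K, V, h⟩ := C.exists_isCoordinateModel α.proj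
  have hK := h.contDiffAt_cometric.differentiableAt (by simp)
  have hV := h.contDiffAt_potential.differentiableAt (by simp)
  have h0 : (extChartAt (cotModel r) α α).1 = extChartAt 𝓘(ℝ, Eu r) α.proj α.proj := by
    rw [extChartAt_cot_apply]
  rw [← h0] at hK hV
  refine (hasMFDerivAt_of_chart
    (F := fun z => 2⁻¹ * z.2 (K z.1 z.2) + V z.1) ?_ ?_ ?_).mdifferentiableAt
  · refine Filter.Eventually.of_forall fun _ => ?_
    rw [extChartAt_model_space_eq_id]
    trivial
  · exact ((differentiableAt_snd.clm_apply (differentiableAt_velocity hK)).const_mul _).fun_add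
      (differentiableAt_comp_fst hV)
  · filter_upwards [h.redHam_symm] with z hz
    rw [extChartAt_model_space_eq_id]
    exact hz

end CoordinateModel

/-! ### The tangent map of the reduction -/

/-- The reduction map `T*Q → T*S` in the charts at `β` and at its image. -/
def redC (C : System n r k Q S G) (q₀ : Q) (z : Eu n × (Eu n →L[ℝ] ℝ)) :
    Eu r × (Eu r →L[ℝ] ℝ) := (C.prjC q₀ z.1, z.2 ∘L C.horC q₀ z.1)

theorem hasFDerivAt_redC (C : System n r k Q S G) {q : Q} {z : Eu n × (Eu n →L[ℝ] ℝ)}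
    (hz : z.1 = extChartAt 𝓘(ℝ, Eu n) q q) : DifferentiableAt ℝ (C.redC q) z ∧
    ∀ w, fderiv ℝ (C.redC q) z w = (fderiv ℝ (C.prjC q) z.1 w.1,
      w.2 ∘L C.horC q z.1 + z.2 ∘L fderiv ℝ (C.horC q) z.1 w.1) := by
  have h1 : DifferentiableAt ℝ (C.prjC q) z.1 := by
    rw [hz]
    exact (contDiffAt_prjC (C.mem_chartDomain q)).differentiableAt (by simp)
  have h2 : DifferentiableAt ℝ (C.horC q) z.1 := by
    rw [hz]
    exact (C.contDiffAt_horC q).differentiableAt (by simp)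
  have h3 := (h1.hasFDerivAt.comp z hasFDerivAt_fst).prodMk
    ((hasFDerivAt_snd (𝕜 := ℝ) (p := z)).clm_comp (h2.hasFDerivAt.comp z hasFDerivAt_fst))
  have h4 : HasFDerivAt (C.redC q) _ z := h3
  refine ⟨h4.differentiableAt, fun w => ?_⟩
  rw [h4.fderiv]
  refine Prod.ext rfl ?_
  exact add_comm _ _

theorem hasMFDerivAt_red (C : System n r k Q S G) (β : Cot n Q) :
    HasMFDerivAt (cotModel n) (cotModel r) C.red β
      (fderiv ℝ (C.redC β.proj) (extChartAt (cotModel n) β β)) := by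
  have h0 : (extChartAt (cotModel n) β β).1 = extChartAt 𝓘(ℝ, Eu n) β.proj β.proj := by
    rw [extChartAt_cot_apply]
  refine hasMFDerivAt_of_chart ?_ (C.hasFDerivAt_redC h0).1 ?_
  · have hc : Continuous fun β' : Cot n Q => C.prj β'.proj :=
      C.smooth_prj.continuous.comp (FiberBundle.continuous_proj _ _)
    filter_upwards [hc.continuousAt.eventually
      ((chartAt (Eu r) (C.prj β.proj)).open_source.mem_nhds (mem_chart_source _ _))] with β' hβ'
    rw [extChartAt_cot_source]
    exact hβ'
  · have hd := C.eventually_mem_chartDomain β.proj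
    rw [← h0] at hd
    filter_upwards [continuousAt_fst.eventually hd] with z hz
    rw [extChartAt_cot_symm_apply β hz.1, extChartAt_cot_apply]
    rfl

theorem dprjProjC_self (C : System n r k Q S G) (q : Q) (v : Tan n q) :
    C.dprjProjC q (extChartAt 𝓘(ℝ, Eu n) q q) v = C.dprj q (C.proj q v) := by
  have key : ∀ q' : Q, q' = q → toChart (C.prj q) (C.prj q')
      (C.dprj q' (C.proj q' (ofChart q q' v))) = C.dprj q (C.proj q v) := by
    rintro _ rfl
    rw [toChart_self]
    exact congrArg (fun w => C.dprj _ (C.proj _ w)) (ofChart_self _ _)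
  exact key _ (extChartAt_to_inv q)

theorem nhForm_apply (C : System n r k Q S G) (q : Q) (a : Tan r (C.prj q) →L[ℝ] ℝ)
    (X V : Eu r × (Eu r →L[ℝ] ℝ)) :
    C.nhForm ⟨C.prj q, a⟩ ![X, V] = V.2 X.1 - X.2 V.1 +
      a (C.gyroC q (extChartAt 𝓘(ℝ, Eu n) q q) X.1 V.1) := by
  set α : Cot r S := ⟨C.prj q, a⟩ with hα
  have h1 : (extChartAt (cotModel r) α α) = (extChartAt 𝓘(ℝ, Eu r) (C.prj q) (C.prj q), a) := by
    rw [extChartAt_cot_apply]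
    refine Prod.ext rfl (ContinuousLinearMap.ext fun v => ?_)
    exact congrArg a (ofChart_self (C.prj q) v)
  have hB := toChart_gyroAt (C.mem_chartDomain q)
    ((C.contDiffAt_horC q).differentiableAt (by simp))
  rw [extChartAt_to_inv] at hB
  have hB' : ∀ u v, toChart (C.prj q) ((extChartAt 𝓘(ℝ, Eu r) (C.prj q)).symm
      (extChartAt 𝓘(ℝ, Eu r) (C.prj q) (C.prj q))) (C.gyroAt _ ![u, v]) =
        C.gyroC q (extChartAt 𝓘(ℝ, Eu n) q q) (toChart (C.prj q) _ u) (toChart (C.prj q) _ v) := by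
    rw [extChartAt_to_inv]
    exact hB
  have h2 := C.inChart_nhForm α (z := (extChartAt 𝓘(ℝ, Eu r) (C.prj q) (C.prj q), a))
    (mem_extChartAt_target _) hB' ![X, V]
  have h3 := DForm.inChart_self C.nhForm α
  rw [h1] at h3
  refine (congrArg (fun η : (Eu r × (Eu r →L[ℝ] ℝ)) [⋀^Fin 2]→L[ℝ] ℝ => η ![X, V])
    h3).symm.trans (h2.trans ?_)
  rw [modelCan_apply]
  rfl

end System

/-- Nondegeneracy supplies a vector satisfying the condition in `hamVec`, so the choice there has
the intended property. -/
theorem canForm_hamVec {m : ℕ} {M : Type*} [TopologicalSpace M] [ChartedSpace (Eu m) M]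
    [IsManifold 𝓘(ℝ, Eu m) ∞ M] (F : Cot m M → ℝ) (β : Cot m M)
    (V : TangentSpace (cotModel m) β) :
    canForm m M β ![hamVec (canForm m M) F β, V] = mfderiv (cotModel m) 𝓘(ℝ, ℝ) F β V := by
  have h : ∃ X : TangentSpace (cotModel m) β, ∀ V : TangentSpace (cotModel m) β,
      canForm m M β ![X, V] = mfderiv (cotModel m) 𝓘(ℝ, ℝ) F β V := by
    rw [canForm_eq]
    exact exists_modelCan_eq (mfderiv (cotModel m) 𝓘(ℝ, ℝ) F β)
  exact Classical.epsilon_spec h V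

/-- Tangent vectors are determined by their action on smooth functions. -/
theorem eq_of_forall_mfderiv_eq {E : Type*} [NormedAddCommGroup E] [NormedSpace ℝ E]
    {H : Type*} [TopologicalSpace H] {I : ModelWithCorners ℝ E H}
    {M : Type*} [TopologicalSpace M] [ChartedSpace H M] [IsManifold I ∞ M] {x : M}
    {X X' : TangentSpace I x}
    (h : ∀ f : M → ℝ, ContMDiffAt I 𝓘(ℝ, ℝ) ∞ f x →
      mfderiv I 𝓘(ℝ, ℝ) f x X = mfderiv I 𝓘(ℝ, ℝ) f x X') : X = X' := by
  have : IsManifold I 1 M := .of_le (n := ∞) (by simp)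
  refine (SeparatingDual.eq_iff_forall_dual_eq (R := ℝ) (V := E)).2 fun ℓ => ?_
  -- Linear functionals of the chart coordinates separate tangent vectors, and they need to be
  -- smooth only at `x`.
  have hc : ContMDiffAt I 𝓘(ℝ, ℝ) ∞ (ℓ ∘ extChartAt I x) x :=
    ℓ.contDiff.contMDiff.contMDiffAt.comp x contMDiffAt_extChartAt
  have hd : ∀ X : TangentSpace I x, mfderiv I 𝓘(ℝ, ℝ) (ℓ ∘ extChartAt I x) x X = ℓ X := by
    intro X
    rw [mfderiv_comp x (ℓ.differentiableAt.mdifferentiableAt)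
      (mdifferentiableAt_extChartAt (mem_chart_source H x)), mfderiv_extChartAt_self,
      mfderiv_eq_fderiv, ContinuousLinearMap.fderiv]
    rfl
  exact (hd X).symm.trans ((h _ hc).trans (hd X'))

namespace System

variable {n r k : ℕ} {Q S G : Type*}
  [TopologicalSpace Q] [ChartedSpace (Eu n) Q] [IsManifold 𝓘(ℝ, Eu n) ∞ Q]
  [TopologicalSpace S] [ChartedSpace (Eu r) S] [IsManifold 𝓘(ℝ, Eu r) ∞ S]
  [TopologicalSpace G] [ChartedSpace (Eu k) G] [Group G] [LieGroup 𝓘(ℝ, Eu k) ∞ G]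
  [MulAction G Q] [ContMDiffSMul 𝓘(ℝ, Eu k) 𝓘(ℝ, Eu n) ∞ G Q] [ProperSMul G Q]
  {C : System n r k Q S G} {q₀ : Q} {y : Eu n}

/-! ### The reduced vector field -/

/-- `Ω_nh` is nondegenerate for any gyroscopic tensor: fibre vectors determine the base part of `X`
through the canonical form alone, and base vectors then determine its fibre part. -/
theorem eq_of_nhForm_eq (C : System n r k Q S G) {α : Cot r S}
    {X X' : TangentSpace (cotModel r) α} (h : ∀ V, C.nhForm α ![X, V] = C.nhForm α ![X', V]) :
    X = X' := by
  obtain ⟨s, a⟩ := α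
  obtain ⟨q, rfl⟩ := C.surjective_prj s
  have h' : ∀ V : Eu r × (Eu r →L[ℝ] ℝ), _ := fun V =>
    (C.nhForm_apply q a X V).symm.trans ((h V).trans (C.nhForm_apply q a X' V))
  have h1 : (show Eu r × (Eu r →L[ℝ] ℝ) from X).1 = (show Eu r × (Eu r →L[ℝ] ℝ) from X').1 := by
    refine (SeparatingDual.eq_iff_forall_dual_eq (R := ℝ)).2 fun p => ?_
    have h2 := h' (0, p)
    simp only [map_zero, sub_zero] at h2
    exact add_right_cancel h2
  refine Prod.ext h1 (ContinuousLinearMap.ext fun u => ?_)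
  have h2 := h' (u, 0)
  change (0 : ℝ) - (show Eu r × (Eu r →L[ℝ] ℝ) from X).2 u +
    a (C.gyroC q _ (show Eu r × (Eu r →L[ℝ] ℝ) from X).1 u) =
    0 - (show Eu r × (Eu r →L[ℝ] ℝ) from X').2 u +
    a (C.gyroC q _ (show Eu r × (Eu r →L[ℝ] ℝ) from X').1 u) at h2
  rw [h1] at h2
  linarith

/-- The image in `T(T*S)` of the Hamiltonian vector field of the constrained Hamiltonian. -/
def redVec (C : System n r k Q S G) (q : Q) (a : Tan r (C.prj q) →L[ℝ] ℝ) :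
    TangentSpace (cotModel r) (C.red (C.lift q a)) :=
  mfderiv (cotModel n) (cotModel r) C.red (C.lift q a)
    (hamVec (canForm n Q) C.constrainedHam (C.lift q a))

theorem bracket_eq_mfderiv (C : System n r k Q S G) (q : Q) (a : Tan r (C.prj q) →L[ℝ] ℝ)
    {f : Cot r S → ℝ} (hf : MDifferentiableAt (cotModel r) 𝓘(ℝ, ℝ) f (C.red (C.lift q a))) :
    bracket (canForm n Q) (f ∘ C.red) C.constrainedHam (C.lift q a) =
      mfderiv (cotModel r) 𝓘(ℝ, ℝ) f (C.red (C.lift q a)) (C.redVec q a) := by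
  rw [bracket, mfderiv_comp _ hf (C.hasMFDerivAt_red _).mdifferentiableAt]
  rfl

/-- This links the bracket definition of the dynamics to `Ω_nh`. The constrained Hamiltonian is
`redHam ∘ red`, so its differential factors through the tangent map of `red`, and
`form_eq_of_reduction` applies. -/
theorem nhForm_redVec (C : System n r k Q S G) (q : Q) (a : Tan r (C.prj q) →L[ℝ] ℝ)
    (V : Eu r × (Eu r →L[ℝ] ℝ)) :
    C.nhForm ⟨C.prj q, a⟩ ![C.redVec q a, V] =
      mfderiv (cotModel r) 𝓘(ℝ, ℝ) C.redHam (C.red (C.lift q a)) V := by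
  set β := C.lift q a with hβ
  have hz1 : (extChartAt (cotModel n) β β).1 = extChartAt 𝓘(ℝ, Eu n) q q := by
    rw [extChartAt_cot_apply]
    rfl
  have hz2 : (extChartAt (cotModel n) β β).2 =
      a ∘L C.dprjProjC q (extChartAt 𝓘(ℝ, Eu n) q q) := by
    rw [extChartAt_cot_apply]
    refine ContinuousLinearMap.ext fun v => ?_
    refine (congrArg β.2 (ofChart_self q v)).trans ?_
    exact congrArg a (C.dprjProjC_self q v).symm
  have hred : ∀ w : Eu n × (Eu n →L[ℝ] ℝ),
      (mfderiv (cotModel n) (cotModel r) C.red β w : Eu r × (Eu r →L[ℝ] ℝ)) =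
      (fderiv ℝ (C.prjC q) (extChartAt 𝓘(ℝ, Eu n) q q) w.1,
        w.2 ∘L C.horC q (extChartAt 𝓘(ℝ, Eu n) q q) +
          (a ∘L C.dprjProjC q (extChartAt 𝓘(ℝ, Eu n) q q)) ∘L
            fderiv ℝ (C.horC q) (extChartAt 𝓘(ℝ, Eu n) q q) w.1) := by
    intro w
    have h := (C.hasFDerivAt_redC hz1).2 w
    rw [hz2, hz1] at h
    rw [(C.hasMFDerivAt_red β).mfderiv]
    exact h
  have hham : ∀ w : Eu n × (Eu n →L[ℝ] ℝ),
      mfderiv (cotModel n) 𝓘(ℝ, ℝ) C.constrainedHam β w =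
        mfderiv (cotModel r) 𝓘(ℝ, ℝ) C.redHam (C.red β)
          (mfderiv (cotModel n) (cotModel r) C.red β w) := by
    intro w
    have h1 : C.constrainedHam = C.redHam ∘ C.red := funext fun β => (C.redHam_red β).symm
    have h2 := mfderiv_comp β (C.mdifferentiableAt_redHam (C.red β))
      (C.hasMFDerivAt_red β).mdifferentiableAt
    rw [← h1] at h2
    exact DFunLike.congr_fun h2 w
  refine (C.nhForm_apply q a (C.redVec q a) V).trans ?_
  rw [gyroC_apply]
  refine form_eq_of_reduction (P := fderiv ℝ (C.prjC q) (extChartAt 𝓘(ℝ, Eu n) q q))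
    (h := C.horC q (extChartAt 𝓘(ℝ, Eu n) q q))
    (ξ := hamVec (canForm n Q) C.constrainedHam β)
    (dH := mfderiv (cotModel r) 𝓘(ℝ, ℝ) C.redHam (C.red β))
    (fun u => fderiv_prjC_horC (C.mem_chartDomain q) u) (fun v c => ?_) (hred _) V
  have h3 := canForm_hamVec C.constrainedHam β (show Eu n × (Eu n →L[ℝ] ℝ) from (v, c))
  have h4 : canForm n Q β ![hamVec (canForm n Q) C.constrainedHam β,
      (show Eu n × (Eu n →L[ℝ] ℝ) from (v, c))] =
      modelCan n ![hamVec (canForm n Q) C.constrainedHam β, (v, c)] := by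
    rw [canForm_eq]
    rfl
  have h5 := modelCan_apply (m := n) ![hamVec (canForm n Q) C.constrainedHam β, (v, c)]
  refine (h5.symm.trans (h4.symm.trans (h3.trans (hham _)))).trans ?_
  exact congrArg _ (hred (v, c))

/-- `red (lift q a)` equals `⟨C.prj q, a⟩` only propositionally. The vector and its two properties
are transported here to the second form of the base point. -/
theorem exists_redVec (C : System n r k Q S G) (q : Q) (a : Tan r (C.prj q) →L[ℝ] ℝ) :
    ∃ W : TangentSpace (cotModel r) (⟨C.prj q, a⟩ : Cot r S),
      (∀ V, C.nhForm ⟨C.prj q, a⟩ ![W, V] =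
        mfderiv (cotModel r) 𝓘(ℝ, ℝ) C.redHam ⟨C.prj q, a⟩ V) ∧
      ∀ f : Cot r S → ℝ, ContMDiffAt (cotModel r) 𝓘(ℝ, ℝ) ∞ f ⟨C.prj q, a⟩ →
        bracket (canForm n Q) (f ∘ C.red) C.constrainedHam (C.lift q a) =
          mfderiv (cotModel r) 𝓘(ℝ, ℝ) f ⟨C.prj q, a⟩ W := by
  have key₁ : ∀ (α : Cot r S) (V : Eu r × (Eu r →L[ℝ] ℝ)), C.red (C.lift q a) = α →
      (mfderiv (cotModel r) 𝓘(ℝ, ℝ) C.redHam (C.red (C.lift q a)) V : ℝ) =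
        mfderiv (cotModel r) 𝓘(ℝ, ℝ) C.redHam α V := by
    rintro _ V rfl
    rfl
  have key₂ : ∀ (α : Cot r S) (f : Cot r S → ℝ), C.red (C.lift q a) = α →
      ContMDiffAt (cotModel r) 𝓘(ℝ, ℝ) ∞ f α →
      bracket (canForm n Q) (f ∘ C.red) C.constrainedHam (C.lift q a) =
        mfderiv (cotModel r) 𝓘(ℝ, ℝ) f α (C.redVec q a : Eu r × (Eu r →L[ℝ] ℝ)) := by
    rintro _ f rfl hf
    exact C.bracket_eq_mfderiv q a (hf.mdifferentiableAt (by simp))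
  exact ⟨(C.redVec q a : Eu r × (Eu r →L[ℝ] ℝ)),
    fun V => (C.nhForm_redVec q a V).trans (key₁ _ V (C.red_lift q a)),
    fun f hf => key₂ _ f (C.red_lift q a) hf⟩

theorem nhForm_of_isReducedDynamics (C : System n r k Q S G)
    {X : ∀ α : Cot r S, TangentSpace (cotModel r) α} (hX : C.IsReducedDynamics X)
    (α : Cot r S) (V : TangentSpace (cotModel r) α) :
    C.nhForm α ![X α, V] = mfderiv (cotModel r) 𝓘(ℝ, ℝ) C.redHam α V := by
  obtain ⟨s, a⟩ := α
  obtain ⟨q, rfl⟩ := C.surjective_prj s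
  obtain ⟨W, h1, h2⟩ := C.exists_redVec q a
  have h4 : X ⟨C.prj q, a⟩ = W := eq_of_forall_mfderiv_eq fun f hf =>
    (hX q a f hf).trans (h2 f hf)
  rw [h4]
  exact h1 V

/-- The defining condition ranges over every `q` in a fibre. Choosing `X` by `Ω_nh(X, ·) = dH`,
which does not mention `q`, makes it consistent: by nondegeneracy the vectors obtained from all
these `q` agree. -/
theorem exists_isReducedDynamics (C : System n r k Q S G) : ∃ X, C.IsReducedDynamics X := by
  have hex : ∀ α : Cot r S, ∃ W : TangentSpace (cotModel r) α, ∀ V,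
      C.nhForm α ![W, V] = mfderiv (cotModel r) 𝓘(ℝ, ℝ) C.redHam α V := by
    rintro ⟨s, a⟩
    obtain ⟨q, rfl⟩ := C.surjective_prj s
    obtain ⟨W, h1, -⟩ := C.exists_redVec q a
    exact ⟨W, h1⟩
  choose X hX using hex
  refine ⟨X, fun q a f hf => ?_⟩
  obtain ⟨W, h1, h2⟩ := C.exists_redVec q a
  have h4 : X ⟨C.prj q, a⟩ = W := C.eq_of_nhForm_eq fun V => (hX _ V).trans (h1 V).symm
  rw [h4]
  exact (h2 f hf).symm

theorem nhForm_reducedField (C : System n r k Q S G) (α : Cot r S)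
    (V : TangentSpace (cotModel r) α) :
    C.nhForm α ![C.reducedField α, V] = mfderiv (cotModel r) 𝓘(ℝ, ℝ) C.redHam α V :=
  C.nhForm_of_isReducedDynamics (Classical.epsilon_spec C.exists_isReducedDynamics) α V

end System

/-- Every tangent vector is the value of a smooth vector field. -/
theorem exists_smooth_eq {m : ℕ} {M : Type*} [TopologicalSpace M] [T2Space M]
    [ChartedSpace (Eu m) M] [IsManifold 𝓘(ℝ, Eu m) ∞ M] (x₀ : M) (v : Tan m x₀) :
    ∃ Y : VField m M, Y.Smooth ∧ Y x₀ = v := by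
  obtain ⟨f⟩ : Nonempty (SmoothBumpFunction 𝓘(ℝ, Eu m) x₀) := inferInstance
  refine ⟨fun x => f x • ofChart x₀ x v, ?_, ?_⟩
  · have h : ContMDiffOn 𝓘(ℝ, Eu m) 𝓘(ℝ, Eu m).tangent ∞
        (fun x => (⟨x, ofChart x₀ x v⟩ : TangentBundle 𝓘(ℝ, Eu m) M))
        (chartAt (Eu m) x₀).source :=
      fun x hx => (contMDiffAt_ofChart hx v).contMDiffWithinAt
    exact ContMDiffOn.smul_section_of_tsupport f.contMDiff.contMDiffOn
      (chartAt (Eu m) x₀).open_source f.tsupport_subset_chartAt_source h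
  · change f x₀ • ofChart x₀ x₀ v = v
    rw [f.eq_one, one_smul]
    exact ofChart_self x₀ v

/-- A skew-symmetric bilinear map on the plane is determined by its contraction. -/
theorem eq_of_trace_eq {B : Eu 2 →L[ℝ] Eu 2 →L[ℝ] Eu 2} {ℓ : Eu 2 →L[ℝ] ℝ}
    (hB : ∀ u v, B u v = -B v u)
    (h : ∀ w, ℓ w + ∑ i, B w (EuclideanSpace.single i 1) i = 0) (u v : Eu 2) :
    B u v = ℓ v • u - ℓ u • v := by
  have hself : ∀ w, B w w = 0 := by
    intro w
    ext i
    have h1 : B w w i = -B w w i := congrArg (fun x : Eu 2 => x i) (hB w w)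
    exact self_eq_neg.1 h1
  set e₀ : Eu 2 := EuclideanSpace.single 0 1 with he₀
  set e₁ : Eu 2 := EuclideanSpace.single 1 1 with he₁
  have hdec : ∀ w : Eu 2, w = w 0 • e₀ + w 1 • e₁ := by
    intro w
    ext i
    fin_cases i <;> simp [he₀, he₁]
  -- By skewness `B` is determined by the single vector `B e₀ e₁`. Testing on `e₀` gives its second
  -- coordinate `-ℓ e₀`, and on `e₁` its first coordinate `ℓ e₁`.
  have h0 := h e₀
  have h1 := h e₁
  rw [Fin.sum_univ_two, ← he₀, ← he₁, hself] at h0 h1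
  have h2 : ∀ i, B e₁ e₀ i = -B e₀ e₁ i := fun i => by
    rw [hB e₁ e₀]
    rfl
  rw [h2] at h1
  have hz : ∀ i, (0 : Eu 2) i = 0 := fun _ => rfl
  rw [hz] at h0 h1
  have hℓ : ∀ w : Eu 2, ℓ w = w 0 * ℓ e₀ + w 1 * ℓ e₁ := fun w => by
    conv_lhs => rw [hdec w]
    simp
  have hBuv : B u v = (u 0 * v 1 - u 1 * v 0) • B e₀ e₁ := by
    conv_lhs => rw [hdec u, hdec v]
    simp only [map_add, map_smul, add_apply, smul_apply, hself, smul_zero,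
      zero_add, add_zero, hB e₁ e₀]
    module
  rw [hBuv]
  ext i
  fin_cases i
  · change (u 0 * v 1 - u 1 * v 0) * B e₀ e₁ 0 = ℓ v * u 0 - ℓ u * v 0
    rw [hℓ u, hℓ v]
    linear_combination (-(u 0 * v 1 - u 1 * v 0)) * h1
  · change (u 0 * v 1 - u 1 * v 0) * B e₀ e₁ 1 = ℓ v * u 1 - ℓ u * v 1
    rw [hℓ u, hℓ v]
    linear_combination (u 0 * v 1 - u 1 * v 0) * h0

/-- The trace of `v ↦ ℓ(v) w` is `ℓ w`, and that of `ℓ(w)` times the identity is `r ℓ w`. This is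
the origin of the exponent `r - 1`. -/
theorem sum_simple {r : ℕ} (ℓ : Eu r →L[ℝ] ℝ) (w : Eu r) :
    ∑ i, (ℓ (EuclideanSpace.single i 1) • w - ℓ w • EuclideanSpace.single i (1 : ℝ)) i =
      ℓ w - r * ℓ w := by
  have h : ∀ i : Fin r, (ℓ (EuclideanSpace.single i 1) • w -
      ℓ w • EuclideanSpace.single i (1 : ℝ)) i = w i * ℓ (EuclideanSpace.single i 1) - ℓ w := by
    intro i
    simp [mul_comm]
  rw [Finset.sum_congr rfl fun i _ => h i, Finset.sum_sub_distrib, ← covector_eq_sum]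
  simp

theorem finrank_prod_dual (r : ℕ) : Module.finrank ℝ (Eu r × (Eu r →L[ℝ] ℝ)) = r * 2 := by
  rw [Module.finrank_prod,
    ← (LinearMap.toContinuousLinearMap : (Eu r →ₗ[ℝ] ℝ) ≃ₗ[ℝ] Eu r →L[ℝ] ℝ).finrank_eq,
    show Module.finrank ℝ (Eu r →ₗ[ℝ] ℝ) = Module.finrank ℝ (Eu r) from
      Subspace.dual_finrank_eq (K := ℝ) (V := Eu r), finrank_euclideanSpace_fin, mul_two]

/-- The differential of a function on a manifold, as a linear form on the tangent space. -/
def differential {m : ℕ} {M : Type*} [TopologicalSpace M] [ChartedSpace (Eu m) M]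
    (φ : M → ℝ) (x : M) : Tan m x →L[ℝ] ℝ :=
  mfderiv 𝓘(ℝ, Eu m) 𝓘(ℝ, ℝ) φ x

theorem fderiv_comp_extChartAt_symm {m : ℕ} {M : Type*} [TopologicalSpace M]
    [ChartedSpace (Eu m) M] [IsManifold 𝓘(ℝ, Eu m) ∞ M] {φ : M → ℝ} {x₀ : M} {x : Eu m}
    (hx : x ∈ (extChartAt 𝓘(ℝ, Eu m) x₀).target)
    (hφ : MDifferentiableAt 𝓘(ℝ, Eu m) 𝓘(ℝ, ℝ) φ ((extChartAt 𝓘(ℝ, Eu m) x₀).symm x))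
    (v : Tan m ((extChartAt 𝓘(ℝ, Eu m) x₀).symm x)) :
    fderiv ℝ (fun x => φ ((extChartAt 𝓘(ℝ, Eu m) x₀).symm x)) x (toChart x₀ _ v) =
      differential φ ((extChartAt 𝓘(ℝ, Eu m) x₀).symm x) v := by
  have h := mfderiv_comp x hφ (mdifferentiableAt_extChartAt_symm hx)
  rw [mfderiv_eq_fderiv] at h
  refine (DFunLike.congr_fun h (toChart x₀ _ v)).trans ?_
  refine congrArg (mfderiv 𝓘(ℝ, Eu m) 𝓘(ℝ, ℝ) φ ((extChartAt 𝓘(ℝ, Eu m) x₀).symm x)) ?_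
  refine (mfderiv_extChartAt_symm_apply hx _).trans ?_
  exact ofChart_toChart (extChartAt_symm_mem hx) v

namespace System

variable {n r k : ℕ} {Q S G : Type*}
  [TopologicalSpace Q] [ChartedSpace (Eu n) Q] [IsManifold 𝓘(ℝ, Eu n) ∞ Q]
  [TopologicalSpace S] [ChartedSpace (Eu r) S] [IsManifold 𝓘(ℝ, Eu r) ∞ S]
  [TopologicalSpace G] [ChartedSpace (Eu k) G] [Group G] [LieGroup 𝓘(ℝ, Eu k) ∞ G]
  [MulAction G Q] [ContMDiffSMul 𝓘(ℝ, Eu k) 𝓘(ℝ, Eu n) ∞ G Q] [ProperSMul G Q]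
  {C : System n r k Q S G} {q₀ : Q} {y : Eu n}

/-! ### `φ`-simple systems -/

/-- Tensoriality: the coordinate formulas for vector fields and for tangent vectors both reduce to
`gyroC` on the values at `s`. -/
theorem gyro_eq_gyroAt (C : System n r k Q S G) {Y Z : VField r S} {s : S}
    (hY : MDifferentiableAt 𝓘(ℝ, Eu r) 𝓘(ℝ, Eu r).tangent
      (fun s => (⟨s, Y s⟩ : TangentBundle 𝓘(ℝ, Eu r) S)) s)
    (hZ : MDifferentiableAt 𝓘(ℝ, Eu r) 𝓘(ℝ, Eu r).tangent
      (fun s => (⟨s, Z s⟩ : TangentBundle 𝓘(ℝ, Eu r) S)) s) :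
    C.gyro Y Z s = C.gyroAt s ![Y s, Z s] := by
  obtain ⟨q, rfl⟩ := C.surjective_prj s
  rw [C.gyro_prj q hY hZ]
  have hy := C.mem_chartDomain q
  have hh := (C.contDiffAt_horC q).differentiableAt (by simp)
  have hx : C.prjC q (extChartAt 𝓘(ℝ, Eu n) q q) = extChartAt 𝓘(ℝ, Eu r) (C.prj q) (C.prj q) := by
    rw [prjC, extChartAt_to_inv]
  have hd : ∀ {Y : VField r S}, MDifferentiableAt 𝓘(ℝ, Eu r) 𝓘(ℝ, Eu r).tangent
      (fun s => (⟨s, Y s⟩ : TangentBundle 𝓘(ℝ, Eu r) S)) (C.prj q) →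
      DifferentiableAt ℝ (Y.inChart (C.prj q)) (C.prjC q (extChartAt 𝓘(ℝ, Eu n) q q)) := by
    intro Y hY
    rw [hx, differentiableAt_inChart_iff (mem_extChartAt_target _), extChartAt_to_inv]
    exact hY
  have h1 := toChart_gyroOver hy hh (hd hY) (hd hZ)
  rw [inChart_prjC hy, inChart_prjC hy, ← toChart_gyroAt hy hh, extChartAt_to_inv, toChart_self,
    toChart_self] at h1
  exact h1

/-- Simplicity quantifies over global smooth fields. Any two tangent vectors extend to such fields
by bump functions, which is where `S` must be Hausdorff, so the condition becomes pointwise. -/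
theorem isSimple_iff [T2Space S] (C : System n r k Q S G) (φ : S → ℝ) :
    C.IsSimple φ ↔ ∀ s u v, C.gyroAt s ![u, v] =
      differential φ s v • u - differential φ s u • v := by
  have hd : ∀ {Y : VField r S}, Y.Smooth → ∀ s, MDifferentiableAt 𝓘(ℝ, Eu r) 𝓘(ℝ, Eu r).tangent
      (fun s => (⟨s, Y s⟩ : TangentBundle 𝓘(ℝ, Eu r) S)) s :=
    fun hY s => ContMDiff.mdifferentiable hY (by simp) s
  constructor
  · intro h s u v
    obtain ⟨Y, hY, rfl⟩ := exists_smooth_eq s u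
    obtain ⟨Z, hZ, rfl⟩ := exists_smooth_eq s v
    rw [← C.gyro_eq_gyroAt (hd hY s) (hd hZ s)]
    exact h Y Z hY hZ s
  · intro h Y Z hY hZ s
    rw [C.gyro_eq_gyroAt (hd hY s) (hd hZ s)]
    exact h s _ _

theorem simple_chart_iff (C : System n r k Q S G) {φ : S → ℝ}
    (hφ : ContMDiff 𝓘(ℝ, Eu r) 𝓘(ℝ, ℝ) ∞ φ) {s₀ : S} {x : Eu r}
    (hx : x ∈ (extChartAt 𝓘(ℝ, Eu r) s₀).target) {B : Eu r →L[ℝ] Eu r →L[ℝ] Eu r}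
    (hB : ∀ u v, toChart s₀ ((extChartAt 𝓘(ℝ, Eu r) s₀).symm x)
      (C.gyroAt ((extChartAt 𝓘(ℝ, Eu r) s₀).symm x) ![u, v]) =
        B (toChart s₀ _ u) (toChart s₀ _ v)) :
    (∀ u v, B u v = fderiv ℝ (fun x => φ ((extChartAt 𝓘(ℝ, Eu r) s₀).symm x)) x v • u -
      fderiv ℝ (fun x => φ ((extChartAt 𝓘(ℝ, Eu r) s₀).symm x)) x u • v) ↔
    ∀ u v, C.gyroAt ((extChartAt 𝓘(ℝ, Eu r) s₀).symm x) ![u, v] =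
      differential φ ((extChartAt 𝓘(ℝ, Eu r) s₀).symm x) v • u -
        differential φ ((extChartAt 𝓘(ℝ, Eu r) s₀).symm x) u • v := by
  have hs := extChartAt_symm_mem hx
  have hd := fderiv_comp_extChartAt_symm hx (hφ.mdifferentiable (by simp) _)
  constructor
  · intro h u v
    rw [← ofChart_toChart hs (C.gyroAt _ ![u, v]), hB, h, hd, hd, map_sub, map_smul, map_smul,
      ofChart_toChart hs, ofChart_toChart hs]
  · intro h u v
    have h1 := hB (ofChart s₀ _ u) (ofChart s₀ _ v)
    rw [h, ← hd, ← hd, map_sub, map_smul, map_smul, toChart_ofChart hs, toChart_ofChart hs] at h1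
    exact h1.symm

end System

/-! ### The three claims, from coordinate models. -/

namespace System

variable {n r k : ℕ} {Q S G : Type*}
  [TopologicalSpace Q] [ChartedSpace (Eu n) Q] [IsManifold 𝓘(ℝ, Eu n) ∞ Q]
  [TopologicalSpace S] [ChartedSpace (Eu r) S] [IsManifold 𝓘(ℝ, Eu r) ∞ S]
  [TopologicalSpace G] [ChartedSpace (Eu k) G] [Group G] [LieGroup 𝓘(ℝ, Eu k) ∞ G]
  [MulAction G Q] [ContMDiffSMul 𝓘(ℝ, Eu k) 𝓘(ℝ, Eu n) ∞ G Q] [ProperSMul G Q]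
  {C : System n r k Q S G} {q₀ : Q} {y : Eu n}

theorem extChartAt_cot_fst (α : Cot r S) :
    (extChartAt (cotModel r) α α).1 = extChartAt 𝓘(ℝ, Eu r) α.proj α.proj := by
  rw [extChartAt_cot_apply]

theorem extChartAt_cot_self (s : S) (p : Tan r s →L[ℝ] ℝ) :
    extChartAt (cotModel r) (⟨s, p⟩ : Cot r S) ⟨s, p⟩ = (extChartAt 𝓘(ℝ, Eu r) s s, p) := by
  rw [extChartAt_cot_apply]
  exact Prod.ext rfl (ContinuousLinearMap.ext fun v => congrArg p (ofChart_self s v))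

theorem contDiffAt_comp_chart_symm {φ : S → ℝ} (hφ : ContMDiff 𝓘(ℝ, Eu r) 𝓘(ℝ, ℝ) ∞ φ) (s : S) :
    ContDiffAt ℝ ∞ (fun x => φ ((extChartAt 𝓘(ℝ, Eu r) s).symm x))
      (extChartAt 𝓘(ℝ, Eu r) s s) :=
  contDiffAt_comp_extChartAt_symm (mem_extChartAt_target s) hφ.contMDiffAt

section Model

variable {B : Eu r → Eu r →L[ℝ] Eu r →L[ℝ] Eu r} {K : Eu r → (Eu r →L[ℝ] ℝ) →L[ℝ] Eu r}
  {V : Eu r → ℝ}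

theorem inChart_exp_smul {d : ℕ} (η : DForm (cotModel r) (Cot r S) d) (σ : S → ℝ) (α : Cot r S)
    {z : Eu r × (Eu r →L[ℝ] ℝ)} (hz : z.1 ∈ (extChartAt 𝓘(ℝ, Eu r) α.proj).target) :
    DForm.inChart (fun β : Cot r S => Real.exp (σ β.proj) • η β) α z =
      Real.exp (σ ((extChartAt 𝓘(ℝ, Eu r) α.proj).symm z.1)) • η.inChart α z := by
  rw [← extChartAt_cot_symm_proj α hz]
  rfl

theorem IsCoordinateModel.inChart_exp_smul_nhForm {α : Cot r S}
    (h : C.IsCoordinateModel α.proj B K V) (φ : S → ℝ) :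
    ∀ᶠ z in 𝓝 (extChartAt (cotModel r) α α), ∀ v,
      DForm.inChart (fun β : Cot r S => Real.exp (φ β.proj) • C.nhForm β) α z v =
        Real.exp (φ ((extChartAt 𝓘(ℝ, Eu r) α.proj).symm z.1)) *
          (modelCan r v + z.2 (B z.1 (v 0).1 (v 1).1)) := by
  filter_upwards [h.inChart_nhForm, eventually_cot α (eventually_mem_target α.proj)]
    with z hz hzt v
  rw [inChart_exp_smul C.nhForm φ α hzt, ← hz v]
  rfl

/-- A system is simple at `s` if its coordinate expression satisfies the equation there. -/
theorem IsCoordinateModel.gyroAt_eq {s : S} (h : C.IsCoordinateModel s B K V) {φ : S → ℝ}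
    (hφ : ContMDiff 𝓘(ℝ, Eu r) 𝓘(ℝ, ℝ) ∞ φ)
    (hB : ∀ u v, B (extChartAt 𝓘(ℝ, Eu r) s s) u v =
      fderiv ℝ (fun x => φ ((extChartAt 𝓘(ℝ, Eu r) s).symm x)) (extChartAt 𝓘(ℝ, Eu r) s s) v • u -
      fderiv ℝ (fun x => φ ((extChartAt 𝓘(ℝ, Eu r) s).symm x)) (extChartAt 𝓘(ℝ, Eu r) s s) u • v)
    (u v : Tan r s) :
    C.gyroAt s ![u, v] = differential φ s v • u - differential φ s u • v := by
  have h1 := (C.simple_chart_iff hφ (mem_extChartAt_target s) h.gyro_eq.self_of_nhds).1 hB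
  rw [extChartAt_to_inv] at h1
  exact h1 u v

theorem IsCoordinateModel.eventually_simple [T2Space S] {s : S} (h : C.IsCoordinateModel s B K V)
    {φ : S → ℝ} (hφ : ContMDiff 𝓘(ℝ, Eu r) 𝓘(ℝ, ℝ) ∞ φ) (hs : C.IsSimple φ) :
    ∀ᶠ x in 𝓝 (extChartAt 𝓘(ℝ, Eu r) s s), ∀ u v, B x u v =
      fderiv ℝ (fun x => φ ((extChartAt 𝓘(ℝ, Eu r) s).symm x)) x v • u -
      fderiv ℝ (fun x => φ ((extChartAt 𝓘(ℝ, Eu r) s).symm x)) x u • v := by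
  filter_upwards [h.gyro_eq, eventually_mem_target s] with x hx hxt
  exact (C.simple_chart_iff hφ hxt hx).2 fun u v => (C.isSimple_iff φ).1 hs _ u v

theorem isSimple_iff_isClosed [T2Space S] (C : System n r k Q S G) {φ : S → ℝ}
    (hφ : ContMDiff 𝓘(ℝ, Eu r) 𝓘(ℝ, ℝ) ∞ φ) :
    C.IsSimple φ ↔ DForm.IsClosed fun α : Cot r S => Real.exp (φ α.proj) • C.nhForm α := by
  rw [DForm.isClosed_iff]
  constructor
  · intro hs α
    obtain ⟨B, K, V, h⟩ := C.exists_isCoordinateModel α.proj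
    refine extDeriv_conformal_eq_zero (φ := fun x => φ ((extChartAt 𝓘(ℝ, Eu r) α.proj).symm x))
      (B := B) ?_ (h.inChart_exp_smul_nhForm φ) ?_
    · rw [extChartAt_cot_fst]
      exact contDiffAt_comp_chart_symm hφ α.proj
    · rw [extChartAt_cot_fst]
      exact h.eventually_simple hφ hs
  · intro hc
    -- Closedness at the zero covector over each `s` suffices, since the test vector `(0, b)`
    -- differentiates `p B` in `p`.
    refine (C.isSimple_iff φ).2 fun s => ?_
    obtain ⟨B, K, V, h⟩ := C.exists_isCoordinateModel s
    refine h.gyroAt_eq hφ ?_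
    have h0 := extChartAt_cot_fst (⟨s, 0⟩ : Cot r S)
    have h1 := eq_of_extDeriv_conformal_eq_zero (B := B)
      (z₀ := extChartAt (cotModel r) (⟨s, 0⟩ : Cot r S) ⟨s, 0⟩)
      (φ := fun x => φ ((extChartAt 𝓘(ℝ, Eu r) s).symm x)) ?_ ?_
      (IsCoordinateModel.inChart_exp_smul_nhForm (α := ⟨s, 0⟩) h φ) (hc ⟨s, 0⟩)
    · rw [h0] at h1
      exact h1
    · rw [h0]
      exact (contDiffAt_comp_chart_symm hφ s).differentiableAt (by simp)
    · rw [h0]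
      exact h.contDiffAt_gyro.differentiableAt (by simp)

/-- The reduced vector field in the chart at `α`. -/
def reducedFieldC (C : System n r k Q S G) (α : Cot r S) (z : Eu r × (Eu r →L[ℝ] ℝ)) :
    Eu r × (Eu r →L[ℝ] ℝ) :=
  mfderiv (cotModel r) 𝓘(ℝ, Eu r × (Eu r →L[ℝ] ℝ)) (extChartAt (cotModel r) α)
    ((extChartAt (cotModel r) α).symm z) (C.reducedField ((extChartAt (cotModel r) α).symm z))

theorem mfderiv_symm_reducedFieldC (C : System n r k Q S G) (α : Cot r S)
    {z : Eu r × (Eu r →L[ℝ] ℝ)} (hz : z ∈ (extChartAt (cotModel r) α).target) :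
    mfderiv 𝓘(ℝ, Eu r × (Eu r →L[ℝ] ℝ)) (cotModel r) (extChartAt (cotModel r) α).symm z
      (C.reducedFieldC α z) = C.reducedField ((extChartAt (cotModel r) α).symm z) := by
  have : IsManifold (cotModel r) 1 (Cot r S) := .of_le (n := ∞) (by simp)
  have h := mfderivWithin_extChartAt_symm_comp_mfderiv_extChartAt (I := cotModel r) hz
  rw [ModelWithCorners.range_eq_univ, mfderivWithin_univ] at h
  exact DFunLike.congr_fun h (C.reducedField ((extChartAt (cotModel r) α).symm z))

theorem nhForm_inChart_reducedFieldC (C : System n r k Q S G) (α : Cot r S)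
    {z : Eu r × (Eu r →L[ℝ] ℝ)} (hz : z ∈ (extChartAt (cotModel r) α).target)
    (W : Eu r × (Eu r →L[ℝ] ℝ)) :
    C.nhForm.inChart α z ![C.reducedFieldC α z, W] =
      fderiv ℝ (fun z => C.redHam ((extChartAt (cotModel r) α).symm z)) z W := by
  have h := mfderiv_comp z (C.mdifferentiableAt_redHam ((extChartAt (cotModel r) α).symm z))
    (mdifferentiableAt_extChartAt_symm hz)
  rw [mfderiv_eq_fderiv] at h
  refine Eq.trans ?_ (DFunLike.congr_fun h W).symm
  refine Eq.trans ?_ (C.nhForm_reducedField ((extChartAt (cotModel r) α).symm z)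
    (mfderiv 𝓘(ℝ, Eu r × (Eu r →L[ℝ] ℝ)) (cotModel r) (extChartAt (cotModel r) α).symm z W))
  rw [DForm.inChart_eq]
  refine congrArg (C.nhForm ((extChartAt (cotModel r) α).symm z)) ?_
  funext i
  fin_cases i
  · exact C.mfderiv_symm_reducedFieldC α hz
  · rfl

theorem IsCoordinateModel.reducedFieldC_eq {α : Cot r S} (h : C.IsCoordinateModel α.proj B K V) :
    ∀ᶠ z in 𝓝 (extChartAt (cotModel r) α α), (C.reducedFieldC α z).1 = K z.1 z.2 ∧
      ∀ v, (C.reducedFieldC α z).2 v = forceComponent K B V v z := by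
  have hK := (h.contDiffAt_cometric.of_le (m := 1) (by simp)).eventually (by simp)
  have hV := (h.contDiffAt_potential.of_le (m := 1) (by simp)).eventually (by simp)
  -- The formula for `H` is taken through `eventually_nhds`, because it has to be differentiated at
  -- every nearby `z` and so must hold around each of them.
  filter_upwards [eventually_cot α hK, eventually_cot α hV, eventually_cot α h.cometric_symm,
    h.inChart_nhForm, h.redHam_symm.eventually_nhds,
    eventually_cot α (eventually_mem_target α.proj)] with z hKz hVz hs hn hr ht
  refine eq_of_form_eq_fderiv (hKz.differentiableAt (by simp)) (hVz.differentiableAt (by simp))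
    hs fun W => ?_
  have h1 := C.nhForm_inChart_reducedFieldC α (z := z)
    (by rw [extChartAt_cot_target]; exact ⟨ht, trivial⟩) W
  rw [Filter.EventuallyEq.fderiv_eq hr, hn, modelCan_apply] at h1
  exact h1

/-- In the chart `ν` is constant, so the Lie derivative is the divergence computed in
`trace_fderiv_reduced`. The metric enters only through the velocity `K x p`, and the potential
disappears. -/
theorem IsCoordinateModel.lieDer_reducedField {α : Cot r S}
    (h : C.IsCoordinateModel α.proj B K V) {σ : S → ℝ}
    (hσ : ContMDiff 𝓘(ℝ, Eu r) 𝓘(ℝ, ℝ) ∞ σ) {x : Eu r} {p : Eu r →L[ℝ] ℝ}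
    (hα : extChartAt (cotModel r) α α = (x, p)) :
    DForm.lieDer C.reducedField
      (fun β : Cot r S => Real.exp (σ β.proj) • liouvilleVol r S β) α =
    (Real.exp (σ ((extChartAt 𝓘(ℝ, Eu r) α.proj).symm x)) *
      (fderiv ℝ (fun x => σ ((extChartAt 𝓘(ℝ, Eu r) α.proj).symm x)) x (K x p) +
        ∑ i, B x (K x p) (EuclideanSpace.single i 1) i)) • wedgePow (modelCan r) r := by
  have h0 := extChartAt_cot_fst α
  have hK := h.contDiffAt_cometric
  have hB := h.contDiffAt_gyro
  have hV := h.contDiffAt_potential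
  have hs := h.cometric_symm
  have hg := h.gyro_skew
  have hσ' := contDiffAt_comp_chart_symm hσ α.proj
  rw [← h0] at hK hB hV hs hg hσ'
  obtain ⟨hd, htr⟩ := trace_fderiv_reduced hK hs (hB.differentiableAt (by simp)) hg.self_of_nhds hV
    (hσ'.differentiableAt (by simp)) (h.reducedFieldC_eq.mono fun z hz => hz.1)
    (h.reducedFieldC_eq.mono fun z hz => hz.2)
  have ht := eventually_cot α (eventually_mem_target α.proj)
  refine (DForm.lieDer_top (by have := C.two_le; omega) (finrank_prod_dual r) C.reducedField _ α
    _ (wedgePow (modelCan r) r) (C.reducedFieldC α) ?_ ?_ hd).trans ?_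
  · filter_upwards [ht] with z hz
    rw [inChart_exp_smul _ σ α hz, inChart_liouvilleVol α hz]
  · filter_upwards [ht] with z hz
    exact (C.mfderiv_symm_reducedFieldC α
      (by rw [extChartAt_cot_target]; exact ⟨hz, trivial⟩)).symm
  · rw [htr, hα]

end Model

theorem preservesBasicMeasure_of_isSimple [T2Space S] (C : System n r k Q S G) {φ : S → ℝ}
    (hφ : ContMDiff 𝓘(ℝ, Eu r) 𝓘(ℝ, ℝ) ∞ φ) (hs : C.IsSimple φ) :
    C.PreservesBasicMeasure fun s => ((r : ℝ) - 1) * φ s := by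
  rintro ⟨s, p⟩
  obtain ⟨B, K, V, h⟩ := C.exists_isCoordinateModel s
  refine (IsCoordinateModel.lieDer_reducedField (α := ⟨s, p⟩) h
    (σ := fun s => ((r : ℝ) - 1) * φ s) (contMDiff_const.mul hφ)
    (extChartAt_cot_self s p)).trans ?_
  have hd := (contDiffAt_comp_chart_symm hφ s).differentiableAt (by simp)
  have hB := (h.eventually_simple hφ hs).self_of_nhds
  simp only [hB]
  rw [sum_simple, fderiv_const_mul hd]
  simp only [smul_apply, smul_eq_mul]
  ring_nf
  exact zero_smul ℝ _

theorem isSimple_of_preservesBasicMeasure [T2Space S] (C : System n r k Q S G) (hr : r = 2)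
    {φ : S → ℝ}
    (hφ : ContMDiff 𝓘(ℝ, Eu r) 𝓘(ℝ, ℝ) ∞ φ) (hp : C.PreservesBasicMeasure φ) :
    C.IsSimple φ := by
  subst hr
  refine (C.isSimple_iff φ).2 fun s => ?_
  obtain ⟨B, K, V, h⟩ := C.exists_isCoordinateModel s
  refine h.gyroAt_eq hφ (eq_of_trace_eq h.gyro_skew.self_of_nhds fun w => ?_)
  -- Every velocity `w` comes from some momentum `p`, so preservation along the whole fibre over `s`
  -- yields the trace identity for all `w`.
  obtain ⟨p, rfl⟩ := h.cometric_surjective.self_of_nhds w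
  have h1 := (IsCoordinateModel.lieDer_reducedField (α := ⟨s, p⟩) h hφ
    (extChartAt_cot_self s p)).symm.trans (hp ⟨s, p⟩)
  -- The volume form and the exponential do not vanish, so the divergence factor itself is zero.
  have h2 := (smul_eq_zero.1 h1).resolve_right wedgePow_modelCan_ne_zero
  exact (mul_eq_zero.1 h2).resolve_left (Real.exp_ne_zero _)

end System

end Chaplygin

end

theorem theorem3 {n r k : ℕ} {Q S G : Type*}
    [TopologicalSpace Q] [T2Space Q] [ChartedSpace (Chaplygin.Eu n) Q]
    [IsManifold 𝓘(ℝ, Chaplygin.Eu n) ∞ Q]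
    [TopologicalSpace S] [T2Space S] [ChartedSpace (Chaplygin.Eu r) S]
    [IsManifold 𝓘(ℝ, Chaplygin.Eu r) ∞ S]
    [TopologicalSpace G] [ChartedSpace (Chaplygin.Eu k) G] [Group G]
    [LieGroup 𝓘(ℝ, Chaplygin.Eu k) ∞ G]
    [MulAction G Q] [ContMDiffSMul 𝓘(ℝ, Chaplygin.Eu k) 𝓘(ℝ, Chaplygin.Eu n) ∞ G Q]
    [ProperSMul G Q]
    (C : Chaplygin.System n r k Q S G)
    (φ : S → ℝ) (hφ : ContMDiff 𝓘(ℝ, Chaplygin.Eu r) 𝓘(ℝ, ℝ) ∞ φ) :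
    (C.IsSimple φ ↔
      Chaplygin.DForm.IsClosed fun α : Chaplygin.Cot r S => Real.exp (φ α.proj) • C.nhForm α) ∧
    (C.IsSimple φ → C.PreservesBasicMeasure fun s => ((r : ℝ) - 1) * φ s) ∧
    (r = 2 → C.PreservesBasicMeasure φ → C.IsSimple φ) := by
  refine ⟨C.isSimple_iff_isClosed hφ, C.preservesBasicMeasure_of_isSimple hφ,
    fun hr hp => C.isSimple_of_preservesBasicMeasure hr hφ hp⟩
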